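/- \textbf{Theorem.} Let $(X_p)_{p\ \mathrm{prime}}$ be independent random variables, each uniformly distributed on the unit circle of $\mathbb{C}$, and for $n=\prod_p p^{\alpha(p)}\ge 1$ put $X_n=\prod_p X_p^{\alpha(p)}$. Let $k\ge 1$ be a fixed integer and let $0\le\sigma<1/2$ be fixed. Then, as $x\to\infty$, \[ \mathbb{E}\bigg[\Big|\sum_{n\le x}\frac{X_n}{n^{\sigma}}\Big|^{2k}\bigg]\sim \frac{a(k)\,\beta(k)}{(1-2\sigma)^{2k-1}}\,\frac{\Gamma(2k-1)}{\Gamma(k)^2}\,x^{k(1-2\sigma)}(\log x)^{(k-1)^2}. \] Here \[ a(k)=\prod_{p}\bigg(1-\frac1p\bigg)^{k^2}\sum_{m=0}^{\infty}\frac{d_k(p^m)^2}{p^m}, \] where $d_k(n)$ is the number of ordered $k$-tuples of positive integers with product $n$; further $\beta(1)=1$, and for $k\ge 2$ \[ \beta(k)=\frac{1}{(2\pi i)^{2k-1}}\int_{(b_{2k})}\cdots\int_{(b_2)}\bigg[\prod_{i=2}^{k}\prod_{j=k+1}^{2k}\frac{1}{s_i+s_j}\bigg]e^{s_2+\cdots+s_{2k}}\prod_{j=2}^{k}ds_j\prod_{j=k+1}^{2k}\frac{ds_j}{s_j},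 \] where $\int_{(b_j)}=\int_{b_j-i\infty}^{b_j+i\infty}$ and $b_2,\dots,b_{2k}>0$ are arbitrary. The series and the product defining $a(k)$ converge, and for $k\ge 2$ the integral defining $\beta(k)$ converges absolutely. -/

import Mathlib

open MeasureTheory ProbabilityTheory Filter Asymptotics

namespace SteinhausMoments

noncomputable section

/-- The uniform probability law on the unit circle of `ℂ`: the law of `exp (2πiθ)` for `θ` uniform
on `[0, 1]`. -/
def unitCircleLaw : Measure ℂ :=
  (volume.restrict (Set.Icc (0 : ℝ) 1)).map
    fun θ : ℝ => Complex.exp (2 * (Real.pi : ℂ) * Complex.I * (θ : ℂ))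

/-- `X 1, X 2, …` are multiplicative Steinhaus variables: the `X p` with `p` prime are independent
and uniform on the unit circle, and `X n = ∏ X p ^ α(p)` if `n = ∏ p ^ α(p)`. -/
structure IsMultiplicativeSteinhaus {Ω : Type*} [MeasurableSpace Ω] (P : Measure Ω)
    (X : ℕ → Ω → ℂ) : Prop where
  indep : iIndepFun (fun p : Nat.Primes => X (p : ℕ)) P
  law : ∀ p : Nat.Primes, HasLaw (X (p : ℕ)) unitCircleLaw P
  mult : ∀ n : ℕ, 1 ≤ n → ∀ ω : Ω, X n ω = n.factorization.prod fun p α => X p ω ^ α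

/-- The `2k`-th moment of `∑_{n ≤ x} X n / n ^ σ`. -/
def moment {Ω : Type*} [MeasurableSpace Ω] (P : Measure Ω) (X : ℕ → Ω → ℂ) (k : ℕ) (σ x : ℝ) : ℝ :=
  ∫ ω, ‖∑ n ∈ Finset.Icc 1 ⌊x⌋₊, X n ω / (((n : ℝ) ^ σ : ℝ) : ℂ)‖ ^ (2 * k) ∂P

/-- The `k`-fold divisor function: the number of ordered factorizations of `n` into `k` factors. -/
def divisorFun (k n : ℕ) : ℕ := (Nat.finMulAntidiag k n).card

/-- The terms of the series in the Euler factor of `arithFactor` at `p`. -/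
def localTerm (k p m : ℕ) : ℝ := (divisorFun k (p ^ m) : ℝ) ^ 2 / (p : ℝ) ^ m

/-- The Euler factor of `arithFactor` at `p`. -/
def eulerFactor (k p : ℕ) : ℝ := (1 - 1 / (p : ℝ)) ^ k ^ 2 * ∑' m : ℕ, localTerm k p m

/-- The Keating–Snaith arithmetic factor `a(k)`. -/
def arithFactor (k : ℕ) : ℝ := ∏' p : Nat.Primes, eulerFactor k p

/-- The index set of the `2k - 1` variables `s_2, …, s_{2k}`: the left summand indexes
`s_2, …, s_k`, the right summand indexes `s_{k+1}, …, s_{2k}`. -/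
abbrev Idx (k : ℕ) : Type := Fin (k - 1) ⊕ Fin k

/-- `∏_{i=2}^{k} ∏_{j=k+1}^{2k} (s_i + s_j)⁻¹ · e ^ (s_2 + ⋯ + s_{2k}) · ∏_{j=k+1}^{2k} s_j⁻¹`. -/
def betaIntegrand (k : ℕ) (s : Idx k → ℂ) : ℂ :=
  (∏ i : Fin (k - 1), ∏ j : Fin k, 1 / (s (Sum.inl i) + s (Sum.inr j))) *
    Complex.exp (∑ l, s l) * ∏ j : Fin k, 1 / s (Sum.inr j)

/-- The point `(b_j + i t_j)_j` on the product of the vertical lines `Re s_j = b_j`. -/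
def linePoint {k : ℕ} (b t : Idx k → ℝ) : Idx k → ℂ :=
  fun l => (b l : ℂ) + (t l : ℂ) * Complex.I

/-- `β(1) = 1`, and for `k ≥ 2` the number `β(k)` is `(2πi)^{-(2k-1)}` times the integral of
`betaIntegrand` over the vertical lines `Re s_j = b_j`; here `ds_j = i dt_j`. -/
def beta (k : ℕ) (b : Idx k → ℝ) : ℂ :=
  if k = 1 then 1
  else 1 / (2 * (Real.pi : ℂ) * Complex.I) ^ (2 * k - 1) *
    ∫ t : Idx k → ℝ, betaIntegrand k (linePoint b t) * Complex.I ^ (2 * k - 1)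

end

end SteinhausMoments

/-! Write k = m + 1 and L = log x. Orthogonality of the X n turns the moment into a sum of (∏ a_i) ^
(-2σ) over pairs of k-tuples a, b from [1, x] with ∏ a_i = ∏ b_j (`moment_eq_sum`). Such a pair is
the same thing as a k × k matrix of positive integers with row products a and column products b in
which any two entries, one strictly above and to the right of the other, are coprime
(`existsUnique_coprime_refinement`). So the moment counts, with weight, matrices with bounded row
and column products under coprimality conditions.

Without these conditions the sum is, in logarithmic coordinates, a perturbed integral of exp ((1 -
2σ) ∑ u_c) over nonnegative real matrices with all margins at most L. The mass sits where every
margin is within O(1) of L. The right coordinates are therefore the m² inner entries, scaled by L,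
and the 2m + 1 independent slacks of the margins, unscaled. The former give L ^ m² times the volume
of the Birkhoff polytope, the latter an exponential integral over a cone, equal to (2m)! / m!² / (1
- 2σ) ^ (2m + 1) (`tendsto_lintegral_latticeWeight`, `lintegral_cornerWeight`).

Coprimality at finitely many primes is periodic. All residue classes have the same asymptotics, so
it multiplies the limit by a density, a product over the primes. The density at p is the Euler
factor of a(k), because the refinement bijection at powers of p counts d_k(p^e)² (`eulerFactor_eq`,
`tendsto_sieve`). A prime p violates a condition only by dividing two entries, which costs p⁻²
uniformly in x, so the remaining primes are negligible (`sieve_le`).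

Finally β(k) is the volume of the Birkhoff polytope. The Laplace transform of the volume of
nonnegative matrices with given margins is the product of all 1 / (s_i + s_j) with s_1 = 0, and β(k)
is Fourier inversion at the point where all margins are 1 (`laplace_fiberVol`, `beta_eq`). Absolute
convergence comes from averaging over crosses of a row and a column (`integrable_prod_bracket`). -/

namespace SteinhausMoments

/-! ### Refinements of factorizations -/

/-- A divisor of `∏ j, b j` factors greedily, and uniquely so, along the `b j`. -/
theorem existsUnique_greedy_factorization (q : ℕ) (a : ℕ) (b : Fin q → ℕ) (ha : 0 < a)
    (hb : ∀ j, 0 < b j) (hab : a ∣ ∏ j, b j) :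
    ∃! r : Fin q → ℕ, (∏ j, r j = a) ∧ (∀ j, r j ∣ b j) ∧
      ∀ j j', j' < j → Nat.Coprime (r j) (b j' / r j') := by
  induction q generalizing a with
  | zero =>
    refine ⟨Fin.elim0, ⟨?_, fun j => j.elim0, fun j => j.elim0⟩, fun _ _ => Subsingleton.elim _ _⟩
    simp only [Finset.univ_eq_empty, Finset.prod_empty, Nat.dvd_one] at hab ⊢
    exact hab.symm
  | succ q ih =>
    -- The first factor is forced: the later factors are coprime to `b 0 / r 0`, so `r 0` must be
    -- the gcd of `a` and `b 0`. What is left is the same problem for `a / gcd` and the tail of `b`.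
    have key : ∀ r : Fin (q + 1) → ℕ, ((∏ j, r j = a) ∧ (∀ j, r j ∣ b j) ∧
        ∀ j j', j' < j → Nat.Coprime (r j) (b j' / r j')) ↔
        r 0 = a.gcd (b 0) ∧ (∏ j, Fin.tail r j = a / a.gcd (b 0)) ∧
          (∀ j, Fin.tail r j ∣ Fin.tail b j) ∧
          ∀ j j', j' < j → Nat.Coprime (Fin.tail r j) (Fin.tail b j' / Fin.tail r j') := by
      intro r
      have hg : 0 < a.gcd (b 0) := Nat.gcd_pos_of_pos_left _ ha
      constructor
      · rintro ⟨h1, h2, h3⟩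
        rw [Fin.prod_univ_succ] at h1
        have hr0 : 0 < r 0 := Nat.pos_of_dvd_of_pos (h2 0) (hb 0)
        have hco : Nat.Coprime (∏ j : Fin q, r j.succ) (b 0 / r 0) :=
          Nat.Coprime.prod_left fun j _ => h3 j.succ 0 (Fin.succ_pos j)
        have h0 : r 0 = a.gcd (b 0) := by
          conv_rhs => rw [← h1, ← Nat.mul_div_cancel' (h2 0), Nat.gcd_mul_left, hco.gcd_eq_one,
            mul_one]
        refine ⟨h0, ?_, fun j => h2 j.succ, fun j j' hj => h3 j.succ j'.succ
          (Fin.succ_lt_succ_iff.2 hj)⟩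
        rw [← h0, ← h1, Nat.mul_div_cancel_left _ hr0]
        rfl
      · rintro ⟨h0, h1, h2, h3⟩
        refine ⟨?_, ?_, ?_⟩
        · rw [Fin.prod_univ_succ, h0]
          exact (congrArg _ h1).trans (Nat.mul_div_cancel' (Nat.gcd_dvd_left _ _))
        · intro j
          refine Fin.cases ?_ (fun j => h2 j) j
          rw [h0]
          exact Nat.gcd_dvd_right _ _
        · intro j j'
          refine Fin.cases (fun h => absurd h (Fin.not_lt_zero _)) (fun j => ?_) j
          refine Fin.cases (fun _ => ?_) (fun j' h => h3 j j' (Fin.succ_lt_succ_iff.1 h)) j'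
          rw [h0]
          refine Nat.Coprime.coprime_dvd_left (?_ : r j.succ ∣ a / a.gcd (b 0))
            (Nat.coprime_div_gcd_div_gcd hg)
          rw [← h1]
          exact Finset.dvd_prod_of_mem (Fin.tail r) (Finset.mem_univ j)
    have hg : 0 < a.gcd (b 0) := Nat.gcd_pos_of_pos_left _ ha
    obtain ⟨s, hs, hsu⟩ := ih (a / a.gcd (b 0)) (Fin.tail b)
      (Nat.div_pos (Nat.le_of_dvd ha (Nat.gcd_dvd_left _ _)) hg) (fun j => hb j.succ) (by
        rw [Fin.prod_univ_succ] at hab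
        refine (Nat.coprime_div_gcd_div_gcd hg).dvd_of_dvd_mul_left
          (k := a / a.gcd (b 0)) (m := b 0 / a.gcd (b 0)) ?_
        have : a.gcd (b 0) * (a / a.gcd (b 0)) ∣
            a.gcd (b 0) * (b 0 / a.gcd (b 0) * ∏ i : Fin q, b i.succ) := by
          rw [← mul_assoc, Nat.mul_div_cancel' (Nat.gcd_dvd_left _ _),
            Nat.mul_div_cancel' (Nat.gcd_dvd_right _ _)]
          exact hab
        exact Nat.dvd_of_mul_dvd_mul_left hg this)
    refine ⟨Fin.cons (a.gcd (b 0)) s, (key _).2 ⟨Fin.cons_zero _ _, ?_⟩, fun r hr => ?_⟩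
    · rw [Fin.tail_cons]; exact hs
    · obtain ⟨h0, h1⟩ := (key r).1 hr
      rw [← Fin.cons_self_tail r, h0, hsu _ h1]

/-- Two factorizations of one integer have exactly one common refinement in which crossing entries
are coprime. -/
theorem existsUnique_coprime_refinement (p q : ℕ) (a : Fin p → ℕ) (b : Fin q → ℕ)
    (ha : ∀ i, 0 < a i) (hb : ∀ j, 0 < b j) (hab : ∏ i, a i = ∏ j, b j) :
    ∃! n : Fin p → Fin q → ℕ, (∀ i, ∏ j, n i j = a i) ∧ (∀ j, ∏ i, n i j = b j) ∧
      ∀ i i' j j', i < i' → j' < j → Nat.Coprime (n i j) (n i' j') := by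
  induction p generalizing b with
  | zero =>
    refine ⟨Fin.elim0, ⟨fun i => i.elim0, fun j => ?_, fun i => i.elim0⟩,
      fun _ _ => Subsingleton.elim _ _⟩
    simp only [Finset.univ_eq_empty, Finset.prod_empty] at hab ⊢
    exact (Nat.dvd_one.1 (hab ▸ Finset.dvd_prod_of_mem b (Finset.mem_univ j))).symm
  | succ p ih =>
    -- The first row must be the greedy factorization of `a 0`: the quotient `b j' / r j'` is the
    -- product of the entries below `r j'` in its column, so coprimality to it is coprimality to all
    -- of them.
    obtain ⟨r, ⟨hr1, hr2, hr3⟩, hru⟩ := existsUnique_greedy_factorization q (a 0) b (ha 0) hb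
      (hab ▸ Finset.dvd_prod_of_mem a (Finset.mem_univ 0))
    have hrpos : ∀ j, 0 < r j := fun j => Nat.pos_of_dvd_of_pos (hr2 j) (hb j)
    have hbr : (∏ j, r j) * ∏ j, b j / r j = ∏ j, b j := by
      rw [← Finset.prod_mul_distrib]
      exact Finset.prod_congr rfl fun j _ => Nat.mul_div_cancel' (hr2 j)
    obtain ⟨n, ⟨hn1, hn2, hn3⟩, hnu⟩ := ih (Fin.tail a) (fun j => b j / r j) (fun i => ha i.succ)
      (fun j => Nat.div_pos (Nat.le_of_dvd (hb j) (hr2 j)) (hrpos j)) (by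
        rw [← hab, Fin.prod_univ_succ, hr1] at hbr
        exact (Nat.eq_of_mul_eq_mul_left (ha 0) hbr).symm)
    refine ⟨Fin.cons r n, ⟨?_, ?_, ?_⟩, ?_⟩
    · intro i
      refine Fin.cases ?_ (fun i => ?_) i
      · simpa using hr1
      · simpa [Fin.tail] using hn1 i
    · intro j
      rw [Fin.prod_univ_succ]
      simp only [Fin.cons_zero, Fin.cons_succ]
      rw [hn2 j, Nat.mul_div_cancel' (hr2 j)]
    · intro i i' j j' hi hj
      induction i' using Fin.cases with
      | zero => exact absurd hi (Fin.not_lt_zero _)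
      | succ i' =>
        induction i using Fin.cases with
        | zero =>
          simp only [Fin.cons_zero, Fin.cons_succ]
          refine Nat.Coprime.coprime_dvd_right ?_ (hr3 j j' hj)
          rw [← hn2 j']
          exact Finset.dvd_prod_of_mem (fun i => n i j') (Finset.mem_univ i')
        | succ i =>
          simp only [Fin.cons_succ]
          exact hn3 i i' j j' (Fin.succ_lt_succ_iff.1 hi) hj
    · rintro N ⟨h1, h2, h3⟩
      have hdiv : ∀ j, N 0 j ∣ b j := fun j => by
        rw [← h2 j]; exact Finset.dvd_prod_of_mem (fun i => N i j) (Finset.mem_univ 0)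
      have hpos : ∀ j, 0 < N 0 j := fun j => Nat.pos_of_dvd_of_pos (hdiv j) (hb j)
      have hquot : ∀ j, b j / N 0 j = ∏ i : Fin p, N i.succ j := fun j => by
        rw [← h2 j, Fin.prod_univ_succ, Nat.mul_div_cancel_left _ (hpos j)]
      have hN0 : N 0 = r := hru _ ⟨h1 0, hdiv, fun j j' hj => by
        rw [hquot]
        exact Nat.Coprime.prod_right fun i _ => h3 0 i.succ j j' (Fin.succ_pos i) hj⟩
      have hNt : Fin.tail N = n := hnu _ ⟨fun i => h1 i.succ, fun j => by
        change ∏ i : Fin p, N i.succ j = _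
        rw [← hquot, hN0],
        fun i i' j j' hi hj => h3 i.succ i'.succ j j' (Fin.succ_lt_succ_iff.2 hi) hj⟩
      rw [← Fin.cons_self_tail N, hN0, hNt]

end SteinhausMoments

namespace SteinhausMoments

/-! ### The moments as counts of multiplicative configurations -/

theorem measurable_unitCircleParam :
    Measurable fun θ : ℝ => Complex.exp (2 * (Real.pi : ℂ) * Complex.I * (θ : ℂ)) := by
  fun_prop

theorem integral_pow_mul_conj_pow_unitCircleLaw (α β : ℕ) :
    ∫ z, z ^ α * (starRingEnd ℂ) z ^ β ∂unitCircleLaw = if α = β then 1 else 0 := by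
  rw [unitCircleLaw, integral_map measurable_unitCircleParam.aemeasurable
    (by fun_prop)]
  have h : ∀ θ : ℝ, Complex.exp (2 * (Real.pi : ℂ) * Complex.I * (θ : ℂ)) ^ α *
      (starRingEnd ℂ) (Complex.exp (2 * (Real.pi : ℂ) * Complex.I * (θ : ℂ))) ^ β =
      Complex.exp ((2 * (Real.pi : ℂ) * Complex.I * ((α : ℂ) - β)) * θ) := by
    intro θ
    rw [← Complex.exp_conj, ← Complex.exp_nat_mul, ← Complex.exp_nat_mul, ← Complex.exp_add]
    congr 1
    simp only [map_mul, Complex.conj_I, Complex.conj_ofReal, map_ofNat]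
    ring
  simp_rw [h]
  rw [integral_Icc_eq_integral_Ioc, ← intervalIntegral.integral_of_le zero_le_one]
  split_ifs with hab
  · simp [hab]
  · have hne : (2 * (Real.pi : ℂ) * Complex.I * ((α : ℂ) - β)) ≠ 0 := by
      refine mul_ne_zero Complex.two_pi_I_ne_zero (sub_ne_zero.2 ?_)
      exact_mod_cast hab
    rw [integral_exp_mul_complex hne]
    have : Complex.exp (2 * (Real.pi : ℂ) * Complex.I * ((α : ℂ) - β) * (1 : ℝ)) = 1 := by
      rw [Complex.exp_eq_one_iff]
      exact ⟨(α : ℤ) - β, by push_cast; ring⟩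
    rw [this]
    simp

theorem ae_norm_eq_one_unitCircleLaw : ∀ᵐ z ∂unitCircleLaw, ‖z‖ = 1 := by
  rw [unitCircleLaw, ae_map_iff measurable_unitCircleParam.aemeasurable
    (measurableSet_eq_fun measurable_norm measurable_const)]
  refine ae_of_all _ fun θ => ?_
  rw [show 2 * (Real.pi : ℂ) * Complex.I * (θ : ℂ) = ((2 * Real.pi * θ : ℝ) : ℂ) * Complex.I by
    push_cast; ring]
  exact Complex.norm_exp_ofReal_mul_I _

variable {Ω : Type*} [MeasurableSpace Ω] {P : Measure Ω}
  {X : ℕ → Ω → ℂ}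

namespace IsMultiplicativeSteinhaus

theorem aemeasurable (hX : IsMultiplicativeSteinhaus P X) {n : ℕ} (hn : 1 ≤ n) :
    AEMeasurable (X n) P := by
  have h : X n = fun ω => ∏ p ∈ n.primeFactors, X p ω ^ n.factorization p := by
    ext ω
    rw [hX.mult n hn ω]
    rfl
  rw [h]
  refine Finset.aemeasurable_fun_prod _ fun p hp => ?_
  exact ((hX.law ⟨p, Nat.prime_of_mem_primeFactors hp⟩).aemeasurable).pow_const _

theorem ae_norm_eq_one (hX : IsMultiplicativeSteinhaus P X) {n : ℕ} (hn : 1 ≤ n) :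
    ∀ᵐ ω ∂P, ‖X n ω‖ = 1 := by
  have h : ∀ p : Nat.Primes, ∀ᵐ ω ∂P, ‖X p ω‖ = 1 := fun p => by
    have := ae_norm_eq_one_unitCircleLaw
    rw [← (hX.law p).map_eq] at this
    exact ae_of_ae_map (hX.law p).aemeasurable this
  filter_upwards [ae_all_iff.2 h] with ω hω
  rw [hX.mult n hn ω, Finsupp.prod, norm_prod]
  refine Finset.prod_eq_one fun p hp => ?_
  rw [norm_pow, hω ⟨p, Nat.prime_of_mem_primeFactors hp⟩, one_pow]

theorem map_prod (hX : IsMultiplicativeSteinhaus P X) {ι : Type*} (s : Finset ι) (a : ι → ℕ)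
    (ha : ∀ i ∈ s, 1 ≤ a i) (ω : Ω) : X (∏ i ∈ s, a i) ω = ∏ i ∈ s, X (a i) ω := by
  have h0 : ∀ i ∈ s, a i ≠ 0 := fun i hi => Nat.one_le_iff_ne_zero.1 (ha i hi)
  rw [hX.mult _ (Nat.one_le_iff_ne_zero.2 (Finset.prod_ne_zero_iff.2 h0)),
    Nat.factorization_prod h0]
  rw [← Finsupp.prod_finsetSum_index (fun p => pow_zero _) (fun p _ _ => pow_add _ _ _)]
  exact Finset.prod_congr rfl fun i hi => (hX.mult _ (ha i hi) ω).symm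

/-- Independence splits the expectation over the primes dividing `A` or `B`. Each factor is 1 or 0
according to whether the two exponents agree, and unique factorization concludes. -/
theorem integral_mul_conj (hX : IsMultiplicativeSteinhaus P X) {A B : ℕ} (hA : 1 ≤ A)
    (hB : 1 ≤ B) :
    ∫ ω, X A ω * (starRingEnd ℂ) (X B ω) ∂P = if A = B then 1 else 0 := by
  classical
  set S := A.primeFactors ∪ B.primeFactors with hS
  have hSp : ∀ p ∈ S, p.Prime := fun p hp => by
    rcases Finset.mem_union.1 hp with h | h <;> exact Nat.prime_of_mem_primeFactors h
  let g : S → Nat.Primes := fun p => ⟨p, hSp p p.2⟩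
  have hg : Function.Injective g := fun p q h =>
    Subtype.ext (congrArg (fun r : Nat.Primes => (r : ℕ)) h)
  have hexp : ∀ ω, X A ω * (starRingEnd ℂ) (X B ω) =
      ∏ p : S, (fun z : ℂ => z ^ A.factorization p * (starRingEnd ℂ) z ^ B.factorization p)
        (X (g p) ω) := by
    intro ω
    rw [Finset.prod_coe_sort S (fun p : ℕ => X p ω ^ A.factorization p *
      (starRingEnd ℂ) (X p ω) ^ B.factorization p), Finset.prod_mul_distrib, hX.mult A hA,
      hX.mult B hB, Finsupp.prod_of_support_subset _ (s := S) Finset.subset_union_left _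
        (fun _ _ => pow_zero _), Finsupp.prod_of_support_subset B.factorization (s := S)
        Finset.subset_union_right _ (fun _ _ => pow_zero _), _root_.map_prod]
    simp only [map_pow]
  simp_rw [hexp]
  rw [(hX.indep.precomp hg).integral_fun_prod_comp (fun p => (hX.law _).aemeasurable)
    (f := fun (p : S) (z : ℂ) => z ^ A.factorization p * (starRingEnd ℂ) z ^ B.factorization p)
    (fun p => by fun_prop)]
  have hone : ∀ p : S, ∫ ω, X (g p) ω ^ A.factorization p *
      (starRingEnd ℂ) (X (g p) ω) ^ B.factorization p ∂P =
      if A.factorization p = B.factorization p then 1 else 0 := fun p => by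
    rw [← integral_pow_mul_conj_pow_unitCircleLaw, ← (hX.law (g p)).map_eq,
      integral_map (hX.law _).aemeasurable (by fun_prop)]
  rw [Finset.prod_congr rfl fun p _ => hone p, Fintype.prod_boole]
  congr 1
  refine propext ⟨fun h => ?_, fun h p => by rw [h]⟩
  refine Nat.eq_of_factorization_eq (by omega) (by omega) fun p => ?_
  by_cases hp : p ∈ S
  · exact h ⟨p, hp⟩
  · rw [hS, Finset.mem_union, not_or] at hp
    rw [← Nat.support_factorization, ← Nat.support_factorization, Finsupp.notMem_support_iff,
      Finsupp.notMem_support_iff] at hp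
    rw [hp.1, hp.2]

/-- The 2k-th power of the modulus is the k-th power of the sum times its conjugate. Complete
multiplicativity reduces each k-tuple to its product, and orthogonality keeps the pairs with equal
products. -/
theorem moment_eq_sum [IsProbabilityMeasure P] (hX : IsMultiplicativeSteinhaus P X) (k : ℕ)
    (σ x : ℝ) :
    moment P X k σ x = ∑ a ∈ Fintype.piFinset fun _ : Fin k => Finset.Icc 1 ⌊x⌋₊,
      ∑ b ∈ Fintype.piFinset fun _ : Fin k => Finset.Icc 1 ⌊x⌋₊,
        if ∏ i, a i = ∏ j, b j then ((∏ i, a i : ℕ) : ℝ) ^ (-(2 * σ)) else 0 := by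
  set I := Fintype.piFinset fun _ : Fin k => Finset.Icc 1 ⌊x⌋₊ with hI
  have hpos : ∀ a ∈ I, ∀ i, 1 ≤ a i := fun a ha i =>
    (Finset.mem_Icc.1 (Fintype.mem_piFinset.1 ha i)).1
  have hprod : ∀ a ∈ I, 1 ≤ ∏ i, a i := fun a ha =>
    Nat.one_le_iff_ne_zero.2 (Finset.prod_ne_zero_iff.2 fun i _ =>
      Nat.one_le_iff_ne_zero.1 (hpos a ha i))
  have hpow : ∀ ω, (∑ n ∈ Finset.Icc 1 ⌊x⌋₊, X n ω / (((n : ℝ) ^ σ : ℝ) : ℂ)) ^ k =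
      ∑ a ∈ I, X (∏ i, a i) ω * (((∏ i, a i : ℕ) : ℝ) ^ (-σ) : ℝ) := by
    intro ω
    rw [Finset.sum_pow']
    refine Finset.sum_congr rfl fun a ha => ?_
    rw [Finset.prod_div_distrib, hX.map_prod _ _ (fun i _ => hpos a ha i), div_eq_mul_inv]
    congr 1
    rw [Nat.cast_prod, Real.rpow_neg (Finset.prod_nonneg fun i _ => Nat.cast_nonneg _),
      ← Real.finsetProd_rpow _ _ (fun i _ => Nat.cast_nonneg _)]
    push_cast
    rfl
  have hnorm : ∀ ω, ((‖∑ n ∈ Finset.Icc 1 ⌊x⌋₊, X n ω / (((n : ℝ) ^ σ : ℝ) : ℂ)‖ ^ (2 * k) : ℝ) : ℂ)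
      = ∑ a ∈ I, ∑ b ∈ I, ((((∏ i, a i : ℕ) : ℝ) ^ (-σ) * ((∏ i, b i : ℕ) : ℝ) ^ (-σ) : ℝ) : ℂ) *
        (X (∏ i, a i) ω * (starRingEnd ℂ) (X (∏ i, b i) ω)) := by
    intro ω
    rw [mul_comm 2 k, pow_mul, ← norm_pow, hpow]
    push_cast
    rw [← Complex.mul_conj', map_sum, Finset.sum_mul_sum]
    refine Finset.sum_congr rfl fun a _ => Finset.sum_congr rfl fun b _ => ?_
    simp only [map_mul, Complex.conj_ofReal]
    ring
  have hintegrable : ∀ a ∈ I, ∀ b ∈ I,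
      Integrable (fun ω => X (∏ i, a i) ω * (starRingEnd ℂ) (X (∏ i, b i) ω)) P := by
    intro a ha b hb
    refine Integrable.of_bound (C := 1) ?_ ?_
    · exact ((hX.aemeasurable (hprod a ha)).mul
        (Complex.continuous_conj.measurable.comp_aemeasurable
          (hX.aemeasurable (hprod b hb)))).aestronglyMeasurable
    · filter_upwards [hX.ae_norm_eq_one (hprod a ha), hX.ae_norm_eq_one (hprod b hb)] with ω h1 h2
      rw [norm_mul, RCLike.norm_conj, h1, h2, mul_one]
  apply Complex.ofReal_injective
  rw [moment, ← integral_complex_ofReal]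
  simp_rw [hnorm]
  rw [integral_finsetSum _ fun a ha => integrable_finsetSum _ fun b hb =>
    (hintegrable a ha b hb).const_mul _, Complex.ofReal_sum]
  refine Finset.sum_congr rfl fun a ha => ?_
  rw [Complex.ofReal_sum, integral_finsetSum _ fun b hb => (hintegrable a ha b hb).const_mul _]
  refine Finset.sum_congr rfl fun b hb => ?_
  rw [integral_const_mul, hX.integral_mul_conj (hprod a ha) (hprod b hb)]
  split_ifs with h
  · rw [← h, mul_one, ← Real.rpow_add]
    · congr 2
      ring
    · exact_mod_cast hprod a ha
  · simp

end IsMultiplicativeSteinhaus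

end SteinhausMoments

namespace SteinhausMoments

/-! ### Matrices with prescribed margins -/

/-- The positions of a square matrix of size `m + 1`. -/
abbrev Cell (m : ℕ) : Type := Fin (m + 1) × Fin (m + 1)

/-- The inner entries of a matrix of size `m + 1`, with the row sums of the rows `≥ 1` and all
column sums. -/
abbrev Margins (m : ℕ) : Type := (Fin m × Fin m → ℝ) × (Fin m ⊕ Fin (m + 1) → ℝ)

/-- The matrix with the given inner entries and margins. -/
def completion (m : ℕ) : Margins m →ₗ[ℝ] (Cell m → ℝ) where
  toFun z c := Fin.cases (motive := fun _ => ℝ)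
    (Fin.cases (motive := fun _ => ℝ)
      (z.2 (Sum.inr 0) - ∑ i, z.2 (Sum.inl i) + ∑ i, ∑ j, z.1 (i, j))
      (fun j => z.2 (Sum.inr j.succ) - ∑ i, z.1 (i, j)) c.2)
    (fun i => Fin.cases (motive := fun _ => ℝ) (z.2 (Sum.inl i) - ∑ j, z.1 (i, j))
      (fun j => z.1 (i, j)) c.2) c.1
  map_add' z z' := by
    ext ⟨i, j⟩
    refine Fin.cases (Fin.cases ?_ (fun j => ?_) j) (fun i => Fin.cases ?_ (fun j => ?_) j) i <;>
    simp only [Prod.fst_add, Prod.snd_add, Pi.add_apply, Fin.cases_zero, Fin.cases_succ,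
      Finset.sum_add_distrib] <;> ring
  map_smul' a z := by
    ext ⟨i, j⟩
    refine Fin.cases (Fin.cases ?_ (fun j => ?_) j) (fun i => Fin.cases ?_ (fun j => ?_) j) i <;>
    simp only [Prod.smul_fst, Prod.smul_snd, Pi.smul_apply, Fin.cases_zero, Fin.cases_succ,
      smul_eq_mul, ← Finset.mul_sum, RingHom.id_apply] <;> ring

section completion

variable {m : ℕ} (z : Margins m)

theorem completion_zero_zero : completion m z (0, 0) =
    z.2 (Sum.inr 0) - ∑ i, z.2 (Sum.inl i) + ∑ i, ∑ j, z.1 (i, j) := rfl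

theorem completion_zero_succ (j : Fin m) : completion m z (0, j.succ) =
    z.2 (Sum.inr j.succ) - ∑ i, z.1 (i, j) := rfl

theorem completion_succ_zero (i : Fin m) : completion m z (i.succ, 0) =
    z.2 (Sum.inl i) - ∑ j, z.1 (i, j) := rfl

theorem completion_succ_succ (i j : Fin m) : completion m z (i.succ, j.succ) = z.1 (i, j) := rfl

theorem sum_completion_row_succ (i : Fin m) :
    ∑ j, completion m z (i.succ, j) = z.2 (Sum.inl i) := by
  rw [Fin.sum_univ_succ, completion_succ_zero]
  simp only [completion_succ_succ]
  ring

theorem sum_completion_col (j : Fin (m + 1)) :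
    ∑ i, completion m z (i, j) = z.2 (Sum.inr j) := by
  rw [Fin.sum_univ_succ]
  refine Fin.cases ?_ (fun j => ?_) j
  · simp only [completion_zero_zero, completion_succ_zero, Finset.sum_sub_distrib]
    ring
  · simp only [completion_zero_succ, completion_succ_succ]
    ring

theorem sum_completion : ∑ c, completion m z c = ∑ j, z.2 (Sum.inr j) := by
  rw [Fintype.sum_prod_type_right]
  simp only [sum_completion_col]

theorem sum_completion_row_zero : ∑ j, completion m z (0, j) =
    ∑ j, z.2 (Sum.inr j) - ∑ i, z.2 (Sum.inl i) := by
  have h := sum_completion z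
  rw [Fintype.sum_prod_type, Fin.sum_univ_succ] at h
  simp only [sum_completion_row_succ] at h
  linarith

end completion

/-- Splitting the positions of a matrix into inner ones, first column and first row. -/
def cellEquiv (m : ℕ) : (Fin m × Fin m) ⊕ (Fin m ⊕ Fin (m + 1)) ≃ Cell m where
  toFun := Sum.elim (fun p => (p.1.succ, p.2.succ))
    (Sum.elim (fun i => (i.succ, 0)) fun j => (0, j))
  invFun c := Fin.cases (motive := fun _ => (Fin m × Fin m) ⊕ (Fin m ⊕ Fin (m + 1)))
    (Sum.inr (Sum.inr c.2)) (fun i => Fin.cases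
      (motive := fun _ => (Fin m × Fin m) ⊕ (Fin m ⊕ Fin (m + 1)))
      (Sum.inr (Sum.inl i)) (fun j => Sum.inl (i, j)) c.2) c.1
  left_inv := by rintro (⟨i, j⟩ | i | j) <;> rfl
  right_inv := by
    rintro ⟨i, j⟩
    refine Fin.cases ?_ (fun i => Fin.cases ?_ (fun j => ?_) j) i <;> rfl

/-- Only the first column margin moves, by an amount that depends on the row margins alone. This is
how the margins interact in the corner entry of `completion`. -/
theorem measurePreserving_shear (m : ℕ) :
    MeasurePreserving (fun y : Fin m ⊕ Fin (m + 1) → ℝ => fun l =>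
      Sum.elim (fun i => y (Sum.inl i))
        (fun j => y (Sum.inr j) - if j = 0 then ∑ i, y (Sum.inl i) else 0) l) volume volume := by
  have h1 := volume_measurePreserving_sumPiEquivProdPi (fun _ : Fin m ⊕ Fin (m + 1) => ℝ)
  have h2 : MeasurePreserving (fun z : (Fin m → ℝ) × (Fin (m + 1) → ℝ) =>
      (z.1, z.2 - fun j => if j = 0 then ∑ i, z.1 i else 0)) volume volume := by
    refine (MeasurePreserving.id volume).skew_product (g := fun (x : Fin m → ℝ)
      (y : Fin (m + 1) → ℝ) => y - fun j => if j = 0 then ∑ i, x i else 0) ?_ ?_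
    · change Measurable fun z : (Fin m → ℝ) × (Fin (m + 1) → ℝ) =>
        z.2 - fun j => if j = 0 then ∑ i, z.1 i else 0
      refine measurable_snd.sub (measurable_pi_lambda _ fun j => ?_)
      split_ifs <;> fun_prop
    · exact ae_of_all _ fun x => (measurePreserving_sub_right volume _).map_eq
  have h3 := volume_measurePreserving_sumPiEquivProdPi_symm (fun _ : Fin m ⊕ Fin (m + 1) => ℝ)
  convert (h3.comp h2).comp h1 using 1
  ext y (i | j) <;> rfl

/-- Up to a relabelling of positions, `completion` keeps the inner entries, shears the margins and
translates them by a function of the inner entries. Hence inner entries and margins are coordinates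
with Jacobian one. -/
theorem measurePreserving_completion (m : ℕ) :
    MeasurePreserving (completion m) volume volume := by
  have h1 : MeasurePreserving (fun z : Margins m => (z.1,
      (fun l => Sum.elim (fun i => z.2 (Sum.inl i))
        (fun j => z.2 (Sum.inr j) - if j = 0 then ∑ i, z.2 (Sum.inl i) else 0) l) -
      fun l => Sum.elim (fun i => ∑ j, z.1 (i, j)) (fun j => Fin.cases (motive := fun _ => ℝ)
        (-∑ i, ∑ j, z.1 (i, j)) (fun j => ∑ i, z.1 (i, j)) j) l)) volume volume := by
    have hs := measurePreserving_shear m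
    refine (MeasurePreserving.id volume).skew_product (g := fun (x : Fin m × Fin m → ℝ)
      (y : Fin m ⊕ Fin (m + 1) → ℝ) => (fun l => Sum.elim (fun i => y (Sum.inl i))
        (fun j => y (Sum.inr j) - if j = 0 then ∑ i, y (Sum.inl i) else 0) l) -
      fun l => Sum.elim (fun i => ∑ j, x (i, j)) (fun j => Fin.cases (motive := fun _ => ℝ)
        (-∑ i, ∑ j, x (i, j)) (fun j => ∑ i, x (i, j)) j) l) ?_ ?_
    · refine (hs.measurable.comp measurable_snd).sub (measurable_pi_lambda _ fun l => ?_)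
      rcases l with i | j
      · simp only [Sum.elim_inl]
        fun_prop
      · refine Fin.cases ?_ (fun j => ?_) j
        · simp only [Sum.elim_inr, Fin.cases_zero]
          fun_prop
        · simp only [Sum.elim_inr, Fin.cases_succ]
          fun_prop
    · exact ae_of_all _ fun x => ((measurePreserving_sub_right volume _).comp hs).map_eq
  have h2 := volume_measurePreserving_sumPiEquivProdPi_symm
    (fun _ : (Fin m × Fin m) ⊕ (Fin m ⊕ Fin (m + 1)) => ℝ)
  have h3 := volume_measurePreserving_piCongrLeft (fun _ : Cell m => ℝ) (cellEquiv m)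
  have key : ∀ (f : (Fin m × Fin m) ⊕ (Fin m ⊕ Fin (m + 1)) → ℝ) a,
      MeasurableEquiv.piCongrLeft (fun _ : Cell m => ℝ) (cellEquiv m) f (cellEquiv m a) = f a :=
    fun f a => Equiv.piCongrLeft_apply_apply (fun _ : Cell m => ℝ) (cellEquiv m) f a
  convert (h3.comp h2).comp h1 using 1
  ext z c
  obtain ⟨a, rfl⟩ := (cellEquiv m).surjective c
  refine Eq.trans ?_ (key _ _).symm
  rcases a with ⟨i, j⟩ | i | j
  · rfl
  · rfl
  · refine Fin.cases ?_ (fun j => ?_) j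
    · refine (completion_zero_zero z).trans ?_
      change _ = z.2 (Sum.inr 0) - (if (0 : Fin (m + 1)) = 0 then _ else _) - (-_)
      rw [if_pos rfl, sub_neg_eq_add]
    · refine (completion_zero_succ z j).trans ?_
      change _ = z.2 (Sum.inr j.succ) - (if j.succ = 0 then _ else _) - _
      rw [if_neg (Fin.succ_ne_zero j), sub_zero]
      rfl

/-- Level sets of nonzero linear functionals are null. -/
theorem measure_linear_eq_zero {E : Type*} [NormedAddCommGroup E] [NormedSpace ℝ E]
    [MeasurableSpace E] [BorelSpace E] [FiniteDimensional ℝ E] (μ : Measure E)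
    [μ.IsAddHaarMeasure] (f : E →ₗ[ℝ] ℝ) {v : E} (hv : f v ≠ 0) (a : ℝ) :
    μ {x | f x = a} = 0 := by
  rcases Set.eq_empty_or_nonempty {x | f x = a} with h | ⟨x₀, hx₀⟩
  · rw [h, measure_empty]
  · have h : {x | f x = a} = (fun x => -x₀ + x) ⁻¹' (LinearMap.ker f : Set E) := by
      ext x
      have hx₀' : f x₀ = a := hx₀
      simp only [Set.mem_ofPred_eq, Set.mem_preimage, SetLike.mem_coe, LinearMap.mem_ker, map_add,
        map_neg, hx₀']
      constructor <;> intro h <;> linarith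
    rw [h, measure_preimage_add]
    refine Measure.addHaar_submodule μ _ fun htop => hv ?_
    rw [← LinearMap.mem_ker, htop]
    trivial

theorem ae_linear_ne {E : Type*} [NormedAddCommGroup E] [NormedSpace ℝ E]
    [MeasurableSpace E] [BorelSpace E] [FiniteDimensional ℝ E] (μ : Measure E)
    [μ.IsAddHaarMeasure] (f : E →ₗ[ℝ] ℝ) {v : E} (hv : f v ≠ 0) (a : ℝ) :
    ∀ᵐ x ∂μ, f x ≠ a :=
  measure_eq_zero_iff_ae_notMem.1 (measure_linear_eq_zero μ f hv a)

end SteinhausMoments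

namespace SteinhausMoments

open scoped ENNReal Topology

/-! ### Integrals over cones -/

/-- The indicator function of the nonnegative half-line. -/
noncomputable def heaviside (t : ℝ) : ℝ≥0∞ := if 0 ≤ t then 1 else 0

theorem heaviside_of_nonneg {t : ℝ} (h : 0 ≤ t) : heaviside t = 1 := if_pos h

theorem heaviside_of_neg {t : ℝ} (h : t < 0) : heaviside t = 0 := if_neg (not_le.2 h)

@[fun_prop]
theorem measurable_heaviside : Measurable heaviside :=
  Measurable.ite measurableSet_Ici measurable_const measurable_const

theorem prod_heaviside_eq_one {ι : Type*} {s : Finset ι} {f : ι → ℝ} (h : ∀ i ∈ s, 0 ≤ f i) :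
    ∏ i ∈ s, heaviside (f i) = 1 :=
  Finset.prod_eq_one fun i hi => heaviside_of_nonneg (h i hi)

theorem prod_heaviside_eq_zero {ι : Type*} {s : Finset ι} {f : ι → ℝ} (h : ¬∀ i ∈ s, 0 ≤ f i) :
    ∏ i ∈ s, heaviside (f i) = 0 := by
  push Not at h
  obtain ⟨i, hi, hf⟩ := h
  exact Finset.prod_eq_zero hi (heaviside_of_neg hf)

theorem heaviside_ne_top (t : ℝ) : heaviside t ≠ ∞ := by
  unfold heaviside
  split_ifs <;> simp

theorem continuousAt_heaviside {t : ℝ} (ht : t ≠ 0) : ContinuousAt heaviside t := by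
  rcases lt_or_gt_of_ne ht with h | h
  · refine (continuousAt_const (y := (0 : ℝ≥0∞))).congr ?_
    filter_upwards [gt_mem_nhds h] with s hs
    exact (heaviside_of_neg hs).symm
  · refine (continuousAt_const (y := (1 : ℝ≥0∞))).congr ?_
    filter_upwards [lt_mem_nhds h] with s hs
    exact (heaviside_of_nonneg hs.le).symm

/-- Convolution with the half-line raises s ^ n / n! by one degree; this drives the induction over
the dimension of the orthant. -/
theorem lintegral_heaviside_mul_pow (n : ℕ) (t : ℝ) :
    ∫⁻ s, heaviside (t - s) * (heaviside s * ENNReal.ofReal (s ^ n / n.factorial)) =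
      heaviside t * ENNReal.ofReal (t ^ (n + 1) / (n + 1).factorial) := by
  have h : ∀ s, heaviside (t - s) * (heaviside s * ENNReal.ofReal (s ^ n / n.factorial)) =
      (Set.Icc 0 t).indicator (fun s => ENNReal.ofReal (s ^ n / n.factorial)) s := by
    intro s
    rw [Set.indicator_apply]
    simp only [heaviside, Set.mem_Icc, sub_nonneg]
    split_ifs <;> simp_all
  simp_rw [h]
  rw [lintegral_indicator measurableSet_Icc]
  rcases lt_or_ge t 0 with ht | ht
  · rw [Set.Icc_eq_empty (not_le.2 ht), heaviside_of_neg ht]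
    simp
  · rw [heaviside_of_nonneg ht, one_mul, ← ofReal_integral_eq_lintegral_ofReal]
    · rw [integral_Icc_eq_integral_Ioc, ← intervalIntegral.integral_of_le ht,
        intervalIntegral.integral_div, integral_pow]
      congr 1
      rw [Nat.factorial_succ]
      push_cast
      field_simp
      simp
    · exact (Continuous.integrableOn_Icc (by fun_prop))
    · filter_upwards [ae_restrict_mem measurableSet_Icc] with s hs
      exact div_nonneg (pow_nonneg hs.1 _) (Nat.cast_nonneg _)

/-- Integration of a function of `∑ i, x i` over the positive orthant. -/
theorem lintegral_orthant_sum (n : ℕ) (F : ℝ → ℝ≥0∞) (hF : Measurable F) :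
    ∫⁻ x : Fin (n + 1) → ℝ, (∏ i, heaviside (x i)) * F (∑ i, x i) =
      ∫⁻ s, heaviside s * ENNReal.ofReal (s ^ n / n.factorial) * F s := by
  induction n generalizing F with
  | zero =>
    have h := (volume_preserving_piFinSuccAbove (fun _ : Fin (0 + 1) => ℝ) 0).symm
    rw [← h.lintegral_comp_emb (MeasurableEquiv.measurableEmbedding _), Measure.volume_eq_prod,
      lintegral_prod _ (by fun_prop)]
    simp [volume_pi]
  | succ n ih =>
    have e := (volume_preserving_piFinSuccAbove (fun _ : Fin (n + 1 + 1) => ℝ) 0).symm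
    rw [← e.lintegral_comp_emb (MeasurableEquiv.measurableEmbedding _)]
    have h1 : ∀ z : ℝ × (Fin (n + 1) → ℝ), (∏ i, heaviside
        ((MeasurableEquiv.piFinSuccAbove (fun _ : Fin (n + 1 + 1) => ℝ) 0).symm z i)) *
        F (∑ i, (MeasurableEquiv.piFinSuccAbove (fun _ : Fin (n + 1 + 1) => ℝ) 0).symm z i) =
        heaviside z.1 * ((∏ i, heaviside (z.2 i)) * F (z.1 + ∑ i, z.2 i)) := by
      intro z
      simp only [MeasurableEquiv.piFinSuccAbove_symm_apply, Fin.insertNthEquiv,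
        Fin.insertNth_zero, Equiv.coe_fn_mk, Fin.prod_univ_succ, Fin.sum_univ_succ, Fin.cons_zero,
        Fin.cons_succ, mul_assoc]
      rfl
    simp_rw [h1]
    rw [Measure.volume_eq_prod, lintegral_prod _ (by fun_prop)]
    -- Translation replaces the sum over the other coordinates by the total t. After the swap, the
    -- integral over `a` is the convolution of `lintegral_heaviside_mul_pow`.
    have h2 : ∀ a : ℝ, ∫⁻ y : Fin (n + 1) → ℝ,
        heaviside a * ((∏ i, heaviside (y i)) * F (a + ∑ i, y i)) =
        ∫⁻ t, heaviside a * (heaviside (t - a) *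
          ENNReal.ofReal ((t - a) ^ n / n.factorial) * F t) := by
      intro a
      rw [lintegral_const_mul _ (by fun_prop), ih (fun s => F (a + s)) (by fun_prop),
        lintegral_const_mul _ (by fun_prop),
        ← lintegral_sub_right_eq_self (fun s => heaviside s * ENNReal.ofReal (s ^ n / n.factorial) *
          F (a + s)) a]
      simp
    simp only [h2]
    rw [lintegral_lintegral_swap (by fun_prop)]
    refine lintegral_congr fun t => ?_
    rw [← lintegral_heaviside_mul_pow, ← lintegral_mul_const _ (by fun_prop),
      ← lintegral_sub_left_eq_self _ t]
    refine lintegral_congr fun a => ?_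
    simp only [sub_sub_cancel]
    ring

theorem lintegral_simplex (m : ℕ) (s : ℝ) (hs : 0 ≤ s) :
    ∫⁻ x : Fin m → ℝ, (∏ i, heaviside (x i)) * heaviside (s - ∑ i, x i) =
      ENNReal.ofReal (s ^ m / m.factorial) := by
  cases m with
  | zero => simp [heaviside_of_nonneg hs, volume_pi]
  | succ n =>
    rw [lintegral_orthant_sum n (fun t => heaviside (s - t)) (by fun_prop)]
    simp_rw [mul_comm _ (heaviside (s - _))]
    rw [lintegral_heaviside_mul_pow, heaviside_of_nonneg hs, one_mul]

/-- The slacks of the row sums of a matrix whose remaining margins have slack `y`. -/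
def rowSlack {m : ℕ} (y : Fin m ⊕ Fin (m + 1) → ℝ) (i : Fin (m + 1)) : ℝ :=
  Fin.cases (motive := fun _ => ℝ) (∑ j, y (Sum.inr j) - ∑ i, y (Sum.inl i))
    (fun i => y (Sum.inl i)) i

theorem rowSlack_zero {m : ℕ} (y : Fin m ⊕ Fin (m + 1) → ℝ) :
    rowSlack y 0 = ∑ j, y (Sum.inr j) - ∑ i, y (Sum.inl i) := rfl

theorem rowSlack_succ {m : ℕ} (y : Fin m ⊕ Fin (m + 1) → ℝ) (i : Fin m) :
    rowSlack y i.succ = y (Sum.inl i) := rfl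

@[fun_prop]
theorem measurable_rowSlack {m : ℕ} (i : Fin (m + 1)) :
    Measurable fun y : Fin m ⊕ Fin (m + 1) → ℝ => rowSlack y i := by
  refine Fin.cases ?_ (fun i => ?_) i
  · simp only [rowSlack_zero]
    fun_prop
  · simp only [rowSlack_succ]
    fun_prop

/-- The exponential weight on the cone of all slacks. -/
noncomputable def cornerWeight (m : ℕ) (τ : ℝ) (y : Fin m ⊕ Fin (m + 1) → ℝ) : ℝ≥0∞ :=
  (∏ i, heaviside (rowSlack y i)) * (∏ j, heaviside (y (Sum.inr j))) *
    ENNReal.ofReal (Real.exp (-(τ * ∑ j, y (Sum.inr j))))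

@[fun_prop]
theorem measurable_cornerWeight (m : ℕ) (τ : ℝ) : Measurable (cornerWeight m τ) := by
  unfold cornerWeight
  fun_prop

theorem lintegral_gamma (n : ℕ) (c : ℝ) (hc : 0 ≤ c) {τ : ℝ} (hτ : 0 < τ) :
    ∫⁻ s, heaviside s * ENNReal.ofReal (c * s ^ n * Real.exp (-(τ * s))) =
      ENNReal.ofReal (c * (n.factorial / τ ^ (n + 1))) := by
  have h : ∀ s, heaviside s * ENNReal.ofReal (c * s ^ n * Real.exp (-(τ * s))) =
      (Set.Ici 0).indicator (fun s => ENNReal.ofReal (c * s ^ n * Real.exp (-(τ * s)))) s := by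
    intro s
    rw [Set.indicator_apply]
    simp only [heaviside, Set.mem_Ici]
    split_ifs <;> simp
  have key := Real.integral_rpow_mul_exp_neg_mul_Ioi (a := (n : ℝ) + 1) (r := τ) (by positivity) hτ
  simp only [add_sub_cancel_right, Real.rpow_natCast, Real.Gamma_nat_eq_factorial] at key
  have hval : (1 / τ) ^ ((n : ℝ) + 1) * (n.factorial : ℝ) = n.factorial / τ ^ (n + 1) := by
    rw [show (n : ℝ) + 1 = ((n + 1 : ℕ) : ℝ) by push_cast; ring, Real.rpow_natCast, one_div,
      inv_pow]
    field_simp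
  rw [hval] at key
  have hintegrable : IntegrableOn (fun s : ℝ => s ^ n * Real.exp (-(τ * s))) (Set.Ioi 0) :=
    Integrable.of_integral_ne_zero (by rw [key]; positivity)
  simp_rw [h]
  rw [lintegral_indicator measurableSet_Ici, setLIntegral_congr Ioi_ae_eq_Ici.symm,
    ← key, ← integral_const_mul, ofReal_integral_eq_lintegral_ofReal (hintegrable.const_mul c)]
  · simp only [mul_assoc]
  · filter_upwards [ae_restrict_mem measurableSet_Ioi] with s hs
    have hs' : (0 : ℝ) < s := hs
    simp only [Pi.zero_apply]
    positivity

/-- Given column slacks with total s, the row slacks other than the first range over a simplex of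
volume s ^ m / m!, the first being determined. The column slacks with total s have density s ^ m /
m! as well. A gamma integral in s remains. -/
theorem lintegral_cornerWeight (m : ℕ) {τ : ℝ} (hτ : 0 < τ) :
    ∫⁻ y, cornerWeight m τ y =
      ENNReal.ofReal ((2 * m).factorial / (m.factorial : ℝ) ^ 2 / τ ^ (2 * m + 1)) := by
  have e := volume_measurePreserving_sumPiEquivProdPi_symm (fun _ : Fin m ⊕ Fin (m + 1) => ℝ)
  rw [← e.lintegral_comp_emb (MeasurableEquiv.measurableEmbedding _)]
  have h1 : ∀ z : (Fin m → ℝ) × (Fin (m + 1) → ℝ), cornerWeight m τ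
      ((MeasurableEquiv.sumPiEquivProdPi (fun _ : Fin m ⊕ Fin (m + 1) => ℝ)).symm z) =
      (∏ i, heaviside (z.1 i)) * heaviside (∑ j, z.2 j - ∑ i, z.1 i) *
        ((∏ j, heaviside (z.2 j)) * ENNReal.ofReal (Real.exp (-(τ * ∑ j, z.2 j)))) := by
    intro z
    rw [cornerWeight, Fin.prod_univ_succ]
    simp only [rowSlack_zero, rowSlack_succ]
    change heaviside (∑ j, z.2 j - ∑ i, z.1 i) * (∏ i, heaviside (z.1 i)) *
      (∏ j, heaviside (z.2 j)) * ENNReal.ofReal (Real.exp (-(τ * ∑ j, z.2 j))) = _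
    ring
  simp_rw [h1]
  rw [Measure.volume_eq_prod, lintegral_prod_symm _ (by fun_prop)]
  have h2 : ∀ y : Fin (m + 1) → ℝ, ∫⁻ x : Fin m → ℝ,
      (∏ i, heaviside (x i)) * heaviside (∑ j, y j - ∑ i, x i) *
        ((∏ j, heaviside (y j)) * ENNReal.ofReal (Real.exp (-(τ * ∑ j, y j)))) =
      (∏ j, heaviside (y j)) * (fun s => ENNReal.ofReal
        (s ^ m / m.factorial * Real.exp (-(τ * s)))) (∑ j, y j) := by
    intro y
    rw [lintegral_mul_const _ (by fun_prop)]
    by_cases hy : ∀ j ∈ Finset.univ, 0 ≤ y j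
    · have hs : 0 ≤ ∑ j, y j := Finset.sum_nonneg hy
      rw [lintegral_simplex m _ hs, mul_left_comm, ← ENNReal.ofReal_mul (by positivity)]
    · rw [prod_heaviside_eq_zero hy, zero_mul, zero_mul, mul_zero]
  simp only [h2]
  rw [lintegral_orthant_sum m (fun s => ENNReal.ofReal
        (s ^ m / m.factorial * Real.exp (-(τ * s)))) (by fun_prop)]
  have h3 : ∀ s : ℝ, heaviside s * ENNReal.ofReal (s ^ m / m.factorial) *
      ENNReal.ofReal (s ^ m / m.factorial * Real.exp (-(τ * s))) = heaviside s *
      ENNReal.ofReal (((m.factorial : ℝ) ^ 2)⁻¹ * s ^ (2 * m) * Real.exp (-(τ * s))) := by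
    intro s
    rcases lt_or_ge s 0 with hs | hs
    · rw [heaviside_of_neg hs, zero_mul, zero_mul, zero_mul]
    · rw [mul_assoc, ← ENNReal.ofReal_mul (by positivity)]
      congr 2
      field_simp
      ring
  simp_rw [h3]
  rw [lintegral_gamma _ _ (by positivity) hτ]
  congr 1
  field_simp

end SteinhausMoments

namespace SteinhausMoments

open scoped ENNReal Topology

/-! ### Perturbed exponential integrals over matrices with bounded margins -/

/-- The weight `exp (∑ (1 - 2σ) u_c)` on the matrices with entries at least `v₀` and margins at most
`L`, where the entries `u_c` of the matrix are perturbed by `θ_c (u_c)`. -/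
noncomputable def latticeWeight {m : ℕ} (σ : ℝ) (θ : Cell m → ℝ → ℝ) (v₀ : Cell m → ℝ) (L : ℝ)
    (u : Cell m → ℝ) : ℝ≥0∞ :=
  (∏ c, heaviside (u c - v₀ c)) *
    (∏ i, heaviside (L - ∑ j, (u (i, j) - θ (i, j) (u (i, j))))) *
    (∏ j, heaviside (L - ∑ i, (u (i, j) - θ (i, j) (u (i, j))))) *
    ENNReal.ofReal (Real.exp (∑ c, (u c - 2 * σ * (u c - θ c (u c)))))

/-- The matrix with inner entries `L w` whose margins have the slacks `y` with respect to `L`. -/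
def scaledMatrix {m : ℕ} (L : ℝ) (z : Margins m) : Cell m → ℝ :=
  completion m (L • z.1, (fun _ => L) - z.2)

/-- `latticeWeight` in the coordinates of `scaledMatrix`, divided by its size. -/
noncomputable def scaledWeight {m : ℕ} (σ : ℝ) (θ : Cell m → ℝ → ℝ) (v₀ : Cell m → ℝ) (L : ℝ)
    (z : Margins m) : ℝ≥0∞ :=
  (∏ c, heaviside (scaledMatrix L z c - v₀ c)) *
    (∏ i, heaviside (rowSlack z.2 i + ∑ j, θ (i, j) (scaledMatrix L z (i, j)))) *
    (∏ j, heaviside (z.2 (Sum.inr j) + ∑ i, θ (i, j) (scaledMatrix L z (i, j)))) *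
    ENNReal.ofReal (Real.exp (-((1 - 2 * σ) * ∑ j, z.2 (Sum.inr j)) +
      2 * σ * ∑ c, θ c (scaledMatrix L z c)))

/-- An integrable majorant of `scaledWeight`. -/
noncomputable def scaledMajorant (m : ℕ) (σ C : ℝ) (z : Margins m) : ℝ≥0∞ :=
  (Set.Icc (0 : Fin m × Fin m → ℝ) fun _ => 1 + (m + 1) * C).indicator 1 z.1 *
    (ENNReal.ofReal (Real.exp ((1 - 2 * σ) * ((m + 1) * ((m + 1) * C)) +
      2 * σ * ((m + 1) * ((m + 1) * C)))) *
    cornerWeight m (1 - 2 * σ) (z.2 + fun _ => (m + 1) * C))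

/-- The inner entries of the doubly stochastic matrices. -/
def birkhoff (m : ℕ) : Set (Fin m × Fin m → ℝ) :=
  {w | ∀ c, 0 ≤ completion m (w, fun _ => 1) c}

variable {m : ℕ}

theorem measurable_completion : Measurable (completion m) :=
  (measurePreserving_completion m).measurable

theorem measurable_scaledMatrix (L : ℝ) : Measurable (scaledMatrix (m := m) L) :=
  measurable_completion.comp (by fun_prop)

@[fun_prop]
theorem measurable_scaledMatrix_apply (L : ℝ) (c : Cell m) :
    Measurable fun z => scaledMatrix (m := m) L z c :=
  (measurable_pi_apply c).comp (measurable_scaledMatrix L)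

theorem measurable_latticeWeight (σ : ℝ) {θ : Cell m → ℝ → ℝ} (hθ : ∀ c, Measurable (θ c))
    (v₀ : Cell m → ℝ) (L : ℝ) : Measurable (latticeWeight σ θ v₀ L) := by
  unfold latticeWeight
  fun_prop

theorem measurable_scaledWeight (σ : ℝ) {θ : Cell m → ℝ → ℝ} (hθ : ∀ c, Measurable (θ c))
    (v₀ : Cell m → ℝ) (L : ℝ) : Measurable (scaledWeight σ θ v₀ L) := by
  unfold scaledWeight
  fun_prop

/-- Linearity separates the growing part of an entry from a part independent of `L`; the sign of the
former decides whether the entry tends to +∞ or -∞. -/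
theorem scaledMatrix_eq (L : ℝ) (z : Margins m) (c : Cell m) :
    scaledMatrix L z c = L * completion m (z.1, fun _ => 1) c - completion m (0, z.2) c := by
  have h : ((L • z.1, (fun _ => L) - z.2) : Margins m) =
      L • ((z.1, fun _ => 1) : Margins m) - ((0, z.2) : Margins m) := by
    ext <;> simp
  rw [scaledMatrix, h, map_sub, map_smul]
  rfl

theorem sum_scaledMatrix_row (L : ℝ) (z : Margins m) (i : Fin (m + 1)) :
    ∑ j, scaledMatrix L z (i, j) = L - rowSlack z.2 i := by
  refine Fin.cases ?_ (fun i => ?_) i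
  · simp only [scaledMatrix, sum_completion_row_zero, rowSlack_zero, Pi.sub_apply,
      Finset.sum_sub_distrib, Finset.sum_const, Finset.card_univ, Fintype.card_fin, nsmul_eq_mul]
    push_cast
    ring
  · simp only [scaledMatrix, sum_completion_row_succ, rowSlack_succ, Pi.sub_apply]

theorem sum_scaledMatrix_col (L : ℝ) (z : Margins m) (j : Fin (m + 1)) :
    ∑ i, scaledMatrix L z (i, j) = L - z.2 (Sum.inr j) := by
  simp only [scaledMatrix, sum_completion_col, Pi.sub_apply]

theorem sum_scaledMatrix (L : ℝ) (z : Margins m) :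
    ∑ c, scaledMatrix L z c = (m + 1) * L - ∑ j, z.2 (Sum.inr j) := by
  rw [Fintype.sum_prod_type_right]
  simp only [sum_scaledMatrix_col, Finset.sum_sub_distrib, Finset.sum_const, Finset.card_univ,
    Fintype.card_fin, nsmul_eq_mul]
  push_cast
  ring

/-- The entries add up to (m + 1) L minus the column slacks, so the exponential of the leading term
factors out and only slacks and perturbations remain. -/
theorem latticeWeight_scaledMatrix (σ : ℝ) (θ : Cell m → ℝ → ℝ) (v₀ : Cell m → ℝ) (L : ℝ)
    (z : Margins m) : latticeWeight σ θ v₀ L (scaledMatrix L z) =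
      ENNReal.ofReal (Real.exp ((1 - 2 * σ) * ((m + 1) * L))) * scaledWeight σ θ v₀ L z := by
  rw [latticeWeight, scaledWeight, mul_left_comm, ← ENNReal.ofReal_mul (Real.exp_nonneg _),
    ← Real.exp_add]
  have hr : ∀ i, L - ∑ j, (scaledMatrix L z (i, j) - θ (i, j) (scaledMatrix L z (i, j))) =
      rowSlack z.2 i + ∑ j, θ (i, j) (scaledMatrix L z (i, j)) := fun i => by
    rw [Finset.sum_sub_distrib, sum_scaledMatrix_row]
    ring
  have hc : ∀ j, L - ∑ i, (scaledMatrix L z (i, j) - θ (i, j) (scaledMatrix L z (i, j))) =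
      z.2 (Sum.inr j) + ∑ i, θ (i, j) (scaledMatrix L z (i, j)) := fun j => by
    rw [Finset.sum_sub_distrib, sum_scaledMatrix_col]
    ring
  have he : ∑ c, (scaledMatrix L z c - 2 * σ * (scaledMatrix L z c - θ c (scaledMatrix L z c))) =
      (1 - 2 * σ) * ((m + 1) * L) + (-((1 - 2 * σ) * ∑ j, z.2 (Sum.inr j)) +
        2 * σ * ∑ c, θ c (scaledMatrix L z c)) := by
    rw [Finset.sum_sub_distrib, ← Finset.mul_sum, Finset.sum_sub_distrib, sum_scaledMatrix]
    ring
  simp_rw [hr, hc, he]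

theorem lintegral_comp_smul {ι : Type*} [Fintype ι] (F : (ι → ℝ) → ℝ≥0∞) (hF : Measurable F)
    {L : ℝ} (hL : 0 < L) :
    ∫⁻ w, F w = ENNReal.ofReal (L ^ Fintype.card ι) * ∫⁻ w, F (L • w) := by
  have h := Measure.map_addHaar_smul (volume : Measure (ι → ℝ)) hL.ne'
  have h2 : ∫⁻ w, F (L • w) = ∫⁻ w, F w ∂(Measure.map (L • ·) volume) :=
    (lintegral_map hF (measurable_const_smul L)).symm
  rw [h2, h, lintegral_smul_measure, smul_eq_mul, ← mul_assoc,
    ← ENNReal.ofReal_mul (by positivity), Module.finrank_fintype_fun_eq_card, abs_of_nonneg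
      (by positivity), mul_inv_cancel₀ (by positivity), ENNReal.ofReal_one, one_mul]

/-- The power of `L` is the Jacobian of scaling the m² inner entries; passing to margins and then to
slacks preserves the measure. -/
theorem lintegral_latticeWeight (σ : ℝ) {θ : Cell m → ℝ → ℝ} (hθ : ∀ c, Measurable (θ c))
    (v₀ : Cell m → ℝ) {L : ℝ} (hL : 0 < L) :
    ∫⁻ u, latticeWeight σ θ v₀ L u =
      ENNReal.ofReal (Real.exp ((1 - 2 * σ) * ((m + 1) * L)) * L ^ m ^ 2) *
        ∫⁻ z, scaledWeight σ θ v₀ L z := by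
  have hm := measurable_latticeWeight σ hθ v₀ L
  have hm1 : Measurable fun z : Margins m => latticeWeight σ θ v₀ L (completion m z) :=
    hm.comp measurable_completion
  have hm2 : Measurable fun z : Margins m =>
      latticeWeight σ θ v₀ L (completion m (z.1, (fun _ => L) - z.2)) :=
    hm1.comp (by fun_prop)
  have hm3 := measurable_scaledWeight σ hθ v₀ L
  rw [← (measurePreserving_completion m).lintegral_comp hm, Measure.volume_eq_prod,
    lintegral_prod _ hm1.aemeasurable]
  have h1 : ∀ w : Fin m × Fin m → ℝ, ∫⁻ y, latticeWeight σ θ v₀ L (completion m (w, y)) =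
      ∫⁻ y, latticeWeight σ θ v₀ L (completion m (w, (fun _ => L) - y)) := fun w =>
    (lintegral_sub_left_eq_self (fun y => latticeWeight σ θ v₀ L (completion m (w, y)))
      (fun _ => L)).symm
  simp_rw [h1]
  rw [lintegral_comp_smul _ hm2.lintegral_prod_right' hL]
  have h2 : ∀ w : Fin m × Fin m → ℝ, ∀ y, latticeWeight σ θ v₀ L
      (completion m (L • w, (fun _ => L) - y)) =
      ENNReal.ofReal (Real.exp ((1 - 2 * σ) * ((m + 1) * L))) * scaledWeight σ θ v₀ L (w, y) :=
    fun w y => latticeWeight_scaledMatrix σ θ v₀ L (w, y)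
  simp_rw [h2]
  rw [← lintegral_prod (fun z : Margins m =>
    ENNReal.ofReal (Real.exp ((1 - 2 * σ) * ((m + 1) * L))) * scaledWeight σ θ v₀ L z)
    (by fun_prop), lintegral_const_mul _ hm3, ← mul_assoc, ← ENNReal.ofReal_mul (by positivity)]
  simp only [Fintype.card_prod, Fintype.card_fin]
  rw [mul_comm (L ^ _), ← pow_two]

theorem lintegral_scaledMajorant_ne_top {σ : ℝ} (hσ : σ < 1 / 2) (C : ℝ) :
    ∫⁻ z, scaledMajorant m σ C z ≠ ∞ := by
  unfold scaledMajorant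
  rw [Measure.volume_eq_prod, lintegral_prod_mul
    (f := (Set.Icc (0 : Fin m × Fin m → ℝ) fun _ => 1 + (m + 1) * C).indicator 1)
    (g := fun y => ENNReal.ofReal (Real.exp ((1 - 2 * σ) * ((m + 1) * ((m + 1) * C)) +
      2 * σ * ((m + 1) * ((m + 1) * C)))) *
        cornerWeight m (1 - 2 * σ) (y + fun _ => (m + 1) * C))
    ((measurable_one.indicator measurableSet_Icc).aemeasurable) (by fun_prop)]
  refine ENNReal.mul_ne_top ?_ ?_
  · rw [lintegral_indicator_one measurableSet_Icc]
    exact isCompact_Icc.measure_ne_top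
  · rw [lintegral_const_mul _ (by fun_prop),
      lintegral_add_right_eq_self (fun y => cornerWeight m (1 - 2 * σ) y) (fun _ => (m + 1) * C),
      lintegral_cornerWeight m (by linarith)]
    exact ENNReal.mul_ne_top ENNReal.ofReal_ne_top ENNReal.ofReal_ne_top

theorem rowSlack_add_const (y : Fin m ⊕ Fin (m + 1) → ℝ) (C : ℝ) (i : Fin (m + 1)) :
    rowSlack (y + fun _ => C) i = rowSlack y i + C := by
  refine Fin.cases ?_ (fun i => ?_) i
  · simp only [rowSlack_zero, Pi.add_apply, Finset.sum_add_distrib, Finset.sum_const,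
      Finset.card_univ, Fintype.card_fin, nsmul_eq_mul]
    push_cast
    ring
  · simp only [rowSlack_succ, Pi.add_apply]

theorem sum_le_card_mul {θ : Cell m → ℝ → ℝ} {C : ℝ} (hC : ∀ c v, θ c v ≤ C)
    (f : Fin (m + 1) → Cell m) (u : Fin (m + 1) → ℝ) :
    ∑ j, θ (f j) (u j) ≤ (m + 1) * C := by
  refine (Finset.sum_le_sum fun j _ => hC (f j) (u j)).trans ?_
  simp

/-- The perturbations change each slack by at most (m + 1) C, so on the support the slacks
translated by this amount lie in the cone of `cornerWeight`. The inner entries are nonnegative and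
bounded by a row sum, hence lie in a fixed box after division by L ≥ 1. -/
theorem scaledWeight_le {σ : ℝ} (hσ₀ : 0 ≤ σ) {θ : Cell m → ℝ → ℝ} {v₀ : Cell m → ℝ} {C : ℝ}
    (hθ₀ : ∀ c v, 0 ≤ θ c v) (hC : ∀ c v, θ c v ≤ C) (hv₀ : ∀ c, 0 ≤ v₀ c) {L : ℝ} (hL : 1 ≤ L)
    (z : Margins m) : scaledWeight σ θ v₀ L z ≤ scaledMajorant m σ C z := by
  have hC₀ : 0 ≤ C := (hθ₀ (0, 0) 0).trans (hC (0, 0) 0)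
  by_cases h1 : ∀ c ∈ Finset.univ, 0 ≤ scaledMatrix L z c - v₀ c
  swap
  · rw [scaledWeight, prod_heaviside_eq_zero h1, zero_mul, zero_mul, zero_mul]
    exact zero_le
  by_cases h2 : ∀ i ∈ Finset.univ,
      0 ≤ rowSlack z.2 i + ∑ j, θ (i, j) (scaledMatrix L z (i, j))
  swap
  · rw [scaledWeight, prod_heaviside_eq_zero h2, mul_zero, zero_mul, zero_mul]
    exact zero_le
  by_cases h3 : ∀ j ∈ Finset.univ,
      0 ≤ z.2 (Sum.inr j) + ∑ i, θ (i, j) (scaledMatrix L z (i, j))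
  swap
  · rw [scaledWeight, prod_heaviside_eq_zero h3, mul_zero, zero_mul]
    exact zero_le
  have hr : ∀ i, 0 ≤ rowSlack z.2 i + (m + 1) * C := fun i =>
    (h2 i (Finset.mem_univ i)).trans (by gcongr; exact sum_le_card_mul hC _ _)
  have hc : ∀ j, 0 ≤ z.2 (Sum.inr j) + (m + 1) * C := fun j =>
    (h3 j (Finset.mem_univ j)).trans (by gcongr; exact sum_le_card_mul hC _ _)
  have hu : ∀ c, 0 ≤ scaledMatrix L z c := fun c =>
    (hv₀ c).trans (sub_nonneg.1 (h1 c (Finset.mem_univ c)))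
  have hw : z.1 ∈ Set.Icc (0 : Fin m × Fin m → ℝ) fun _ => 1 + (m + 1) * C := by
    have key : ∀ p : Fin m × Fin m, scaledMatrix L z (p.1.succ, p.2.succ) = L * z.1 p :=
      fun p => rfl
    refine ⟨fun p => ?_, fun p => ?_⟩
    · have := hu (p.1.succ, p.2.succ)
      rw [key] at this
      exact nonneg_of_mul_nonneg_right this (by linarith)
    · have h4 : scaledMatrix L z (p.1.succ, p.2.succ) ≤
          ∑ j, scaledMatrix L z (p.1.succ, j) :=
        Finset.single_le_sum (f := fun j => scaledMatrix L z (p.1.succ, j))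
          (fun j _ => hu _) (Finset.mem_univ p.2.succ)
      rw [key, sum_scaledMatrix_row] at h4
      have h5 := hr p.1.succ
      have h6 : (0 : ℝ) ≤ (m + 1) * C := by positivity
      have h7 : (m + 1) * C ≤ L * ((m + 1) * C) := le_mul_of_one_le_left h6 hL
      refine le_of_mul_le_mul_left (a := L) ?_ (by linarith)
      linarith
  rw [scaledWeight, prod_heaviside_eq_one h1, prod_heaviside_eq_one h2, prod_heaviside_eq_one h3,
    scaledMajorant, Set.indicator_of_mem hw, cornerWeight, prod_heaviside_eq_one
      (fun i _ => by rw [rowSlack_add_const]; exact hr i),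
    prod_heaviside_eq_one (fun j _ => by simpa using hc j)]
  simp only [one_mul, Pi.one_apply]
  rw [← ENNReal.ofReal_mul (Real.exp_nonneg _), ← Real.exp_add]
  refine ENNReal.ofReal_le_ofReal (Real.exp_le_exp.2 ?_)
  have h8 : ∑ c, θ c (scaledMatrix L z c) ≤ (m + 1) * ((m + 1) * C) := by
    refine (Finset.sum_le_sum fun c _ => hC c _).trans ?_
    simp only [Finset.sum_const, Finset.card_univ, Fintype.card_prod, Fintype.card_fin,
      nsmul_eq_mul]
    push_cast
    exact le_of_eq (by ring)
  have h9 : 2 * σ * ∑ c, θ c (scaledMatrix L z c) ≤ 2 * σ * ((m + 1) * ((m + 1) * C)) :=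
    mul_le_mul_of_nonneg_left h8 (by linarith)
  simp only [Pi.add_apply, Finset.sum_add_distrib, Finset.sum_const, Finset.card_univ,
    Fintype.card_fin, nsmul_eq_mul]
  push_cast
  linarith

/-- A bound for the integral of `latticeWeight` that depends on the perturbation only through its
size. -/
theorem lintegral_latticeWeight_le {σ : ℝ} (hσ₀ : 0 ≤ σ) {θ : Cell m → ℝ → ℝ} {v₀ : Cell m → ℝ}
    {C : ℝ} (hθ : ∀ c, Measurable (θ c)) (hθ₀ : ∀ c v, 0 ≤ θ c v) (hC : ∀ c v, θ c v ≤ C)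
    (hv₀ : ∀ c, 0 ≤ v₀ c) {L : ℝ} (hL : 1 ≤ L) :
    ∫⁻ u, latticeWeight σ θ v₀ L u ≤
      ENNReal.ofReal (Real.exp ((1 - 2 * σ) * ((m + 1) * L)) * L ^ m ^ 2) *
        ∫⁻ z, scaledMajorant m σ C z := by
  rw [lintegral_latticeWeight σ hθ v₀ (by linarith)]
  gcongr with z
  exact scaledWeight_le hσ₀ hθ₀ hC hv₀ hL z

/-- With margins 1 an entry is affine in the inner entries, so its zero set is null unless it
vanishes identically, which is excluded here. The constant term of the corner entry is 1 - m, which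
can vanish; hence the case distinction. -/
theorem completion_ne_zero (c : Cell m) :
    (∃ w, completion m (w, 0) c ≠ 0) ∨ completion m (0, fun _ => 1) c ≠ 0 := by
  obtain ⟨i, j⟩ := c
  refine Fin.cases (Fin.cases ?_ (fun j => ?_) j) (fun i => Fin.cases ?_ (fun j => ?_) j) i
  · rcases Nat.eq_zero_or_pos m with rfl | hm
    · right
      simp [completion_zero_zero]
    · left
      refine ⟨fun _ => 1, ?_⟩
      simp [completion_zero_zero, hm.ne']
  · right
    simp [completion_zero_succ]
  · right
    simp [completion_succ_zero]
  · left
    refine ⟨fun _ => 1, ?_⟩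
    simp [completion_succ_succ]

theorem ae_completion_one_ne_zero (c : Cell m) :
    ∀ᵐ w : Fin m × Fin m → ℝ, completion m (w, fun _ => 1) c ≠ 0 := by
  let f : (Fin m × Fin m → ℝ) →ₗ[ℝ] ℝ :=
    LinearMap.proj c ∘ₗ completion m ∘ₗ LinearMap.inl ℝ _ _
  have hf : ∀ w, completion m (w, fun _ => 1) c = f w + completion m (0, fun _ => 1) c := by
    intro w
    have : ((w, fun _ => 1) : Margins m) = (w, 0) + (0, fun _ => 1) := by ext <;> simp
    rw [this, map_add]
    rfl
  by_cases h : ∃ v, f v ≠ 0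
  · obtain ⟨v, hv⟩ := h
    filter_upwards [ae_linear_ne volume f hv (-completion m (0, fun _ => 1) c)] with w hw
    rw [hf]
    contrapose! hw
    linarith
  · refine ae_of_all _ fun w => ?_
    have h' := (completion_ne_zero c).resolve_left h
    push Not at h
    rwa [hf, h w, zero_add]

theorem ae_rowSlack_ne_zero (i : Fin (m + 1)) :
    ∀ᵐ y : Fin m ⊕ Fin (m + 1) → ℝ, rowSlack y i ≠ 0 := by
  have key : ∀ f : (Fin m ⊕ Fin (m + 1) → ℝ) →ₗ[ℝ] ℝ, (∀ y, rowSlack y i = f y) →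
      f (fun _ => 1) ≠ 0 → ∀ᵐ y : Fin m ⊕ Fin (m + 1) → ℝ, rowSlack y i ≠ 0 := by
    intro f hf hne
    filter_upwards [ae_linear_ne volume f hne 0] with y hy
    rwa [hf]
  revert key
  refine Fin.cases (fun key => ?_) (fun i key => ?_) i
  · exact key (∑ j, LinearMap.proj (Sum.inr j) - ∑ i, LinearMap.proj (Sum.inl i))
      (fun y => by simp [rowSlack_zero]) (by simp)
  · exact key (LinearMap.proj (Sum.inl i)) (fun y => by simp [rowSlack_succ]) (by simp)

theorem ae_apply_ne_zero {ι : Type*} [Fintype ι] (l : ι) : ∀ᵐ y : ι → ℝ, y l ≠ 0 :=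
  ae_linear_ne volume (LinearMap.proj l : (ι → ℝ) →ₗ[ℝ] ℝ) (v := fun _ => 1) (by simp) 0

/-- Inside the polytope all entries tend to infinity, so the perturbations die out and the lower
bounds `v₀` are eventually met. Outside, some entry tends to -∞ and the weight is eventually zero.
The hypotheses exclude the boundary of the polytope and the jumps of `heaviside`. -/
theorem tendsto_scaledWeight {σ : ℝ} {θ : Cell m → ℝ → ℝ} {v₀ : Cell m → ℝ}
    (hlim : ∀ c, Tendsto (θ c) atTop (𝓝 0)) {z : Margins m}
    (h1 : ∀ c, completion m (z.1, fun _ => 1) c ≠ 0) (h2 : ∀ i, rowSlack z.2 i ≠ 0)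
    (h3 : ∀ j, z.2 (Sum.inr j) ≠ 0) :
    Tendsto (fun L => scaledWeight σ θ v₀ L z) atTop
      (𝓝 ((birkhoff m).indicator 1 z.1 * cornerWeight m (1 - 2 * σ) z.2)) := by
  by_cases hz : z.1 ∈ birkhoff m
  · have hu : ∀ c, Tendsto (fun L => scaledMatrix L z c) atTop atTop := by
      intro c
      simp_rw [scaledMatrix_eq]
      exact tendsto_atTop_add_const_right _ _
        (tendsto_id.atTop_mul_const (lt_of_le_of_ne (hz c) (h1 c).symm))
    have hθu : ∀ c, Tendsto (fun L => θ c (scaledMatrix L z c)) atTop (𝓝 0) := fun c =>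
      (hlim c).comp (hu c)
    rw [Set.indicator_of_mem hz, cornerWeight]
    simp only [Pi.one_apply]
    rw [← mul_assoc, ← mul_assoc]
    refine ENNReal.Tendsto.mul (ENNReal.Tendsto.mul (ENNReal.Tendsto.mul ?_ ?_ ?_ ?_) ?_ ?_ ?_)
      ?_ ?_ ?_
    · refine tendsto_const_nhds.congr' ?_
      have : ∀ᶠ L in atTop, ∀ c, v₀ c ≤ scaledMatrix L z c :=
        eventually_all.2 fun c => (hu c).eventually_ge_atTop _
      filter_upwards [this] with L hL
      exact (prod_heaviside_eq_one fun c _ => sub_nonneg.2 (hL c)).symm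
    · exact Or.inl one_ne_zero
    · refine ENNReal.tendsto_finsetProd_of_ne_top _ (fun i _ => ?_) fun i _ => heaviside_ne_top _
      refine (continuousAt_heaviside (h2 i)).tendsto.comp ?_
      simpa using tendsto_const_nhds.add (tendsto_finsetSum Finset.univ fun j _ => hθu (i, j))
    · exact Or.inr ENNReal.one_ne_top
    · exact Or.inr (ENNReal.prod_ne_top fun j _ => heaviside_ne_top _)
    · refine ENNReal.tendsto_finsetProd_of_ne_top _ (fun j _ => ?_) fun j _ => heaviside_ne_top _
      refine (continuousAt_heaviside (h3 j)).tendsto.comp ?_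
      simpa using tendsto_const_nhds.add (tendsto_finsetSum Finset.univ fun i _ => hθu (i, j))
    · exact Or.inr (ENNReal.mul_ne_top ENNReal.one_ne_top
        (ENNReal.prod_ne_top fun j _ => heaviside_ne_top _))
    · exact Or.inr ENNReal.ofReal_ne_top
    · refine ENNReal.tendsto_ofReal ((Real.continuous_exp.tendsto _).comp ?_)
      simpa using tendsto_const_nhds.add
        ((tendsto_finsetSum Finset.univ fun c _ => hθu c).const_mul (2 * σ))
    · refine Or.inr (ENNReal.mul_ne_top (ENNReal.mul_ne_top ENNReal.one_ne_top
        (ENNReal.prod_ne_top fun j _ => heaviside_ne_top _))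
        (ENNReal.prod_ne_top fun j _ => heaviside_ne_top _))
  · rw [Set.indicator_of_notMem hz, zero_mul]
    have hz' : ∃ c, completion m (z.1, fun _ => 1) c < 0 := by
      by_contra! h
      exact hz h
    obtain ⟨c, hc⟩ := hz'
    have hu : Tendsto (fun L => scaledMatrix L z c) atTop atBot := by
      simp_rw [scaledMatrix_eq]
      exact tendsto_atBot_add_const_right _ _ (tendsto_id.atTop_mul_const_of_neg hc)
    refine tendsto_const_nhds.congr' ?_
    filter_upwards [hu.eventually_lt_atBot (v₀ c)] with L hL
    have hzero : ∏ c, heaviside (scaledMatrix L z c - v₀ c) = 0 :=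
      Finset.prod_eq_zero (Finset.mem_univ c) (heaviside_of_neg (by linarith))
    rw [scaledWeight, hzero, zero_mul, zero_mul, zero_mul]

theorem measurableSet_birkhoff : MeasurableSet (birkhoff m) := by
  have : birkhoff m = ⋂ c, {w | 0 ≤ completion m (w, fun _ => 1) c} := by
    ext w
    simp [birkhoff]
  rw [this]
  refine MeasurableSet.iInter fun c => measurableSet_le measurable_const ?_
  exact (measurable_pi_apply c).comp (measurable_completion.comp (by fun_prop))

/-- The asymptotics of the integral of `latticeWeight`. -/
theorem tendsto_lintegral_latticeWeight {σ : ℝ} (hσ₀ : 0 ≤ σ) (hσ : σ < 1 / 2)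
    {θ : Cell m → ℝ → ℝ} {v₀ : Cell m → ℝ} {C : ℝ} (hθ : ∀ c, Measurable (θ c))
    (hθ₀ : ∀ c v, 0 ≤ θ c v) (hC : ∀ c v, θ c v ≤ C) (hv₀ : ∀ c, 0 ≤ v₀ c)
    (hlim : ∀ c, Tendsto (θ c) atTop (𝓝 0)) :
    Tendsto (fun L => (∫⁻ u, latticeWeight σ θ v₀ L u) /
        ENNReal.ofReal (Real.exp ((1 - 2 * σ) * ((m + 1) * L)) * L ^ m ^ 2)) atTop
      (𝓝 (volume (birkhoff m) * ENNReal.ofReal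
        ((2 * m).factorial / (m.factorial : ℝ) ^ 2 / (1 - 2 * σ) ^ (2 * m + 1)))) := by
  have h1 : ∫⁻ z : Margins m, (birkhoff m).indicator 1 z.1 * cornerWeight m (1 - 2 * σ) z.2 =
      volume (birkhoff m) * ENNReal.ofReal
        ((2 * m).factorial / (m.factorial : ℝ) ^ 2 / (1 - 2 * σ) ^ (2 * m + 1)) := by
    rw [Measure.volume_eq_prod, lintegral_prod_mul
      ((measurable_one.indicator measurableSet_birkhoff).aemeasurable) (by fun_prop),
      lintegral_indicator_one measurableSet_birkhoff, lintegral_cornerWeight m (by linarith)]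
  rw [← h1]
  have h2 : Tendsto (fun L => ∫⁻ z, scaledWeight σ θ v₀ L z) atTop
      (𝓝 (∫⁻ z : Margins m, (birkhoff m).indicator 1 z.1 * cornerWeight m (1 - 2 * σ) z.2)) := by
    refine tendsto_lintegral_filter_of_dominated_convergence (scaledMajorant m σ C)
      (Eventually.of_forall fun L => measurable_scaledWeight σ hθ v₀ L) ?_
      (lintegral_scaledMajorant_ne_top hσ C) ?_
    · filter_upwards [eventually_ge_atTop 1] with L hL
      exact ae_of_all _ fun z => scaledWeight_le hσ₀ hθ₀ hC hv₀ hL z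
    · have e1 : ∀ᵐ z : Margins m, ∀ c, completion m (z.1, fun _ => 1) c ≠ 0 :=
        Measure.quasiMeasurePreserving_fst.ae (ae_all_iff.2 ae_completion_one_ne_zero)
      have e2 : ∀ᵐ z : Margins m, ∀ i, rowSlack z.2 i ≠ 0 :=
        Measure.quasiMeasurePreserving_snd.ae (ae_all_iff.2 ae_rowSlack_ne_zero)
      have e3 : ∀ᵐ z : Margins m, ∀ j, z.2 (Sum.inr j) ≠ 0 :=
        Measure.quasiMeasurePreserving_snd.ae
          (ae_all_iff.2 fun j : Fin (m + 1) => ae_apply_ne_zero (Sum.inr j))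
      filter_upwards [e1, e2, e3] with z h1 h2 h3
      exact tendsto_scaledWeight hlim h1 h2 h3
  refine h2.congr' ?_
  filter_upwards [eventually_gt_atTop 0] with L hL
  rw [lintegral_latticeWeight σ hθ v₀ hL, mul_comm (ENNReal.ofReal _),
    ENNReal.mul_div_cancel_right _ ENNReal.ofReal_ne_top]
  rw [Ne, ENNReal.ofReal_eq_zero, not_le]
  positivity

end SteinhausMoments

namespace SteinhausMoments

open scoped ENNReal Topology

/-! ### Sums over arithmetic progressions as integrals -/

theorem lintegral_fin_prod {n : ℕ} (f : Fin n → ℝ → ℝ≥0∞) (hf : ∀ i, Measurable (f i)) :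
    ∫⁻ x : Fin n → ℝ, ∏ i, f i (x i) = ∏ i, ∫⁻ t, f i t := by
  induction n with
  | zero => simp [volume_pi]
  | succ n ih =>
    have e := (volume_preserving_piFinSuccAbove (fun _ : Fin (n + 1) => ℝ) 0).symm
    rw [← e.lintegral_comp_emb (MeasurableEquiv.measurableEmbedding _), Fin.prod_univ_succ,
      ← ih _ fun i => hf i.succ, Measure.volume_eq_prod,
      ← lintegral_prod_mul (f := f 0) (g := fun y : Fin n → ℝ => ∏ i : Fin n, f i.succ (y i))
        (hf 0).aemeasurable (Finset.measurable_fun_prod _ fun i _ =>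
          (hf i.succ).comp (measurable_pi_apply i)).aemeasurable]
    refine lintegral_congr fun z => ?_
    simp only [MeasurableEquiv.piFinSuccAbove_symm_apply, Fin.insertNthEquiv,
      Fin.insertNth_zero, Equiv.coe_fn_mk, Fin.prod_univ_succ, Fin.cons_zero, Fin.cons_succ]
    rfl

theorem lintegral_fintype_prod {ι : Type*} [Fintype ι] (f : ι → ℝ → ℝ≥0∞)
    (hf : ∀ i, Measurable (f i)) :
    ∫⁻ x : ι → ℝ, ∏ i, f i (x i) = ∏ i, ∫⁻ t, f i t := by
  let e := (Fintype.equivFin ι).symm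
  rw [← (volume_measurePreserving_piCongrLeft (fun _ : ι => ℝ) e).lintegral_comp_emb
    (MeasurableEquiv.measurableEmbedding _), ← e.prod_comp,
    ← lintegral_fin_prod _ fun i => hf (e i)]
  refine lintegral_congr fun x => ?_
  rw [← e.prod_comp]
  refine Finset.prod_congr rfl fun i _ => ?_
  rw [MeasurableEquiv.coe_piCongrLeft, Equiv.piCongrLeft_apply_apply]

theorem pi_withDensity {ι : Type*} [Fintype ι] (d : ι → ℝ → ℝ≥0∞) (hd : ∀ i, Measurable (d i))
    [∀ i, SigmaFinite (volume.withDensity (d i))] :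
    Measure.pi (fun i => volume.withDensity (d i)) =
      (volume : Measure (ι → ℝ)).withDensity fun x => ∏ i, d i (x i) := by
  refine Measure.pi_eq fun s hs => ?_
  rw [withDensity_apply _ (MeasurableSet.univ_pi hs), ← lintegral_indicator
    (MeasurableSet.univ_pi hs)]
  have h : ∀ x : ι → ℝ, (Set.univ.pi s).indicator (fun x => ∏ i, d i (x i)) x =
      ∏ i, (s i).indicator (d i) (x i) := by
    intro x
    by_cases hx : x ∈ Set.univ.pi s
    · rw [Set.indicator_of_mem hx]
      exact Finset.prod_congr rfl fun i _ => (Set.indicator_of_mem (hx i (Set.mem_univ i)) _).symm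
    · rw [Set.indicator_of_notMem hx]
      simp only [Set.mem_univ_pi, not_forall] at hx
      obtain ⟨i, hi⟩ := hx
      exact (Finset.prod_eq_zero (Finset.mem_univ i) (Set.indicator_of_notMem hi _)).symm
  simp_rw [h]
  rw [lintegral_fintype_prod _ fun i => (hd i).indicator (hs i)]
  refine Finset.prod_congr rfl fun i _ => ?_
  rw [lintegral_indicator (hs i), withDensity_apply _ (hs i)]

/-- The density on the line that `progressionIndex` maps to counting measure. -/
noncomputable def progressionDensity (q : ℕ) (v : ℝ) : ℝ≥0∞ :=
  heaviside (v - Real.log q) * ENNReal.ofReal (Real.exp v / q)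

/-- The index in a progression modulo `q` that is attached to `exp v`. -/
noncomputable def progressionIndex (q : ℕ) (v : ℝ) : ℕ := ⌊Real.exp v / q⌋₊ - 1

@[fun_prop]
theorem measurable_progressionDensity (q : ℕ) : Measurable (progressionDensity q) := by
  unfold progressionDensity
  fun_prop

@[fun_prop]
theorem measurable_progressionIndex (q : ℕ) : Measurable (progressionIndex q) := by
  have h : Measurable fun v : ℝ => ⌊Real.exp v / q⌋₊ := Nat.measurable_floor.comp (by fun_prop)
  exact (measurable_of_countable (fun n : ℕ => n - 1)).comp h

/-- The fibre over n is the interval log (q (n + 1)) ≤ v < log (q (n + 2)), of mass 1 for the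
density exp v / q. The cut-off at log q matters: truncated subtraction would send smaller v to the
index 0 too. -/
theorem map_progressionIndex {q : ℕ} (hq : 0 < q) :
    (volume.withDensity (progressionDensity q)).map (progressionIndex q) = Measure.count := by
  have hq' : (0 : ℝ) < q := Nat.cast_pos.2 hq
  refine Measure.ext_of_singleton fun n => ?_
  have hms : MeasurableSet (progressionIndex q ⁻¹' {n}) :=
    measurable_progressionIndex q (measurableSet_singleton n)
  rw [Measure.map_apply (by fun_prop) (measurableSet_singleton n), withDensity_apply _ hms,
    Measure.count_singleton, ← lintegral_indicator hms]
  have h : ∀ v, (progressionIndex q ⁻¹' {n}).indicator (progressionDensity q) v =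
      (Set.Ico (Real.log (q * (n + 1))) (Real.log (q * (n + 2)))).indicator
        (fun v => ENNReal.ofReal (Real.exp v / q)) v := by
    intro v
    have hiff : (Real.log q ≤ v ∧ progressionIndex q v = n) ↔
        v ∈ Set.Ico (Real.log (q * (n + 1))) (Real.log (q * (n + 2))) := by
      rw [Set.mem_Ico, Real.log_le_iff_le_exp hq', Real.log_le_iff_le_exp (by positivity),
        Real.lt_log_iff_exp_lt (by positivity), progressionIndex]
      have h1 : (q : ℝ) ≤ Real.exp v ↔ 1 ≤ ⌊Real.exp v / q⌋₊ := by
        rw [Nat.le_floor_iff (by positivity), le_div_iff₀ hq', Nat.cast_one, one_mul]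
      have h2 : (q : ℝ) * (n + 1) ≤ Real.exp v ↔ n + 1 ≤ ⌊Real.exp v / q⌋₊ := by
        rw [Nat.le_floor_iff (by positivity), le_div_iff₀ hq', mul_comm]
        push_cast
        rfl
      have h3 : Real.exp v < (q : ℝ) * (n + 2) ↔ ⌊Real.exp v / q⌋₊ < n + 2 := by
        rw [Nat.floor_lt (by positivity), div_lt_iff₀ hq', mul_comm]
        push_cast
        rfl
      rw [h1, h2, h3]
      omega
    classical
    simp only [Set.indicator_apply, ← hiff, progressionDensity, heaviside, Set.mem_preimage,
      Set.mem_singleton_iff, sub_nonneg]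
    by_cases h1 : progressionIndex q v = n <;> by_cases h2 : Real.log q ≤ v <;> simp [h1, h2]
  simp_rw [h]
  have hle : Real.log (q * (n + 1)) ≤ Real.log (q * (n + 2)) :=
    Real.log_le_log (by positivity) (by gcongr; norm_num)
  rw [lintegral_indicator measurableSet_Ico, setLIntegral_congr Ico_ae_eq_Ioc,
    ← ofReal_integral_eq_lintegral_ofReal, ← intervalIntegral.integral_of_le hle,
    intervalIntegral.integral_div, integral_exp, Real.exp_log (by positivity),
    Real.exp_log (by positivity)]
  · rw [show ((q : ℝ) * (n + 2) - q * (n + 1)) / q = 1 by field_simp; ring, ENNReal.ofReal_one]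
  · exact (Continuous.integrableOn_Ioc (by fun_prop))
  · exact ae_of_all _ fun _ => by positivity

theorem sigmaFinite_progressionDensity (q : ℕ) :
    SigmaFinite (volume.withDensity (progressionDensity q)) :=
  SigmaFinite.withDensity_of_ne_top (ae_of_all _ fun _ =>
    ENNReal.mul_ne_top (heaviside_ne_top _) ENNReal.ofReal_ne_top)

/-- Counting measure is the image of a product of one-dimensional measures, so the sum is an
integral exactly. All rounding is deferred to `progressionError`. -/
theorem tsum_eq_lintegral {ι : Type*} [Fintype ι] {q : ι → ℕ} (hq : ∀ i, 0 < q i)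
    (F : (ι → ℕ) → ℝ≥0∞) :
    ∑' n, F n = ∫⁻ v : ι → ℝ, (∏ i, progressionDensity (q i) (v i)) *
      F (fun i => progressionIndex (q i) (v i)) := by
  have := fun i => sigmaFinite_progressionDensity (q i)
  have hF : Measurable F := measurable_of_countable F
  have hg : Measurable fun (v : ι → ℝ) i => progressionIndex (q i) (v i) :=
    measurable_pi_lambda _ fun i => by fun_prop
  have h1 : Measure.pi (fun _ : ι => (Measure.count : Measure ℕ)) = Measure.count := by
    refine Measure.ext_of_singleton fun n => ?_
    rw [Measure.pi_singleton]
    simp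
  have h2 : Measure.pi (fun _ : ι => (Measure.count : Measure ℕ)) =
      (Measure.pi fun i => volume.withDensity (progressionDensity (q i))).map
        (fun v i => progressionIndex (q i) (v i)) := by
    have h3 : (fun _ : ι => (Measure.count : Measure ℕ)) = fun i =>
        (volume.withDensity (progressionDensity (q i))).map (progressionIndex (q i)) :=
      funext fun i => (map_progressionIndex (hq i)).symm
    have : ∀ i, SigmaFinite
        ((volume.withDensity (progressionDensity (q i))).map (progressionIndex (q i))) := by
      intro i
      rw [map_progressionIndex (hq i)]
      infer_instance
    rw [h3, ← Measure.pi_map_pi fun i => (measurable_progressionIndex (q i)).aemeasurable]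
  rw [← lintegral_count, ← h1, h2, lintegral_map hF hg,
    pi_withDensity _ fun i => measurable_progressionDensity (q i),
    lintegral_withDensity_eq_lintegral_mul _ (by fun_prop)
      (show Measurable fun v : ι → ℝ => F fun i => progressionIndex (q i) (v i) from hF.comp hg)]
  rfl

/-- The weight of an integer matrix: `(∏ n_c) ^ (-2σ)` if its row and column products are at most
`x`. -/
noncomputable def matrixWeight {m : ℕ} (σ x : ℝ) (n : Cell m → ℕ) : ℝ≥0∞ :=
  open Classical in
  if (∀ i, ∏ j, (n (i, j) : ℝ) ≤ x) ∧ ∀ j, ∏ i, (n (i, j) : ℝ) ≤ x then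
    ENNReal.ofReal (∏ c, (n c : ℝ) ^ (-(2 * σ))) else 0

/-- The difference between `v` and the logarithm of the attached element of the progression. -/
noncomputable def progressionError (q r : ℕ) (v : ℝ) : ℝ :=
  if Real.log q ≤ v then v - Real.log ((q * progressionIndex q v + r : ℕ) : ℝ) else 0

theorem measurable_progressionError (q r : ℕ) : Measurable (progressionError q r) := by
  have h : Measurable fun v : ℝ => Real.log ((q * progressionIndex q v + r : ℕ) : ℝ) :=
    (measurable_of_countable fun n : ℕ => Real.log ((q * n + r : ℕ) : ℝ)).comp
      (measurable_progressionIndex q)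
  exact Measurable.ite measurableSet_Ici (measurable_id.sub h) measurable_const

section progression

variable {q r : ℕ}

/-- If N is the index, then q (N + 1) ≤ exp v < q (N + 2). The shift by one in `progressionIndex`
keeps q N + r below exp v, which makes the error nonnegative. -/
theorem progression_bounds (hr : 0 < r) (hrq : r ≤ q) {v : ℝ} (hv : Real.log q ≤ v) :
    ((q * progressionIndex q v + r : ℕ) : ℝ) ≤ Real.exp v ∧
    Real.exp v * r ≤ 2 * q * ((q * progressionIndex q v + r : ℕ) : ℝ) ∧
    Real.exp v - 2 * q ≤ ((q * progressionIndex q v + r : ℕ) : ℝ) := by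
  have hq : (0 : ℝ) < q := by exact_mod_cast hr.trans_le hrq
  have hr' : (0 : ℝ) < r := Nat.cast_pos.2 hr
  have hrq' : (r : ℝ) ≤ q := Nat.cast_le.2 hrq
  rw [Real.log_le_iff_le_exp hq] at hv
  have h1 : 1 ≤ ⌊Real.exp v / q⌋₊ := by
    rw [Nat.le_floor_iff (by positivity), le_div_iff₀ hq, Nat.cast_one, one_mul]
    exact hv
  obtain ⟨N, hN⟩ : ∃ N, ⌊Real.exp v / q⌋₊ = N + 1 := ⟨_, (Nat.sub_add_cancel h1).symm⟩
  have hidx : progressionIndex q v = N := by rw [progressionIndex, hN, Nat.add_sub_cancel]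
  have h2 : (q : ℝ) * (N + 1) ≤ Real.exp v := by
    have := Nat.floor_le (show 0 ≤ Real.exp v / q by positivity)
    rw [hN, le_div_iff₀ hq] at this
    push_cast at this
    linarith
  have h3 : Real.exp v < (q : ℝ) * (N + 2) := by
    have := Nat.lt_floor_add_one (Real.exp v / q)
    rw [hN, div_lt_iff₀ hq] at this
    push_cast at this
    linarith
  rw [hidx]
  push_cast
  have hN0 : (0 : ℝ) ≤ N := Nat.cast_nonneg N
  refine ⟨by linarith, ?_, by linarith⟩
  have h4 : Real.exp v * r ≤ q * (N + 2) * r := by gcongr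
  have h5 : (N : ℝ) * r ≤ N * q := by gcongr
  have h6 : (0 : ℝ) ≤ N * q := by positivity
  have h7 := mul_le_mul_of_nonneg_left (show ((N : ℝ) + 2) * r ≤ 2 * (q * N + r) by linarith) hq.le
  linarith

theorem progression_pos (hr : 0 < r) (v : ℝ) :
    (0 : ℝ) < ((q * progressionIndex q v + r : ℕ) : ℝ) := by
  exact_mod_cast Nat.add_pos_right _ hr

theorem progressionError_nonneg (hr : 0 < r) (hrq : r ≤ q) (v : ℝ) :
    0 ≤ progressionError q r v := by
  unfold progressionError
  split_ifs with h
  · rw [sub_nonneg, Real.log_le_iff_le_exp (progression_pos hr v)]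
    exact (progression_bounds hr hrq h).1
  · rfl

theorem progressionError_le (hr : 0 < r) (hrq : r ≤ q) (v : ℝ) :
    progressionError q r v ≤ Real.log (2 * q / r) := by
  have hq : (0 : ℝ) < q := by exact_mod_cast hr.trans_le hrq
  have hr' : (0 : ℝ) < r := Nat.cast_pos.2 hr
  have hrq' : (r : ℝ) ≤ q := Nat.cast_le.2 hrq
  unfold progressionError
  split_ifs with h
  · rw [sub_le_iff_le_add, ← Real.log_mul (by positivity) (progression_pos hr v).ne',
      Real.le_log_iff_exp_le (mul_pos (by positivity) (progression_pos hr v)), div_mul_eq_mul_div,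
      le_div_iff₀ hr']
    exact (progression_bounds hr hrq h).2.1
  · refine Real.log_nonneg ?_
    rw [le_div_iff₀ hr']
    linarith

theorem tendsto_progressionError (hr : 0 < r) (hrq : r ≤ q) :
    Tendsto (progressionError q r) atTop (𝓝 0) := by
  have h1 : Tendsto (fun v : ℝ => 1 - 2 * q * Real.exp (-v)) atTop (𝓝 1) := by
    simpa using (Real.tendsto_exp_neg_atTop_nhds_zero.const_mul (2 * (q : ℝ))).const_sub 1
  have h2 : Tendsto (fun v : ℝ => ((q * progressionIndex q v + r : ℕ) : ℝ) * Real.exp (-v)) atTop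
      (𝓝 1) := by
    refine tendsto_of_tendsto_of_tendsto_of_le_of_le' h1 tendsto_const_nhds ?_ ?_
    · filter_upwards [eventually_ge_atTop (Real.log q)] with v hv
      have := (progression_bounds hr hrq hv).2.2
      calc 1 - 2 * q * Real.exp (-v) = (Real.exp v - 2 * q) * Real.exp (-v) := by
            rw [sub_mul, ← Real.exp_add]
            simp
        _ ≤ _ := by gcongr
    · filter_upwards [eventually_ge_atTop (Real.log q)] with v hv
      have := (progression_bounds hr hrq hv).1
      calc _ ≤ Real.exp v * Real.exp (-v) := by gcongr
        _ = 1 := by rw [← Real.exp_add]; simp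
  have h3 := (Real.continuousAt_log one_ne_zero).tendsto.comp h2
  rw [Real.log_one] at h3
  have h4 := h3.neg
  rw [neg_zero] at h4
  refine h4.congr' ?_
  filter_upwards [eventually_ge_atTop (Real.log q)] with v hv
  rw [progressionError, if_pos hv, Function.comp_apply,
    Real.log_mul (progression_pos hr v).ne' (Real.exp_pos _).ne', Real.log_exp]
  ring

end progression

variable {m : ℕ} {q r : Cell m → ℕ}

/-- The density contributes exp (u_c) with the unperturbed u_c, whereas the margins and the powers
n_c ^ (-2σ) see log n_c = u_c - θ_c. This dictates the form of `latticeWeight`. -/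
theorem tsum_matrixWeight_progression (σ : ℝ) (hr : ∀ c, 0 < r c) (hrq : ∀ c, r c ≤ q c)
    {x : ℝ} (hx : 0 < x) :
    ∑' n : Cell m → ℕ, matrixWeight σ x (fun c => q c * n c + r c) =
      ENNReal.ofReal (∏ c, (q c : ℝ)⁻¹) *
        ∫⁻ u, latticeWeight σ (fun c => progressionError (q c) (r c))
          (fun c => Real.log (q c)) (Real.log x) u := by
  rw [tsum_eq_lintegral (q := q) (fun c => (hr c).trans_le (hrq c)),
    ← lintegral_const_mul _ (measurable_latticeWeight σ
      (fun c => measurable_progressionError _ _) _ _)]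
  refine lintegral_congr fun u => ?_
  have hd : ∏ c, progressionDensity (q c) (u c) = ENNReal.ofReal (∏ c, (q c : ℝ)⁻¹) *
      ((∏ c, heaviside (u c - Real.log (q c))) *
        ENNReal.ofReal (∏ c, Real.exp (u c))) := by
    simp only [progressionDensity, Finset.prod_mul_distrib]
    rw [mul_left_comm, ← ENNReal.ofReal_prod_of_nonneg (fun c _ => by positivity),
      ← ENNReal.ofReal_mul (Finset.prod_nonneg fun c _ => by positivity),
      ← Finset.prod_mul_distrib]
    congr 3
    ext c
    rw [div_eq_inv_mul]
  rw [hd, mul_assoc]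
  congr 1
  rw [latticeWeight]
  by_cases hu : ∀ c ∈ Finset.univ, 0 ≤ u c - Real.log (q c)
  swap
  · rw [prod_heaviside_eq_zero hu]
    simp
  rw [prod_heaviside_eq_one hu]
  simp only [one_mul]
  set n : Cell m → ℕ := fun c => q c * progressionIndex (q c) (u c) + r c with hn
  have hpos : ∀ c, (0 : ℝ) < n c := fun c => progression_pos (hr c) (u c)
  have herr : ∀ c, u c - progressionError (q c) (r c) (u c) = Real.log (n c) := fun c => by
    rw [progressionError, if_pos (sub_nonneg.1 (hu c (Finset.mem_univ c))), sub_sub_cancel]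
  simp only [herr]
  have hlog : ∀ f : Fin (m + 1) → Cell m, (0 ≤ Real.log x - ∑ j, Real.log (n (f j)) ↔
      ∏ j, (n (f j) : ℝ) ≤ x) := fun f => by
    rw [sub_nonneg, ← Real.log_prod (fun j _ => (hpos _).ne'),
      Real.log_le_log_iff (Finset.prod_pos fun j _ => hpos _) hx]
  have hexp : ENNReal.ofReal (∏ c, Real.exp (u c)) * ENNReal.ofReal (∏ c, (n c : ℝ) ^ (-(2 * σ))) =
      ENNReal.ofReal (Real.exp (∑ c, (u c - 2 * σ * Real.log (n c)))) := by
    rw [← ENNReal.ofReal_mul (Finset.prod_nonneg fun c _ => by positivity), Real.exp_sum,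
      ← Finset.prod_mul_distrib]
    congr 1
    refine Finset.prod_congr rfl fun c _ => ?_
    rw [Real.rpow_def_of_pos (hpos c), ← Real.exp_add]
    congr 1
    ring
  rw [matrixWeight]
  by_cases h1 : ∀ i, ∏ j, (n (i, j) : ℝ) ≤ x
  · by_cases h2 : ∀ j, ∏ i, (n (i, j) : ℝ) ≤ x
    · rw [if_pos ⟨h1, h2⟩, prod_heaviside_eq_one fun i _ => (hlog fun j => (i, j)).2 (h1 i),
        prod_heaviside_eq_one fun j _ => (hlog fun i => (i, j)).2 (h2 j), one_mul, one_mul, hexp]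
    · rw [if_neg fun h => h2 h.2, prod_heaviside_eq_zero (s := Finset.univ)
        (f := fun j => Real.log x - ∑ i, Real.log (n (i, j)))
        fun h => h2 fun j => (hlog fun i => (i, j)).1 (h j (Finset.mem_univ j))]
      simp
  · rw [if_neg fun h => h1 h.1, prod_heaviside_eq_zero (s := Finset.univ)
      (f := fun i => Real.log x - ∑ j, Real.log (n (i, j)))
      fun h => h1 fun i => (hlog fun j => (i, j)).1 (h i (Finset.mem_univ i))]
    simp

/-- The order of magnitude of the moment. -/
noncomputable def mainSize (m : ℕ) (σ x : ℝ) : ℝ :=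
  Real.exp ((1 - 2 * σ) * ((m + 1) * Real.log x)) * Real.log x ^ m ^ 2

/-- The limit of the normalized sums over all integer matrices. -/
noncomputable def mainConst (m : ℕ) (σ : ℝ) : ℝ≥0∞ :=
  volume (birkhoff m) * ENNReal.ofReal
    ((2 * m).factorial / (m.factorial : ℝ) ^ 2 / (1 - 2 * σ) ^ (2 * m + 1))

/-- The residues enter only through an error that tends to zero, so the limit depends on the modulus
alone. -/
theorem tendsto_tsum_progression {σ : ℝ} (hσ₀ : 0 ≤ σ) (hσ : σ < 1 / 2) {Q : ℕ}
    (hr : ∀ c, 0 < r c) (hrq : ∀ c, r c ≤ Q) :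
    Tendsto (fun x => (∑' n : Cell m → ℕ, matrixWeight σ x (fun c => Q * n c + r c)) /
      ENNReal.ofReal (mainSize m σ x)) atTop
      (𝓝 (ENNReal.ofReal (((Q : ℝ) ^ (m + 1) ^ 2)⁻¹) * mainConst m σ)) := by
  have hQ : 1 ≤ Q := (hr (0, 0)).trans_le (hrq (0, 0))
  have hQ' : (1 : ℝ) ≤ Q := by exact_mod_cast hQ
  have h := (tendsto_lintegral_latticeWeight (m := m) hσ₀ hσ
    (θ := fun c => progressionError Q (r c)) (v₀ := fun _ => Real.log Q) (C := Real.log (2 * Q))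
    (fun c => measurable_progressionError _ _) (fun c v => progressionError_nonneg (hr c) (hrq c) v)
    (fun c v => (progressionError_le (hr c) (hrq c) v).trans (by
      have : (1 : ℝ) ≤ r c := by exact_mod_cast hr c
      exact Real.log_le_log (by positivity) (div_le_self (by positivity) this)))
    (fun _ => Real.log_nonneg hQ')
    (fun c => tendsto_progressionError (hr c) (hrq c))).comp Real.tendsto_log_atTop
  have h' := ENNReal.Tendsto.const_mul (a := ENNReal.ofReal (((Q : ℝ) ^ (m + 1) ^ 2)⁻¹)) h
    (Or.inr ENNReal.ofReal_ne_top)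
  refine h'.congr' ?_
  filter_upwards [eventually_gt_atTop 0] with x hx
  rw [tsum_matrixWeight_progression (q := fun _ => Q) σ hr hrq hx, mul_div_assoc]
  simp only [Finset.prod_const, Finset.card_univ, Fintype.card_prod, Fintype.card_fin, ← pow_two,
    inv_pow]
  rfl

/-- For r = q the error is at most log 2 whatever q is. The majorant is thus uniform in the moduli,
as the summation over all large primes requires. -/
theorem tsum_progression_le {σ : ℝ} (hσ₀ : 0 ≤ σ) (hq : ∀ c, 0 < q c) {x : ℝ}
    (hx : Real.exp 1 ≤ x) :
    ∑' n : Cell m → ℕ, matrixWeight σ x (fun c => q c * n c + q c) ≤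
      ENNReal.ofReal (∏ c, (q c : ℝ)⁻¹) * (ENNReal.ofReal (mainSize m σ x) *
        ∫⁻ z, scaledMajorant m σ (Real.log 2) z) := by
  have hx0 : 0 < x := (Real.exp_pos 1).trans_le hx
  rw [tsum_matrixWeight_progression σ hq (fun c => le_rfl) hx0]
  gcongr
  refine lintegral_latticeWeight_le hσ₀ (fun c => measurable_progressionError _ _)
    (fun c v => progressionError_nonneg (hq c) le_rfl v) (fun c v => ?_)
    (fun c => Real.log_nonneg (by exact_mod_cast hq c)) ((Real.le_log_iff_exp_le hx0).2 hx)
  have hq' : (q c : ℝ) ≠ 0 := by exact_mod_cast (hq c).ne'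
  refine (progressionError_le (hq c) le_rfl v).trans (le_of_eq ?_)
  rw [mul_div_assoc, div_self hq', mul_one]

end SteinhausMoments

namespace SteinhausMoments

open scoped ENNReal Topology

/-! ### Matrices with coprime crossing entries -/

variable {m : ℕ}

/-- Two positions cross if the first lies strictly above and strictly to the right of the second. -/
def Crossing (c c' : Cell m) : Prop := c.1 < c'.1 ∧ c'.2 < c.2

theorem Crossing.ne {c c' : Cell m} (h : Crossing c c') : c ≠ c' := fun e =>
  absurd h.1 (by rw [e]; exact lt_irrefl _)

/-- Positive integer matrices all of whose crossing entries are coprime. -/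
def CoprimeMatrix (n : Cell m → ℕ) : Prop :=
  (∀ c, 0 < n c) ∧ ∀ c c', Crossing c c' → Nat.Coprime (n c) (n c')

/-- Pairs of factorizations of a positive integer. -/
def EqualProducts (ab : (Fin (m + 1) → ℕ) × (Fin (m + 1) → ℕ)) : Prop :=
  (∀ i, 0 < ab.1 i) ∧ (∀ j, 0 < ab.2 j) ∧ ∏ i, ab.1 i = ∏ j, ab.2 j

/-- The row products and column products of a matrix. -/
def marginProducts (n : Cell m → ℕ) : (Fin (m + 1) → ℕ) × (Fin (m + 1) → ℕ) :=
  (fun i => ∏ j, n (i, j), fun j => ∏ i, n (i, j))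

theorem CoprimeMatrix.equalProducts {n : Cell m → ℕ} (hn : CoprimeMatrix n) :
    EqualProducts (marginProducts n) := by
  refine ⟨fun i => ?_, fun j => ?_, ?_⟩ <;> simp only [marginProducts]
  · exact Finset.prod_pos (f := fun j => n (i, j)) fun j _ => hn.1 _
  · exact Finset.prod_pos (f := fun i => n (i, j)) fun i _ => hn.1 _
  · exact Finset.prod_comm

theorem bijOn_marginProducts :
    Set.BijOn marginProducts {n : Cell m → ℕ | CoprimeMatrix n} {ab | EqualProducts ab} := by
  refine ⟨fun n hn => hn.equalProducts, ?_, ?_⟩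
  · intro n hn n' hn' h
    have hab := hn.equalProducts
    have hu := (existsUnique_coprime_refinement _ _ _ _ hab.1 hab.2.1 hab.2.2).unique
      (y₁ := fun i j => n (i, j)) (y₂ := fun i j => n' (i, j))
      ⟨fun i => rfl, fun j => rfl, fun i i' j j' hi hj => hn.2 (i, j) (i', j') ⟨hi, hj⟩⟩
      ⟨fun i => (congrFun (congrArg Prod.fst h) i).symm,
        fun j => (congrFun (congrArg Prod.snd h) j).symm,
        fun i i' j j' hi hj => hn'.2 (i, j) (i', j') ⟨hi, hj⟩⟩
    ext c
    exact congrFun (congrFun hu c.1) c.2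
  · rintro ⟨a, b⟩ ⟨ha, hb, hab⟩
    obtain ⟨n, ⟨h1, h2, h3⟩, -⟩ := existsUnique_coprime_refinement _ _ a b ha hb hab
    refine ⟨fun c => n c.1 c.2, ⟨fun c => ?_, fun c c' h => h3 _ _ _ _ h.1 h.2⟩,
      Prod.ext (funext h1) (funext h2)⟩
    refine Nat.pos_of_ne_zero fun h0 => (ha c.1).ne' ?_
    exact (h1 c.1).symm.trans (Finset.prod_eq_zero (Finset.mem_univ c.2) h0)

open scoped Classical in
-- An arbitrary `F` allows two uses: for the moment itself, and at powers of one prime for the Euler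
-- factor.
theorem tsum_coprimeMatrix (F : (Fin (m + 1) → ℕ) × (Fin (m + 1) → ℕ) → ℝ≥0∞) :
    ∑' n : Cell m → ℕ, (if CoprimeMatrix n then F (marginProducts n) else 0) =
      ∑' ab, if EqualProducts ab then F ab else 0 := by
  have h1 : ∀ n : Cell m → ℕ, (if CoprimeMatrix n then F (marginProducts n) else 0) =
      Set.indicator {n : Cell m → ℕ | CoprimeMatrix n} (fun n => F (marginProducts n)) n :=
    fun n => rfl
  have h2 : ∀ ab : (Fin (m + 1) → ℕ) × (Fin (m + 1) → ℕ), (if EqualProducts ab then F ab else 0) =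
      Set.indicator {ab | EqualProducts ab} F ab := fun ab => rfl
  simp_rw [h1, h2]
  rw [← tsum_subtype, ← tsum_subtype, ← (bijOn_marginProducts.equiv marginProducts).tsum_eq]
  rfl

open scoped Classical in
theorem IsMultiplicativeSteinhaus.ofReal_moment {Ω : Type*} [MeasurableSpace Ω] {P : Measure Ω}
    [IsProbabilityMeasure P] {X : ℕ → Ω → ℂ} (hX : IsMultiplicativeSteinhaus P X) (σ : ℝ) {x : ℝ}
    (hx : 0 ≤ x) :
    ENNReal.ofReal (moment P X (m + 1) σ x) =
      ∑' n : Cell m → ℕ, if CoprimeMatrix n then matrixWeight σ x n else 0 := by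
  let F : (Fin (m + 1) → ℕ) × (Fin (m + 1) → ℕ) → ℝ≥0∞ := fun ab =>
    if (∀ i, (ab.1 i : ℝ) ≤ x) ∧ ∀ j, (ab.2 j : ℝ) ≤ x then
      ENNReal.ofReal (((∏ i, ab.1 i : ℕ) : ℝ) ^ (-(2 * σ))) else 0
  have hF : ∀ n : Cell m → ℕ, matrixWeight σ x n = F (marginProducts n) := by
    intro n
    have h1 : ((∏ i, (marginProducts n).1 i : ℕ) : ℝ) ^ (-(2 * σ)) =
        ∏ c, (n c : ℝ) ^ (-(2 * σ)) := by
      rw [Real.finsetProd_rpow _ _ (fun c _ => Nat.cast_nonneg _), Fintype.prod_prod_type]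
      simp [marginProducts]
    simp only [F, h1]
    simp only [matrixWeight, marginProducts, Nat.cast_prod]
  simp_rw [hF]
  rw [tsum_coprimeMatrix, hX.moment_eq_sum]
  set I := Fintype.piFinset fun _ : Fin (m + 1) => Finset.Icc 1 ⌊x⌋₊ with hI
  have hmem : ∀ a : Fin (m + 1) → ℕ, a ∈ I ↔ (∀ i, 0 < a i) ∧ ∀ i, (a i : ℝ) ≤ x := by
    intro a
    simp only [hI, Fintype.mem_piFinset, Finset.mem_Icc, Nat.le_floor_iff hx, forall_and]
    rfl
  rw [ENNReal.ofReal_sum_of_nonneg (fun a _ => Finset.sum_nonneg fun b _ => by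
    split_ifs <;> positivity), tsum_eq_sum (s := I ×ˢ I), Finset.sum_product]
  · refine Finset.sum_congr rfl fun a ha => ?_
    rw [ENNReal.ofReal_sum_of_nonneg (fun b _ => by split_ifs <;> positivity)]
    refine Finset.sum_congr rfl fun b hb => ?_
    rw [hmem] at ha hb
    by_cases h : ∏ i, a i = ∏ j, b j
    · rw [if_pos h, if_pos (show EqualProducts (a, b) from ⟨ha.1, hb.1, h⟩)]
      simp only [F]
      rw [if_pos ⟨ha.2, hb.2⟩]
    · rw [if_neg h, if_neg (fun h' : EqualProducts (a, b) => h h'.2.2), ENNReal.ofReal_zero]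
  · intro ab hab
    rw [Finset.mem_product, hmem, hmem] at hab
    split_ifs with h
    · simp only [F]
      rw [if_neg fun h' => hab ⟨⟨h.1, h'.1⟩, ⟨h.2.1, h'.2⟩⟩]
    · rfl

/-! ### The Euler factors as densities -/

theorem tsum_fin_prod {α : Type*} {n : ℕ} (f : Fin n → α → ℝ≥0∞) :
    ∑' E : Fin n → α, ∏ i, f i (E i) = ∏ i, ∑' e, f i e := by
  induction n with
  | zero => simp
  | succ n ih =>
    rw [← (Fin.consEquiv fun _ : Fin (n + 1) => α).tsum_eq, ENNReal.tsum_prod',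
      Fin.prod_univ_succ, ← ih, ← ENNReal.tsum_mul_right]
    refine tsum_congr fun a => ?_
    rw [← ENNReal.tsum_mul_left]
    refine tsum_congr fun E => ?_
    rw [Fin.prod_univ_succ]
    rfl

theorem tsum_fintype_prod {ι α : Type*} [Fintype ι] (f : ι → α → ℝ≥0∞) :
    ∑' E : ι → α, ∏ i, f i (E i) = ∏ i, ∑' e, f i e := by
  let e := Fintype.equivFin ι
  rw [← (e.arrowCongr (Equiv.refl α)).symm.tsum_eq, ← e.symm.prod_comp, ← tsum_fin_prod]
  refine tsum_congr fun E => ?_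
  rw [← e.symm.prod_comp]
  refine Finset.prod_congr rfl fun i _ => ?_
  simp [Equiv.arrowCongr]

/-- Summing a function of the pattern of `E` against a product weight. -/
theorem tsum_pattern {ι α : Type*} [Fintype ι] [DecidableEq ι] (π : α → Bool) (h : α → ℝ≥0∞)
    (G : (ι → Bool) → ℝ≥0∞) :
    ∑' E : ι → α, G (fun i => π (E i)) * ∏ i, h (E i) =
      ∑ s : ι → Bool, G s * ∏ i, ∑' e, if π e = s i then h e else 0 := by
  simp_rw [← tsum_fintype_prod, ← ENNReal.tsum_mul_left]
  rw [← tsum_fintype (L := .unconditional _), ENNReal.tsum_comm]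
  refine tsum_congr fun E => ?_
  rw [tsum_eq_single fun i => π (E i)]
  · simp
  · intro s hs
    obtain ⟨i, hi⟩ := Function.ne_iff.1 hs
    rw [Finset.prod_eq_zero (Finset.mem_univ i) (if_neg hi.symm), mul_zero]

/-- A pattern without crossing marks. -/
def NonCrossing (s : Cell m → Bool) : Prop := ∀ c c', Crossing c c' → ¬(s c ∧ s c')

open scoped Classical in
/-- The matrices modulo `p` without crossing zeros. -/
noncomputable def nonCrossingResidues (m p : ℕ) [NeZero p] : Finset (Cell m → ZMod p) :=
  Finset.univ.filter fun r => NonCrossing fun c => decide (r c = 0)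

theorem tsum_geometric_pos {p : ℕ} (hp : 1 < p) :
    ∑' e : ℕ, (if decide (e ≠ 0) = true then ((p : ℝ≥0∞)⁻¹) ^ e else 0) =
      ((p - 1 : ℕ) : ℝ≥0∞)⁻¹ := by
  rw [tsum_eq_zero_add' ENNReal.summable]
  simp only [ne_eq, not_true_eq_false, decide_false, Bool.false_eq_true, if_false, zero_add,
    Nat.add_eq_zero_iff, one_ne_zero, and_false, not_false_eq_true, decide_true, if_true, pow_succ]
  rw [ENNReal.tsum_mul_right, ENNReal.tsum_geometric]
  have hp0 : (p : ℝ≥0∞) ≠ 0 := by exact_mod_cast (by omega : p ≠ 0)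
  rw [← ENNReal.mul_inv (Or.inr (ENNReal.natCast_ne_top p)) (Or.inr hp0), ENNReal.sub_mul
    (fun _ _ => ENNReal.natCast_ne_top p), one_mul, ENNReal.inv_mul_cancel hp0
    (ENNReal.natCast_ne_top p)]
  push_cast
  rfl

open scoped Classical in
-- Both sides depend only on patterns of marked cells. A marked cell weighs 1 as a zero residue and
-- 1 / (p - 1) as a positive exponent; an unmarked one weighs p - 1 and 1. In both cases the ratio
-- is p - 1, once for each cell.
theorem card_nonCrossingResidues {p : ℕ} (hp : p.Prime) [NeZero p] :
    ((nonCrossingResidues m p).card : ℝ≥0∞) = ((p - 1 : ℕ) : ℝ≥0∞) ^ (m + 1) ^ 2 *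
      ∑' E : Cell m → ℕ, (if NonCrossing fun c => decide (E c ≠ 0) then 1 else 0) *
        ∏ c, ((p : ℝ≥0∞)⁻¹) ^ E c := by
  have hp1 : ((p - 1 : ℕ) : ℝ≥0∞) ≠ 0 := by exact_mod_cast (Nat.sub_pos_of_lt hp.one_lt).ne'
  have h1 : ((nonCrossingResidues m p).card : ℝ≥0∞) =
      ∑' r : Cell m → ZMod p, (fun s => if NonCrossing s then (1 : ℝ≥0∞) else 0)
        (fun c => decide (r c = 0)) * ∏ c, (fun _ => (1 : ℝ≥0∞)) (r c) := by
    rw [tsum_fintype, nonCrossingResidues, Finset.card_filter]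
    simp
  rw [h1, tsum_pattern (fun a : ZMod p => decide (a = 0)) (fun _ => 1)
      (fun s => if NonCrossing s then (1 : ℝ≥0∞) else 0),
    tsum_pattern (fun e : ℕ => decide (e ≠ 0)) (fun e => ((p : ℝ≥0∞)⁻¹) ^ e)
      (fun s => if NonCrossing s then (1 : ℝ≥0∞) else 0), Finset.mul_sum]
  refine Finset.sum_congr rfl fun s _ => ?_
  rw [mul_left_comm]
  congr 1
  have hcard : Fintype.card (Cell m) = (m + 1) ^ 2 := by simp [pow_two]
  rw [← hcard, ← Finset.card_univ, ← Finset.prod_const, ← Finset.prod_mul_distrib]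
  refine Finset.prod_congr rfl fun c _ => ?_
  cases s c
  · have h2 : ∑' e : ZMod p, (if decide (e = 0) = false then (1 : ℝ≥0∞) else 0) =
        ((p - 1 : ℕ) : ℝ≥0∞) := by
      rw [tsum_fintype, Finset.sum_boole]
      congr 1
      simp only [decide_eq_false_iff_not]
      rw [Finset.filter_ne', Finset.card_erase_of_mem (Finset.mem_univ _), Finset.card_univ,
        ZMod.card]
    have h3 : ∑' e : ℕ, (if decide (e ≠ 0) = false then ((p : ℝ≥0∞)⁻¹) ^ e else 0) = 1 := by
      rw [tsum_eq_single 0]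
      · simp
      · intro e he
        simp [he]
    rw [h2, h3, mul_one]
  · have h2 : ∑' e : ZMod p, (if decide (e = 0) = true then (1 : ℝ≥0∞) else 0) = 1 := by
      rw [tsum_eq_single 0]
      · simp
      · intro e he
        simp [he]
    rw [h2, tsum_geometric_pos hp.one_lt, ENNReal.mul_inv_cancel hp1 (ENNReal.natCast_ne_top _)]

theorem coprimeMatrix_pow {p : ℕ} (hp : p.Prime) (E : Cell m → ℕ) :
    CoprimeMatrix (fun c => p ^ E c) ↔ NonCrossing fun c => decide (E c ≠ 0) := by
  constructor
  · rintro ⟨-, h⟩ c c' hc ⟨h1, h2⟩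
    have := h c c' hc
    rw [Nat.coprime_pow_left_iff (Nat.pos_of_ne_zero (by simpa using h1)),
      Nat.coprime_pow_right_iff (Nat.pos_of_ne_zero (by simpa using h2)), Nat.coprime_self] at this
    exact hp.one_lt.ne' this
  · intro h
    refine ⟨fun c => pow_pos hp.pos _, fun c c' hc => ?_⟩
    have := h c c' hc
    simp only [ne_eq, decide_not, Bool.not_eq_true', decide_eq_false_iff_not, not_and, not_not]
      at this
    change Nat.Coprime (p ^ E c) (p ^ E c')
    by_cases h0 : E c = 0
    · rw [h0, pow_zero]
      exact Nat.coprime_one_left _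
    · rw [this h0, pow_zero]
      exact Nat.coprime_one_right _

open scoped Classical in
-- The square of the divisor function counts pairs of factorizations of p ^ k. The refinement
-- bijection makes each pair a matrix of powers of p, and coprimality of crossing entries says that
-- crossing exponents are not both nonzero.
theorem tsum_localTerm {p : ℕ} (hp : p.Prime) :
    ∑' k : ℕ, ENNReal.ofReal (localTerm (m + 1) p k) =
      ∑' E : Cell m → ℕ, (if NonCrossing fun c => decide (E c ≠ 0) then 1 else 0) *
        ∏ c, ((p : ℝ≥0∞)⁻¹) ^ E c := by
  have hp0 : (0 : ℝ) < p := by exact_mod_cast hp.pos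
  have h1 : ∀ k : ℕ, ENNReal.ofReal (localTerm (m + 1) p k) =
      ∑' E : Cell m → ℕ, if (NonCrossing fun c => decide (E c ≠ 0)) ∧ ∑ c, E c = k then
        ((p : ℝ≥0∞)⁻¹) ^ k else 0 := by
    intro k
    let F : (Fin (m + 1) → ℕ) × (Fin (m + 1) → ℕ) → ℝ≥0∞ := fun ab =>
      if ∏ i, ab.1 i = p ^ k then ((p : ℝ≥0∞)⁻¹) ^ k else 0
    have hval : ENNReal.ofReal (localTerm (m + 1) p k) =
        ∑' ab : (Fin (m + 1) → ℕ) × (Fin (m + 1) → ℕ), if EqualProducts ab then F ab else 0 := by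
      have hmem : ∀ a : Fin (m + 1) → ℕ, a ∈ Nat.finMulAntidiag (m + 1) (p ^ k) ↔
          ∏ i, a i = p ^ k := fun a => by
        rw [Nat.mem_finMulAntidiag]
        exact and_iff_left (pow_pos hp.pos _).ne'
      have hpos : ∀ a : Fin (m + 1) → ℕ, ∏ i, a i = p ^ k → ∀ i, 0 < a i := fun a ha i =>
        Nat.pos_of_ne_zero fun h0 => (pow_pos hp.pos k).ne'
          (ha ▸ Finset.prod_eq_zero (Finset.mem_univ i) h0)
      rw [tsum_eq_sum (s := Nat.finMulAntidiag (m + 1) (p ^ k) ×ˢ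
        Nat.finMulAntidiag (m + 1) (p ^ k))]
      · rw [Finset.sum_congr rfl (g := fun _ => ((p : ℝ≥0∞)⁻¹) ^ k), Finset.sum_const,
          Finset.card_product, localTerm, divisorFun, nsmul_eq_mul,
          ENNReal.ofReal_div_of_pos (by positivity), div_eq_mul_inv, ENNReal.ofReal_pow
          (Nat.cast_nonneg _), ENNReal.ofReal_pow (Nat.cast_nonneg _), ENNReal.ofReal_natCast,
          ENNReal.ofReal_natCast, ENNReal.inv_pow]
        · push_cast
          ring
        · intro ab hab
          rw [Finset.mem_product, hmem, hmem] at hab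
          rw [if_pos ⟨hpos _ hab.1, hpos _ hab.2, hab.1.trans hab.2.symm⟩]
          exact if_pos hab.1
      · intro ab hab
        rw [Finset.mem_product, hmem, hmem] at hab
        split_ifs with h
        · exact if_neg fun h' => hab ⟨h', h.2.2 ▸ h'⟩
        · rfl
    rw [hval, ← tsum_coprimeMatrix]
    have hinj : Function.Injective fun (E : Cell m → ℕ) c => p ^ E c := fun E E' h =>
      funext fun c => Nat.pow_right_injective hp.two_le (congrFun h c)
    rw [← hinj.tsum_eq]
    · refine tsum_congr fun E => ?_
      have hprod : ∏ i, (marginProducts fun c => p ^ E c).1 i = p ^ ∑ c, E c := by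
        simp only [marginProducts, Finset.prod_pow_eq_pow_sum]
        rw [Fintype.sum_prod_type]
      simp only [F, hprod, coprimeMatrix_pow hp, Nat.pow_right_inj hp.two_le, ← ite_and]
    · intro n hn
      rw [Function.mem_support] at hn
      have hn1 : ∏ i, (marginProducts n).1 i = p ^ k := by
        by_contra h
        apply hn
        simp only [F, if_neg h, ite_self]
      have hdvd : ∀ c, n c ∣ p ^ k := fun c => by
        rw [← hn1]
        exact (Finset.dvd_prod_of_mem (fun j => n (c.1, j)) (Finset.mem_univ c.2)).trans
          (Finset.dvd_prod_of_mem (marginProducts n).1 (Finset.mem_univ c.1))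
      choose E hE using fun c => (Nat.dvd_prime_pow hp).1 (hdvd c)
      exact ⟨E, funext fun c => (hE c).2.symm⟩
  simp_rw [h1]
  rw [ENNReal.tsum_comm]
  refine tsum_congr fun E => ?_
  rw [tsum_eq_single (∑ c, E c), Finset.prod_pow_eq_pow_sum]
  · simp
  · intro k hk
    exact if_neg fun h => hk h.2.symm

theorem localTerm_nonneg (k p e : ℕ) : 0 ≤ localTerm k p e := by
  unfold localTerm
  positivity

theorem card_nonCrossingResidues_eq {p : ℕ} (hp : p.Prime) [NeZero p] :
    ((nonCrossingResidues m p).card : ℝ≥0∞) = ((p - 1 : ℕ) : ℝ≥0∞) ^ (m + 1) ^ 2 *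
      ∑' k : ℕ, ENNReal.ofReal (localTerm (m + 1) p k) := by
  rw [tsum_localTerm hp, card_nonCrossingResidues hp]

/-- A nonzero multiple of the sum is the cardinality of a finite set, so the sum is finite. -/
theorem summable_localTerm {p : ℕ} (hp : p.Prime) : Summable (localTerm (m + 1) p) := by
  have : NeZero p := ⟨hp.ne_zero⟩
  have hp1 : ((p - 1 : ℕ) : ℝ≥0∞) ^ (m + 1) ^ 2 ≠ 0 :=
    pow_ne_zero _ (by exact_mod_cast (Nat.sub_pos_of_lt hp.one_lt).ne')
  have h : ∑' k : ℕ, ENNReal.ofReal (localTerm (m + 1) p k) ≠ ∞ := fun h => by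
    have := card_nonCrossingResidues_eq (m := m) hp
    rw [h, ENNReal.mul_top hp1] at this
    exact ENNReal.natCast_ne_top _ this
  exact (ENNReal.summable_toReal h).congr fun k => ENNReal.toReal_ofReal (localTerm_nonneg _ _ _)

/-- The Euler factor at `p` is the density of the matrices without crossing zeros modulo `p`. -/
theorem eulerFactor_eq {p : ℕ} (hp : p.Prime) [NeZero p] :
    eulerFactor (m + 1) p = (nonCrossingResidues m p).card / (p : ℝ) ^ (m + 1) ^ 2 := by
  have hp0 : (0 : ℝ) < p := by exact_mod_cast hp.pos
  have h := congrArg ENNReal.toReal (card_nonCrossingResidues_eq (m := m) hp)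
  rw [ENNReal.toReal_mul, ENNReal.toReal_pow, ENNReal.toReal_natCast, ENNReal.toReal_natCast,
    ← ENNReal.ofReal_tsum_of_nonneg (localTerm_nonneg _ _) (summable_localTerm hp),
    ENNReal.toReal_ofReal (tsum_nonneg (localTerm_nonneg _ _))] at h
  rw [eulerFactor, h, Nat.cast_sub hp.one_lt.le, Nat.cast_one, mul_div_right_comm, ← div_pow,
    sub_div, div_self hp0.ne']

end SteinhausMoments

namespace SteinhausMoments

open scoped ENNReal Topology

/-! ### Sieving by finitely many primes -/

variable {m : ℕ}

/-- No prime of `s` divides two crossing entries. -/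
def CoprimeAt (s : Finset Nat.Primes) (n : Cell m → ℕ) : Prop :=
  ∀ p ∈ s, ∀ c c', Crossing c c' → ¬((p : ℕ) ∣ n c ∧ (p : ℕ) ∣ n c')

theorem tsum_ite_pos (F : (Cell m → ℕ) → ℝ≥0∞) [∀ n : Cell m → ℕ, Decidable (∀ c, 0 < n c)] :
    ∑' n : Cell m → ℕ, (if ∀ c, 0 < n c then F n else 0) =
      ∑' n : Cell m → ℕ, F fun c => n c + 1 := by
  have hinj : Function.Injective fun (n : Cell m → ℕ) c => n c + 1 := fun n n' h =>
    funext fun c => Nat.succ_injective (congrFun h c)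
  rw [← hinj.tsum_eq]
  · exact tsum_congr fun n => if_pos fun c => Nat.succ_pos _
  · intro n hn
    have hpos : ∀ c, 0 < n c := by
      by_contra h
      exact hn (if_neg h)
    exact ⟨fun c => n c - 1, funext fun c => Nat.sub_add_cancel (hpos c)⟩

theorem tsum_residues {Q : ℕ} [NeZero Q] (F : (Cell m → ℕ) → ℝ≥0∞) :
    ∑' n : Cell m → ℕ, F (fun c => n c + 1) =
      ∑ r : Cell m → Fin Q, ∑' n : Cell m → ℕ, F fun c => Q * n c + ((r c : ℕ) + 1) := by
  let e : (Cell m → ℕ) ≃ (Cell m → ℕ) × (Cell m → Fin Q) :=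
    ((Equiv.refl (Cell m)).arrowCongr (Nat.divModEquiv Q)).trans
      (Equiv.arrowProdEquivProdArrow _ _ _)
  rw [← e.symm.tsum_eq, ENNReal.tsum_prod', ENNReal.tsum_comm, tsum_fintype]
  refine Finset.sum_congr rfl fun r _ => tsum_congr fun n => congrArg F (funext fun c => ?_)
  change n c * Q + r c + 1 = _
  ring

theorem coprimeAt_add_mul {s : Finset Nat.Primes} {Q : ℕ} (hQ : ∀ p ∈ s, (p : ℕ) ∣ Q)
    (n r : Cell m → ℕ) : CoprimeAt s (fun c => Q * n c + r c) ↔ CoprimeAt s r := by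
  refine forall₂_congr fun p hp => forall₃_congr fun c c' _ => ?_
  rw [Nat.dvd_add_right ((hQ p hp).mul_right _), Nat.dvd_add_right ((hQ p hp).mul_right _)]

instance (p : Nat.Primes) : NeZero (p : ℕ) := ⟨p.2.ne_zero⟩

open scoped Classical in
-- Chinese remainder theorem in each cell: the condition at p sees only the component modulo p.
theorem card_coprimeAt (s : Finset Nat.Primes) :
    (Finset.univ.filter fun r : Cell m → Fin (∏ p : s, ((p : Nat.Primes) : ℕ)) =>
      CoprimeAt s fun c => (r c : ℕ) + 1).card =
      ∏ p : s, (nonCrossingResidues m ((p : Nat.Primes) : ℕ)).card := by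
  set a : s → ℕ := fun p => ((p : Nat.Primes) : ℕ) with ha
  have hcop : Pairwise (Function.onFun Nat.Coprime a) := fun p q hpq =>
    (Nat.coprime_primes p.1.2 q.1.2).2 fun h => hpq (Subtype.ext (Subtype.ext h))
  have hQ : NeZero (∏ p, a p) := ⟨Finset.prod_ne_zero_iff.2 fun p _ => p.1.2.ne_zero⟩
  -- The representatives run from 1 to Q instead of 0 to Q - 1, since matrix entries are positive.
  have hbij : Function.Bijective fun r : Fin (∏ p, a p) =>
      (((r : ℕ) + 1 : ℕ) : ZMod (∏ p, a p)) := by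
    rw [Fintype.bijective_iff_injective_and_card]
    refine ⟨fun r r' h => Fin.ext ?_, by rw [Fintype.card_fin, ZMod.card]⟩
    have := Nat.ModEq.add_right_cancel' 1 ((ZMod.natCast_eq_natCast_iff _ _ _).1 h)
    exact this.eq_of_lt_of_lt r.2 r'.2
  let e : (Cell m → Fin (∏ p, a p)) ≃ ∀ p : s, Cell m → ZMod (a p) :=
    ((Equiv.refl (Cell m)).arrowCongr ((Equiv.ofBijective _ hbij).trans
      (ZMod.prodEquivPi a hcop).toEquiv)).trans (Equiv.piComm _)
  have he : ∀ r p c, e r p c = (((r c : ℕ) + 1 : ℕ) : ZMod (a p)) := fun r p c => by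
    change ZMod.prodEquivPi a hcop (((r c : ℕ) + 1 : ℕ) : ZMod (∏ p, a p)) p = _
    rw [map_natCast, Pi.natCast_apply]
  have hset : (Finset.univ.filter fun r : Cell m → Fin (∏ p, a p) =>
      CoprimeAt s fun c => (r c : ℕ) + 1).map e.toEmbedding =
      Fintype.piFinset fun p : s => nonCrossingResidues m (a p) := by
    ext f
    obtain ⟨r, rfl⟩ := e.surjective f
    rw [Finset.mem_map_equiv, Equiv.symm_apply_apply, Fintype.mem_piFinset, Finset.mem_filter]
    simp only [Finset.mem_univ, true_and, nonCrossingResidues, Finset.mem_filter, he, NonCrossing,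
      decide_eq_true_eq, ZMod.natCast_eq_zero_iff, CoprimeAt]
    exact ⟨fun h p => h p.1 p.2, fun h p hp => h ⟨p, hp⟩⟩
  rw [← Finset.card_map e.toEmbedding, hset, Fintype.card_piFinset]

open scoped Classical in
-- The condition is periodic modulo the product Q of the primes in `s`, so the sum splits into
-- finitely many progressions with equal limits. The proportion of admissible classes is the product
-- of the Euler factors.
theorem tendsto_sieve {σ : ℝ} (hσ₀ : 0 ≤ σ) (hσ : σ < 1 / 2) (s : Finset Nat.Primes) :
    Tendsto (fun x => (∑' n : Cell m → ℕ, if (∀ c, 0 < n c) ∧ CoprimeAt s n then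
      matrixWeight σ x n else 0) / ENNReal.ofReal (mainSize m σ x)) atTop
      (𝓝 (ENNReal.ofReal (∏ p ∈ s, eulerFactor (m + 1) p) * mainConst m σ)) := by
  set Q := ∏ p : s, ((p : Nat.Primes) : ℕ) with hQdef
  have hQ : NeZero Q := ⟨Finset.prod_ne_zero_iff.2 fun p _ => p.1.2.ne_zero⟩
  have hdvd : ∀ p ∈ s, (p : ℕ) ∣ Q := fun p hp =>
    Finset.dvd_prod_of_mem (fun p : s => ((p : Nat.Primes) : ℕ)) (Finset.mem_univ ⟨p, hp⟩)
  have h1 : ∀ x, (∑' n : Cell m → ℕ, if (∀ c, 0 < n c) ∧ CoprimeAt s n then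
      matrixWeight σ x n else 0) / ENNReal.ofReal (mainSize m σ x) =
      ∑ r ∈ Finset.univ.filter fun r : Cell m → Fin Q => CoprimeAt s fun c => (r c : ℕ) + 1,
        (∑' n : Cell m → ℕ, matrixWeight σ x fun c => Q * n c + ((r c : ℕ) + 1)) /
          ENNReal.ofReal (mainSize m σ x) := by
    intro x
    simp only [ite_and, div_eq_mul_inv]
    rw [tsum_ite_pos (fun n => if CoprimeAt s n then matrixWeight σ x n else 0),
      tsum_residues (Q := Q) (fun n => if CoprimeAt s n then matrixWeight σ x n else 0),
      ← Finset.sum_mul, Finset.sum_filter]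
    congr 1
    refine Finset.sum_congr rfl fun r _ => ?_
    simp only [coprimeAt_add_mul hdvd _ fun c => (r c : ℕ) + 1]
    split_ifs <;> simp
  simp_rw [h1]
  have hlim : ENNReal.ofReal (∏ p ∈ s, eulerFactor (m + 1) p) * mainConst m σ =
      ∑ r ∈ Finset.univ.filter fun r : Cell m → Fin Q => CoprimeAt s fun c => (r c : ℕ) + 1,
        ENNReal.ofReal (((Q : ℝ) ^ (m + 1) ^ 2)⁻¹) * mainConst m σ := by
    rw [Finset.sum_const, nsmul_eq_mul, card_coprimeAt, ← mul_assoc, ← ENNReal.ofReal_natCast,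
      ← ENNReal.ofReal_mul (Nat.cast_nonneg _)]
    congr 2
    rw [← Finset.prod_coe_sort s fun p => eulerFactor (m + 1) p, hQdef]
    push_cast
    rw [← Finset.prod_pow, ← Finset.prod_inv_distrib, ← Finset.prod_mul_distrib]
    refine Finset.prod_congr rfl fun p _ => ?_
    rw [eulerFactor_eq p.1.2, div_eq_mul_inv]
  rw [hlim]
  exact tendsto_finsetSum _ fun r _ => tendsto_tsum_progression hσ₀ hσ
    (fun c => Nat.succ_pos _) (fun c => (r c).2)

/-! ### The contribution of the remaining primes -/

open scoped Classical in
-- Take modulus p at the two positions and 1 elsewhere: the product of the inverse moduli is p⁻².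
-- That two entries are involved is what makes the sum over primes converge.
theorem tsum_dvd_le {σ : ℝ} (hσ₀ : 0 ≤ σ) {p : ℕ} (hp : 0 < p) {c c' : Cell m} (hc : c ≠ c')
    {x : ℝ} (hx : Real.exp 1 ≤ x) :
    ∑' n : Cell m → ℕ, (if (∀ c, 0 < n c) ∧ p ∣ n c ∧ p ∣ n c' then matrixWeight σ x n else 0) ≤
      ENNReal.ofReal (((p : ℝ) ^ 2)⁻¹) * (ENNReal.ofReal (mainSize m σ x) *
        ∫⁻ z, scaledMajorant m σ (Real.log 2) z) := by
  let q : Cell m → ℕ := fun d => if d = c ∨ d = c' then p else 1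
  have hq : ∀ d, 0 < q d := fun d => by
    simp only [q]
    split_ifs
    · exact hp
    · exact one_pos
  have hinj : Function.Injective fun (n : Cell m → ℕ) d => q d * n d + q d := fun n n' h =>
    funext fun d => Nat.eq_of_mul_eq_mul_left (hq d) (Nat.add_right_cancel (congrFun h d))
  have hprod : ∏ d, (q d : ℝ)⁻¹ = ((p : ℝ) ^ 2)⁻¹ := by
    have h1 : ∀ d, (q d : ℝ)⁻¹ = (if d = c then (p : ℝ)⁻¹ else 1) *
        (if d = c' then (p : ℝ)⁻¹ else 1) := fun d => by
      simp only [q]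
      by_cases h : d = c
      · have : d ≠ c' := fun h' => hc (h.symm.trans h')
        simp [h, hc]
      · by_cases h' : d = c' <;> simp [h, h']
        intro h''
        exact absurd h''.symm hc
    simp_rw [h1]
    rw [Finset.prod_mul_distrib, Finset.prod_ite_eq', Finset.prod_ite_eq']
    simp [pow_two]
  rw [← hprod]
  refine le_trans (le_of_eq ?_) (tsum_progression_le hσ₀ hq hx)
  rw [← hinj.tsum_eq]
  · refine tsum_congr fun n => if_pos ⟨fun d => Nat.add_pos_right _ (hq d), ?_, ?_⟩
    · simp only [q, true_or, if_true]
      exact ⟨n c + 1, by ring⟩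
    · simp only [q, or_true, if_true]
      exact ⟨n c' + 1, by ring⟩
  · intro n hn
    have hn' : (∀ c, 0 < n c) ∧ p ∣ n c ∧ p ∣ n c' := by
      by_contra h
      exact hn (if_neg h)
    have hd : ∀ d, q d ∣ n d := fun d => by
      simp only [q]
      split_ifs with h
      · rcases h with rfl | rfl
        · exact hn'.2.1
        · exact hn'.2.2
      · exact one_dvd _
    refine ⟨fun d => n d / q d - 1, funext fun d => ?_⟩
    have h1 : 1 ≤ n d / q d := Nat.div_pos (Nat.le_of_dvd (hn'.1 d) (hd d)) (hq d)
    calc q d * (n d / q d - 1) + q d = q d * (n d / q d - 1 + 1) := by ring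
      _ = n d := by rw [Nat.sub_add_cancel h1, Nat.mul_div_cancel' (hd d)]

open scoped Classical in
-- A matrix that survives the sieve without being coprime has a prime outside `s` dividing two
-- crossing entries. The excess is a union bound over that prime and the pair of positions.
theorem sieve_le {σ : ℝ} (hσ₀ : 0 ≤ σ) (s : Finset Nat.Primes) {x : ℝ} (hx : Real.exp 1 ≤ x) :
    (∑' n : Cell m → ℕ, if (∀ c, 0 < n c) ∧ CoprimeAt s n then matrixWeight σ x n else 0) ≤
      (∑' n : Cell m → ℕ, if CoprimeMatrix n then matrixWeight σ x n else 0) +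
      (∑' p : { p : Nat.Primes // p ∉ s }, ENNReal.ofReal ((((p : Nat.Primes) : ℝ) ^ 2)⁻¹)) *
        ((Fintype.card (Cell m × Cell m) : ℝ≥0∞) * (ENNReal.ofReal (mainSize m σ x) *
          ∫⁻ z, scaledMajorant m σ (Real.log 2) z)) := by
  set M := ENNReal.ofReal (mainSize m σ x) * ∫⁻ z : Margins m, scaledMajorant m σ (Real.log 2) z
  have h1 : ∀ n : Cell m → ℕ, (if (∀ c, 0 < n c) ∧ CoprimeAt s n then matrixWeight σ x n else 0) ≤
      (if CoprimeMatrix n then matrixWeight σ x n else 0) +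
      ∑' p : { p : Nat.Primes // p ∉ s }, ∑ d : Cell m × Cell m, if Crossing d.1 d.2 then
        (if (∀ c, 0 < n c) ∧ ((p : Nat.Primes) : ℕ) ∣ n d.1 ∧ ((p : Nat.Primes) : ℕ) ∣ n d.2 then
          matrixWeight σ x n else 0) else 0 := by
    intro n
    by_cases h : (∀ c, 0 < n c) ∧ CoprimeAt s n
    swap
    · rw [if_neg h]
      exact zero_le
    rw [if_pos h]
    by_cases hn : CoprimeMatrix n
    · rw [if_pos hn]
      exact le_self_add
    · have : ∃ c c', Crossing c c' ∧ ¬Nat.Coprime (n c) (n c') := by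
        by_contra! h'
        exact hn ⟨h.1, h'⟩
      obtain ⟨c, c', hc, hcop⟩ := this
      obtain ⟨p, hp, hpc, hpc'⟩ := Nat.Prime.not_coprime_iff_dvd.1 hcop
      have hps : (⟨p, hp⟩ : Nat.Primes) ∉ s := fun hs => h.2 _ hs c c' hc ⟨hpc, hpc'⟩
      refine le_trans ?_ le_add_self
      refine le_trans ?_ (ENNReal.le_tsum (⟨⟨p, hp⟩, hps⟩ : { p : Nat.Primes // p ∉ s }))
      refine le_trans ?_ (Finset.single_le_sum (fun _ _ => zero_le)
        (Finset.mem_univ ((c, c') : Cell m × Cell m)))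
      rw [if_pos hc, if_pos ⟨h.1, hpc, hpc'⟩]
  refine (ENNReal.tsum_le_tsum h1).trans ?_
  rw [ENNReal.tsum_add]
  gcongr
  rw [ENNReal.tsum_comm, ← ENNReal.tsum_mul_right]
  refine ENNReal.tsum_le_tsum fun p => ?_
  rw [Summable.tsum_finsetSum fun _ _ => ENNReal.summable]
  have h2 : ∀ d ∈ (Finset.univ : Finset (Cell m × Cell m)),
      ∑' n : Cell m → ℕ, (if Crossing d.1 d.2 then
        (if (∀ c, 0 < n c) ∧ ((p : Nat.Primes) : ℕ) ∣ n d.1 ∧ ((p : Nat.Primes) : ℕ) ∣ n d.2 then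
          matrixWeight σ x n else 0) else 0) ≤
        ENNReal.ofReal ((((p : Nat.Primes) : ℝ) ^ 2)⁻¹) * M := by
    intro d _
    by_cases hd : Crossing d.1 d.2
    · simp only [if_pos hd]
      exact tsum_dvd_le hσ₀ p.1.2.pos hd.ne hx
    · simp [if_neg hd]
  refine (Finset.sum_le_card_nsmul _ _ _ h2).trans (le_of_eq ?_)
  rw [nsmul_eq_mul, Finset.card_univ]
  ring

theorem coprimeMatrix_le_sieve (s : Finset Nat.Primes) {n : Cell m → ℕ} (hn : CoprimeMatrix n) :
    (∀ c, 0 < n c) ∧ CoprimeAt s n :=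
  ⟨hn.1, fun p _ c c' hc h => Nat.not_coprime_of_dvd_of_dvd p.2.one_lt h.1 h.2 (hn.2 c c' hc)⟩

/-! ### The arithmetic factor -/

theorem eulerFactor_pos (p : Nat.Primes) : 0 < eulerFactor (m + 1) p := by
  classical
  have hp0 : (0 : ℝ) < ((p : ℕ) : ℝ) := by exact_mod_cast p.2.pos
  have : Fact (p : ℕ).Prime := ⟨p.2⟩
  rw [eulerFactor_eq p.2]
  refine div_pos (Nat.cast_pos.2 (Finset.card_pos.2 ⟨fun _ => 1, ?_⟩)) (by positivity)
  rw [nonCrossingResidues, Finset.mem_filter]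
  exact ⟨Finset.mem_univ _, fun c c' _ h => by simp at h⟩

theorem card_zeros_at {p : ℕ} [NeZero p] {c c' : Cell m} (hc : c ≠ c') :
    (Finset.univ.filter fun r : Cell m → ZMod p => r c = 0 ∧ r c' = 0).card * p ^ 2 =
      p ^ (m + 1) ^ 2 := by
  classical
  have h : (Finset.univ.filter fun r : Cell m → ZMod p => r c = 0 ∧ r c' = 0) =
      Fintype.piFinset fun d => if d = c ∨ d = c' then {0} else Finset.univ := by
    ext r
    rw [Finset.mem_filter, Fintype.mem_piFinset]
    refine ⟨fun h d => ?_, fun h => ⟨Finset.mem_univ _, ?_, ?_⟩⟩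
    · split_ifs with hd
      · rcases hd with rfl | rfl
        · simpa using h.2.1
        · simpa using h.2.2
      · exact Finset.mem_univ _
    · simpa using h c
    · simpa using h c'
  rw [h, Fintype.card_piFinset]
  have h1 : ∀ d : Cell m, (if d = c ∨ d = c' then ({0} : Finset (ZMod p)) else Finset.univ).card *
      ((if d = c then p else 1) * (if d = c' then p else 1)) = p := by
    intro d
    by_cases h1 : d = c
    · simp [h1, hc]
    · by_cases h2 : d = c'
      · simp [h2, hc.symm]
      · simp [h1, h2, ZMod.card]
  have h2 : p ^ 2 = ∏ d : Cell m, ((if d = c then p else 1) * (if d = c' then p else 1)) := by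
    rw [Finset.prod_mul_distrib, Finset.prod_ite_eq', Finset.prod_ite_eq']
    simp [pow_two]
  rw [h2, ← Finset.prod_mul_distrib, Finset.prod_congr rfl fun d _ => h1 d, Finset.prod_const,
    Finset.card_univ]
  simp [pow_two]

/-- A matrix outside the counted set vanishes at two distinct positions modulo p, and for each pair
of positions this has density p⁻². -/
theorem abs_eulerFactor_sub_one_le (p : Nat.Primes) :
    |eulerFactor (m + 1) p - 1| ≤ Fintype.card (Cell m × Cell m) * (((p : ℕ) : ℝ) ^ 2)⁻¹ := by
  classical
  have hp0 : (0 : ℝ) < ((p : ℕ) : ℝ) := by exact_mod_cast p.2.pos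
  rw [eulerFactor_eq p.2]
  set N := nonCrossingResidues m (p : ℕ) with hN
  have hcard : Fintype.card (Cell m → ZMod (p : ℕ)) = (p : ℕ) ^ (m + 1) ^ 2 := by
    simp [pow_two, ZMod.card]
  have h1 : (N.card : ℝ) ≤ ((p : ℕ) : ℝ) ^ (m + 1) ^ 2 := by
    rw [← Nat.cast_pow, ← hcard]
    exact_mod_cast Finset.card_le_univ N
  have hsub : Finset.univ ⊆ N ∪ (Finset.univ : Finset (Cell m × Cell m)).biUnion fun d =>
      if d.1 ≠ d.2 then Finset.univ.filter fun r : Cell m → ZMod (p : ℕ) => r d.1 = 0 ∧ r d.2 = 0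
      else ∅ := by
    intro r _
    by_cases hr : r ∈ N
    · exact Finset.mem_union_left _ hr
    · refine Finset.mem_union_right _ ?_
      rw [hN, nonCrossingResidues, Finset.mem_filter] at hr
      simp only [Finset.mem_univ, true_and, NonCrossing, not_forall, not_not,
        decide_eq_true_eq] at hr
      obtain ⟨c, c', hc, h⟩ := hr
      refine Finset.mem_biUnion.2 ⟨(c, c'), Finset.mem_univ _, ?_⟩
      rw [if_pos hc.ne]
      exact Finset.mem_filter.2 ⟨Finset.mem_univ _, h⟩
  have h2 : ((p : ℕ) : ℝ) ^ (m + 1) ^ 2 ≤ N.card + Fintype.card (Cell m × Cell m) *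
      (((p : ℕ) : ℝ) ^ (m + 1) ^ 2 * (((p : ℕ) : ℝ) ^ 2)⁻¹) := by
    have h3 := (Finset.card_le_card hsub).trans ((Finset.card_union_le _ _).trans
      (Nat.add_le_add_left Finset.card_biUnion_le _))
    rw [Finset.card_univ, hcard] at h3
    have h4 : ((p : ℕ) : ℝ) ^ (m + 1) ^ 2 ≤ N.card + ∑ d : Cell m × Cell m,
        (((if d.1 ≠ d.2 then Finset.univ.filter fun r : Cell m → ZMod (p : ℕ) =>
          r d.1 = 0 ∧ r d.2 = 0 else ∅).card : ℕ) : ℝ) := by exact_mod_cast h3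
    refine h4.trans (add_le_add_right ((Finset.sum_le_card_nsmul _ _
      (((p : ℕ) : ℝ) ^ (m + 1) ^ 2 * (((p : ℕ) : ℝ) ^ 2)⁻¹) fun d _ => ?_).trans (le_of_eq ?_)) _)
    · by_cases hd : d.1 ≠ d.2
      · rw [if_pos hd, ← div_eq_mul_inv, le_div_iff₀ (by positivity)]
        exact_mod_cast (card_zeros_at hd).le
      · rw [if_neg hd, Finset.card_empty, Nat.cast_zero]
        positivity
    · rw [nsmul_eq_mul, Finset.card_univ]
  have hP : (0 : ℝ) < ((p : ℕ) : ℝ) ^ (m + 1) ^ 2 := by positivity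
  rw [abs_sub_comm, abs_of_nonneg (sub_nonneg.2 ((div_le_one hP).2 h1)), sub_le_iff_le_add,
    ← sub_le_iff_le_add', le_div_iff₀ hP]
  linarith

theorem summable_primes_inv_sq : Summable fun p : Nat.Primes => (((p : ℕ) : ℝ) ^ 2)⁻¹ :=
  (Real.summable_nat_pow_inv.2 one_lt_two).comp_injective Nat.Primes.coe_nat_injective

theorem summable_eulerFactor_sub_one :
    Summable fun p : Nat.Primes => eulerFactor (m + 1) p - 1 :=
  Summable.of_norm_bounded (summable_primes_inv_sq.mul_left _) abs_eulerFactor_sub_one_le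

theorem multipliable_eulerFactor : Multipliable fun p : Nat.Primes => eulerFactor (m + 1) p := by
  have := Real.multipliable_one_add_of_summable (summable_eulerFactor_sub_one (m := m))
  simpa using this

/-- Positive factors whose deviations from 1 are summable have a nonzero product. An asymptotic
equivalence needs this nonvanishing. -/
theorem arithFactor_ne_zero : arithFactor (m + 1) ≠ 0 := by
  have := tprod_one_add_ne_zero_of_summable
    (f := fun p : Nat.Primes => eulerFactor (m + 1) p - 1)
    (fun p => by simpa using (eulerFactor_pos p).ne') (summable_eulerFactor_sub_one.norm)
  simpa [arithFactor] using this

end SteinhausMoments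

namespace SteinhausMoments

open scoped ENNReal Topology

/-! ### The asymptotics of the moments -/

/-- Interchange of limits: the threshold for x may depend on s, but the error `ε s` does not depend
on x. -/
theorem tendsto_of_approx {ι : Type*} {l : Filter ι} [l.NeBot] {f : ℝ → ℝ} {g : ι → ℝ → ℝ}
    {G ε : ι → ℝ} {A : ℝ} (hg : ∀ s, Tendsto (g s) atTop (𝓝 (G s))) (hG : Tendsto G l (𝓝 A))
    (hε : Tendsto ε l (𝓝 0))
    (h : ∀ s, ∀ᶠ x in atTop, g s x - ε s ≤ f x ∧ f x ≤ g s x) : Tendsto f atTop (𝓝 A) := by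
  refine tendsto_order.2 ⟨fun a ha => ?_, fun a ha => ?_⟩
  · have h1 : Tendsto (fun s => G s - ε s) l (𝓝 A) := by simpa using hG.sub hε
    obtain ⟨s, hs⟩ := (h1.eventually (lt_mem_nhds ha)).exists
    filter_upwards [h s, ((hg s).sub_const (ε s)).eventually (lt_mem_nhds hs)] with x hx hx'
    exact hx'.trans_le hx.1
  · obtain ⟨s, hs⟩ := (hG.eventually (gt_mem_nhds ha)).exists
    filter_upwards [h s, (hg s).eventually (gt_mem_nhds hs)] with x hx hx'
    exact hx.2.trans_lt hx'

variable {m : ℕ}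

theorem isBounded_birkhoff : Bornology.IsBounded (birkhoff m) := by
  refine (Metric.isBounded_Icc (0 : Fin m × Fin m → ℝ) 1).subset fun w hw =>
    ⟨fun p => ?_, fun p => ?_⟩
  · exact hw (p.1.succ, p.2.succ)
  · have h := sum_completion_row_succ ((w, fun _ => 1) : Margins m) p.1
    have h' := Finset.single_le_sum (f := fun j => completion m (w, fun _ => 1) (p.1.succ, j))
      (fun j _ => hw _) (Finset.mem_univ p.2.succ)
    exact h'.trans h.le

theorem mainConst_ne_top (σ : ℝ) : mainConst m σ ≠ ∞ :=
  ENNReal.mul_ne_top isBounded_birkhoff.measure_lt_top.ne ENNReal.ofReal_ne_top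

theorem mainSize_pos (σ : ℝ) {x : ℝ} (hx : 1 < x) : 0 < mainSize m σ x :=
  mul_pos (Real.exp_pos _) (pow_pos (Real.log_pos hx) _)

theorem mainSize_eq (σ : ℝ) {x : ℝ} (hx : 0 < x) :
    mainSize m σ x = x ^ (((m + 1 : ℕ) : ℝ) * (1 - 2 * σ)) * Real.log x ^ m ^ 2 := by
  rw [mainSize, Real.rpow_def_of_pos hx]
  congr 2
  push_cast
  ring

open scoped Classical in
theorem IsMultiplicativeSteinhaus.tendsto_moment {Ω : Type*} [MeasurableSpace Ω] {P : Measure Ω}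
    [IsProbabilityMeasure P] {X : ℕ → Ω → ℂ} (hX : IsMultiplicativeSteinhaus P X) {σ : ℝ}
    (hσ₀ : 0 ≤ σ) (hσ : σ < 1 / 2) :
    Tendsto (fun x => moment P X (m + 1) σ x / mainSize m σ x) atTop
      (𝓝 (arithFactor (m + 1) * (mainConst m σ).toReal)) := by
  let N : Finset Nat.Primes → ℝ → ℝ≥0∞ := fun s x => (∑' n : Cell m → ℕ,
    if (∀ c, 0 < n c) ∧ CoprimeAt s n then matrixWeight σ x n else 0) /
      ENNReal.ofReal (mainSize m σ x)
  -- A bound free of x for the excess of `N s x` over the normalized moment; it is a tail of the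
  -- convergent sum of p⁻² over primes.
  let T : Finset Nat.Primes → ℝ≥0∞ := fun s =>
    (∑' p : { p : Nat.Primes // p ∉ s }, ENNReal.ofReal ((((p : Nat.Primes) : ℝ) ^ 2)⁻¹)) *
      ((Fintype.card (Cell m × Cell m) : ℝ≥0∞) * ∫⁻ z : Margins m,
        scaledMajorant m σ (Real.log 2) z)
  have hB : (Fintype.card (Cell m × Cell m) : ℝ≥0∞) * ∫⁻ z : Margins m,
      scaledMajorant m σ (Real.log 2) z ≠ ∞ :=
    ENNReal.mul_ne_top (ENNReal.natCast_ne_top _) (lintegral_scaledMajorant_ne_top hσ _)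
  have hsum : ∑' p : Nat.Primes, ENNReal.ofReal ((((p : Nat.Primes) : ℝ) ^ 2)⁻¹) ≠ ∞ :=
    summable_primes_inv_sq.tsum_ofReal_ne_top
  have hTt : ∀ s, T s ≠ ∞ := fun s =>
    ENNReal.mul_ne_top (ne_top_of_le_ne_top hsum
      (ENNReal.tsum_comp_le_tsum_of_injective Subtype.val_injective _)) hB
  have hNlim : ∀ s, Tendsto (N s) atTop
      (𝓝 (ENNReal.ofReal (∏ p ∈ s, eulerFactor (m + 1) p) * mainConst m σ)) := fun s =>
    tendsto_sieve hσ₀ hσ s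
  have hNtop : ∀ s : Finset Nat.Primes,
      ENNReal.ofReal (∏ p ∈ s, eulerFactor (m + 1) p) * mainConst m σ ≠ ∞ :=
    fun s => ENNReal.mul_ne_top ENNReal.ofReal_ne_top (mainConst_ne_top σ)
  have hdiv : ∀ x, 1 < x → ENNReal.ofReal (moment P X (m + 1) σ x / mainSize m σ x) =
      (∑' n : Cell m → ℕ, if CoprimeMatrix n then matrixWeight σ x n else 0) /
        ENNReal.ofReal (mainSize m σ x) := fun x hx => by
    rw [ENNReal.ofReal_div_of_pos (mainSize_pos σ hx), hX.ofReal_moment σ (by linarith)]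
  have hnn : ∀ x, 1 < x → 0 ≤ moment P X (m + 1) σ x / mainSize m σ x := fun x hx =>
    div_nonneg (integral_nonneg fun ω => by positivity) (mainSize_pos σ hx).le
  refine tendsto_of_approx (l := atTop) (g := fun s x => (N s x).toReal)
    (G := fun s => (∏ p ∈ s, eulerFactor (m + 1) p) * (mainConst m σ).toReal)
    (ε := fun s => (T s).toReal) (fun s => ?_) ?_ ?_ fun s => ?_
  · have := (ENNReal.tendsto_toReal (hNtop s)).comp (hNlim s)
    rwa [ENNReal.toReal_mul, ENNReal.toReal_ofReal
      (Finset.prod_nonneg fun p _ => (eulerFactor_pos p).le)] at this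
  · exact (multipliable_eulerFactor (m := m)).hasProd.mul_const _
  · have h1 := ENNReal.Tendsto.mul_const (ENNReal.tendsto_tsum_compl_atTop_zero hsum)
      (Or.inr hB)
    rw [zero_mul] at h1
    exact (ENNReal.tendsto_toReal ENNReal.zero_ne_top).comp h1
  · have hfin : ∀ᶠ x in atTop, N s x < ∞ :=
      (hNlim s).eventually (gt_mem_nhds (lt_top_iff_ne_top.2 (hNtop s)))
    filter_upwards [hfin, eventually_ge_atTop (Real.exp 1)] with x hx hxe
    have hx1 : 1 < x := (Real.one_lt_exp_iff.2 one_pos).trans_le hxe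
    have hM0 : ENNReal.ofReal (mainSize m σ x) ≠ 0 := by
      rw [Ne, ENNReal.ofReal_eq_zero, not_le]
      exact mainSize_pos σ hx1
    have hle : (∑' n : Cell m → ℕ, if CoprimeMatrix n then matrixWeight σ x n else 0) /
        ENNReal.ofReal (mainSize m σ x) ≤ N s x := by
      refine ENNReal.div_le_div_right (ENNReal.tsum_le_tsum fun n => ?_) _
      split_ifs with h1 h2 h2
      · exact le_rfl
      · exact absurd (coprimeMatrix_le_sieve s h1) h2
      · exact zero_le
      · exact le_rfl
    have hge : N s x ≤ (∑' n : Cell m → ℕ, if CoprimeMatrix n then matrixWeight σ x n else 0) /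
        ENNReal.ofReal (mainSize m σ x) + T s := by
      refine (ENNReal.div_le_div_right (sieve_le hσ₀ s hxe) _).trans (le_of_eq ?_)
      rw [ENNReal.add_div]
      congr 1
      rw [mul_left_comm (Fintype.card (Cell m × Cell m) : ℝ≥0∞), mul_left_comm,
        mul_comm (ENNReal.ofReal (mainSize m σ x)),
        ENNReal.mul_div_cancel_right hM0 ENNReal.ofReal_ne_top]
    rw [← hdiv x hx1] at hle hge
    constructor
    · rw [sub_le_iff_le_add]
      have := ENNReal.toReal_mono (ENNReal.add_ne_top.2 ⟨ENNReal.ofReal_ne_top, hTt s⟩) hge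
      rwa [ENNReal.toReal_add ENNReal.ofReal_ne_top (hTt s), ENNReal.toReal_ofReal
        (hnn x hx1)] at this
    · have := ENNReal.toReal_mono hx.ne hle
      rwa [ENNReal.toReal_ofReal (hnn x hx1)] at this

end SteinhausMoments

namespace SteinhausMoments

open scoped ENNReal Topology

/-! ### Absolute convergence of the integral defining `beta` -/

variable {m : ℕ}

/-- The variables attached to the rows, the one of the first row being `0`. -/
def rowVar {R : Type*} [Zero R] (s : Fin m ⊕ Fin (m + 1) → R) (i : Fin (m + 1)) : R :=
  Fin.cases (motive := fun _ => R) 0 (fun i => s (Sum.inl i)) i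

theorem rowVar_zero {R : Type*} [Zero R] (s : Fin m ⊕ Fin (m + 1) → R) : rowVar s 0 = 0 := rfl

theorem rowVar_succ {R : Type*} [Zero R] (s : Fin m ⊕ Fin (m + 1) → R) (i : Fin m) :
    rowVar s i.succ = s (Sum.inl i) := rfl

/-- The sum of the variables attached to the row and the column of a position. -/
def cellVar {R : Type*} [AddZeroClass R] (s : Fin m ⊕ Fin (m + 1) → R) (c : Cell m) : R :=
  rowVar s c.1 + s (Sum.inr c.2)

/-- Setting the first row variable to 0 merges the factors 1 / s_j with the factors 1 / (s_i + s_j)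
into one product over all positions. -/
theorem betaIntegrand_eq (s : Fin m ⊕ Fin (m + 1) → ℂ) :
    betaIntegrand (m + 1) s = Complex.exp (∑ l, s l) * ∏ c : Cell m, (cellVar s c)⁻¹ := by
  have h : ∏ c : Cell m, (cellVar s c)⁻¹ = (∏ j : Fin (m + 1), (s (Sum.inr j))⁻¹) *
      ∏ i : Fin m, ∏ j : Fin (m + 1), (s (Sum.inl i) + s (Sum.inr j))⁻¹ := by
    rw [Fintype.prod_prod_type,
      Fin.prod_univ_succ (f := fun i => ∏ j, (cellVar (m := m) s (i, j))⁻¹)]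
    simp only [cellVar, rowVar_zero, rowVar_succ, zero_add]
  rw [h, betaIntegrand]
  simp only [one_div]
  change (∏ i : Fin m, ∏ j : Fin (m + 1), (s (Sum.inl i) + s (Sum.inr j))⁻¹) *
    Complex.exp (∑ l : Fin m ⊕ Fin (m + 1), s l) * _ = _
  ring

theorem cellVar_linePoint (b t : Idx (m + 1) → ℝ) (c : Cell m) :
    cellVar (linePoint b t) c = (cellVar b c : ℝ) + (cellVar t c : ℝ) * Complex.I := by
  obtain ⟨i, j⟩ := c
  refine Fin.cases ?_ (fun i => ?_) i
  · simp [cellVar, rowVar_zero, linePoint]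
  · simp only [cellVar, rowVar_succ, linePoint]
    push_cast
    ring

theorem cellVar_pos {b : Idx (m + 1) → ℝ} (hb : ∀ l, 0 < b l) (c : Cell m) : 0 < cellVar b c := by
  obtain ⟨i, j⟩ := c
  refine Fin.cases ?_ (fun i => ?_) i
  · simpa [cellVar, rowVar_zero] using hb _
  · simpa [cellVar, rowVar_succ] using add_pos (hb _) (hb _)

/-- The crosses formed by a row and a column cover every position equally often. -/
theorem prod_cross (ψ : Cell m → ℝ) (hψ : ∀ c, 0 < ψ c) :
    ∏ d : Cell m, ((∏ i : Fin m, ψ (d.1.succAbove i, d.2)) * ∏ j, ψ (d.1, j)) =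
      (∏ c, ψ c) ^ (2 * m + 1) := by
  have h1 : ∀ f : Fin (m + 1) → ℝ, (∀ a, 0 < f a) →
      ∏ a : Fin (m + 1), ∏ i : Fin m, f (a.succAbove i) = (∏ a, f a) ^ m := by
    intro f hf
    have hne : ∏ a, f a ≠ 0 := (Finset.prod_pos fun a _ => hf a).ne'
    have h2 : ∏ a : Fin (m + 1), ∏ x, f x = (∏ a, f a) ^ (m + 1) := by simp
    rw [Finset.prod_congr rfl fun a _ => Fin.prod_univ_succAbove f a, Finset.prod_mul_distrib,
      pow_succ'] at h2
    exact mul_left_cancel₀ hne h2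
  rw [Finset.prod_mul_distrib, Fintype.prod_prod_type_right]
  -- Every position lies in the column part of m crosses, as the centre is omitted there, and in the
  -- row part of m + 1.
  have h3 : ∏ b, ∏ a, ∏ i : Fin m, ψ ((a : Fin (m + 1)).succAbove i, b) = (∏ c, ψ c) ^ m := by
    rw [Finset.prod_congr rfl fun b _ => h1 (fun x => ψ (x, b)) fun a => hψ _, Finset.prod_pow,
      ← Fintype.prod_prod_type_right]
  have h4 : ∏ d : Cell m, ∏ j, ψ (d.1, j) = (∏ c, ψ c) ^ (m + 1) := by
    rw [Fintype.prod_prod_type, Fintype.prod_prod_type, ← Finset.prod_pow]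
    simp
  rw [h3, h4, ← pow_add]
  congr 1
  ring

/-- The sums of variables along row `d.1` and column `d.2`. -/
def crossMap (d : Cell m) : (Fin m ⊕ Fin (m + 1) → ℝ) →ₗ[ℝ] (Fin m ⊕ Fin (m + 1) → ℝ) where
  toFun t := Sum.elim (fun i => cellVar t (d.1.succAbove i, d.2)) fun j => cellVar t (d.1, j)
  map_add' s t := by
    have h : ∀ i, rowVar (s + t) i = rowVar s i + rowVar t i := fun i => by
      refine Fin.cases ?_ (fun i => ?_) i
      · simp [rowVar_zero]
      · simp [rowVar_succ]
    ext (i | j) <;> simp only [Sum.elim_inl, Sum.elim_inr, Pi.add_apply, cellVar, h] <;> ring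
  map_smul' a t := by
    have h : ∀ i, rowVar (a • t) i = a * rowVar t i := fun i => by
      refine Fin.cases ?_ (fun i => ?_) i
      · simp [rowVar_zero]
      · simp [rowVar_succ]
    ext (i | j) <;> simp only [Sum.elim_inl, Sum.elim_inr, Pi.smul_apply, smul_eq_mul, cellVar, h,
      RingHom.id_apply] <;> ring

/-- If all sums along the cross vanish, all row variables equal the negative of the column variable
of the centre. The first row variable is 0, so everything vanishes. -/
theorem crossMap_injective (d : Cell m) : Function.Injective (crossMap d) := by
  rw [← LinearMap.ker_eq_bot, LinearMap.ker_eq_bot']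
  intro t ht
  have h1 : ∀ i : Fin m, rowVar t (d.1.succAbove i) + t (Sum.inr d.2) = 0 := fun i =>
    congrFun ht (Sum.inl i)
  have h2 : ∀ j, rowVar t d.1 + t (Sum.inr j) = 0 := fun j => congrFun ht (Sum.inr j)
  have h3 : ∀ x, rowVar t x = -t (Sum.inr d.2) := fun x => by
    rcases eq_or_ne x d.1 with rfl | hx
    · linarith [h2 d.2]
    · obtain ⟨i, rfl⟩ := Fin.exists_succAbove_eq hx
      linarith [h1 i]
  have h4 : t (Sum.inr d.2) = 0 := by
    have := h3 0
    rw [rowVar_zero] at this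
    linarith
  ext (i | j)
  · have := h3 i.succ
    rw [rowVar_succ, h4, neg_zero] at this
    exact this
  · have := h2 j
    rw [h3, h4, neg_zero, zero_add] at this
    exact this

theorem integrable_comp_of_injective {E : Type*} [NormedAddCommGroup E] [NormedSpace ℝ E]
    [MeasurableSpace E] [BorelSpace E] [FiniteDimensional ℝ E] (μ : Measure E)
    [μ.IsAddHaarMeasure] {f : E →ₗ[ℝ] E} (hf : Function.Injective f) {g : E → ℝ}
    (hg : Integrable g μ) : Integrable (fun x => g (f x)) μ := by
  have hdet : LinearMap.det f ≠ 0 :=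
    (LinearEquiv.isUnit_det' (LinearEquiv.ofInjectiveEndo f hf)).ne_zero
  have hmap := Measure.map_linearMap_addHaar_eq_smul_addHaar μ hdet
  refine Integrable.comp_measurable (g := g) (f := f) ?_
    f.continuous_of_finiteDimensional.measurable
  rw [hmap]
  exact hg.smul_measure ENNReal.ofReal_ne_top

/-- The 2m + 1 forms along one cross are independent, so a product over a single cross with decay
exponent above 1 is integrable by a linear change of variables. The full product is a geometric mean
of such products over all crosses, and the inequality of arithmetic and geometric means bounds it by
their average. -/
theorem integrable_prod_bracket (hm : 1 ≤ m) :
    Integrable fun t : Fin m ⊕ Fin (m + 1) → ℝ =>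
      ∏ c : Cell m, (1 + cellVar t c ^ 2) ^ (-(1 / 2) : ℝ) := by
  have hk : (0 : ℝ) < 2 * m + 1 := by positivity
  -- The weights (m + 1)⁻² and the multiplicity 2m + 1 of each position turn the exponent -p / 2
  -- into -1 / 2, which fixes p. The condition p > 1 amounts to m² > 0.
  set p : ℝ := ((m : ℝ) + 1) ^ 2 / (2 * m + 1) with hp
  have hp1 : 1 < p := by
    have hm' : (1 : ℝ) ≤ m := by exact_mod_cast hm
    rw [hp, lt_div_iff₀ hk]
    nlinarith
  set z : Cell m → (Fin m ⊕ Fin (m + 1) → ℝ) → ℝ := fun d t =>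
    ∏ l, (1 + ‖crossMap d t l‖ ^ 2) ^ (-p / 2) with hz
  have hintegrable : ∀ d, Integrable (z d) := by
    intro d
    refine integrable_comp_of_injective volume (crossMap_injective d)
      (g := fun x => ∏ l, (1 + ‖x l‖ ^ 2) ^ (-p / 2)) ?_
    exact Integrable.fintype_prod (f := fun _ (x : ℝ) => (1 + ‖x‖ ^ 2) ^ (-p / 2)) fun _ =>
      integrable_rpow_neg_one_add_norm_sq (by simpa using hp1)
  have hsum : Integrable fun t => ∑ d : Cell m, ((m : ℝ) + 1)⁻¹ ^ 2 * z d t :=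
    integrable_finsetSum _ fun d _ => (hintegrable d).const_mul _
  have hmeas : Measurable fun t : Fin m ⊕ Fin (m + 1) → ℝ =>
      ∏ c : Cell m, (1 + cellVar t c ^ 2) ^ (-(1 / 2) : ℝ) := by
    have h : ∀ c : Cell m, Measurable fun t : Fin m ⊕ Fin (m + 1) → ℝ => cellVar t c := by
      rintro ⟨i, j⟩
      refine Fin.cases ?_ (fun i => ?_) i
      · simp only [cellVar, rowVar_zero]
        fun_prop
      · simp only [cellVar, rowVar_succ]
        fun_prop
    fun_prop
  refine hsum.mono' hmeas.aestronglyMeasurable (ae_of_all _ fun t => ?_)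
  rw [Real.norm_of_nonneg (Finset.prod_nonneg fun c _ => by positivity)]
  have hψ : ∀ c : Cell m, 0 < 1 + cellVar t c ^ 2 := fun c => by positivity
  have hcross := prod_cross (fun c => 1 + cellVar t c ^ 2) hψ
  have hprod : ∀ d, (∏ i : Fin m, (1 + cellVar t (d.1.succAbove i, d.2) ^ 2)) *
      ∏ j, (1 + cellVar t (d.1, j) ^ 2) = ∏ l, (1 + ‖crossMap d t l‖ ^ 2) := by
    intro d
    rw [Fintype.prod_sum_type]
    simp only [Real.norm_eq_abs, sq_abs]
    rfl
  have hamgm := Real.geom_mean_le_arith_mean_weighted Finset.univ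
    (fun _ : Cell m => ((m : ℝ) + 1)⁻¹ ^ 2) (fun d => z d t) (fun _ _ => by positivity)
    (by
      rw [Finset.sum_const, Finset.card_univ, nsmul_eq_mul, Fintype.card_prod, Fintype.card_fin]
      push_cast
      field_simp) (fun d _ => Finset.prod_nonneg fun l _ => by positivity)
  refine le_trans (le_of_eq ?_) hamgm
  rw [Real.finsetProd_rpow _ _ (fun c _ => (hψ c).le)]
  have hzd : ∀ d, z d t ^ (((m : ℝ) + 1)⁻¹ ^ 2) =
      ((∏ i : Fin m, (1 + cellVar t (d.1.succAbove i, d.2) ^ 2)) *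
      ∏ j, (1 + cellVar t (d.1, j) ^ 2)) ^ (-(1 / (2 * (2 * m + 1))) : ℝ) := by
    intro d
    simp only [hz]
    rw [hprod, Real.finsetProd_rpow _ _ (fun l _ => by positivity), ← Real.rpow_mul
      (Finset.prod_nonneg fun l _ => by positivity)]
    congr 1
    rw [hp]
    field_simp
  rw [Finset.prod_congr rfl fun d _ => hzd d, Real.finsetProd_rpow _ _ (fun d _ =>
    mul_nonneg (Finset.prod_nonneg fun _ _ => (hψ _).le) (Finset.prod_nonneg fun _ _ => (hψ _).le)),
    hcross, ← Real.rpow_natCast, ← Real.rpow_mul (Finset.prod_nonneg fun _ _ => (hψ _).le)]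
  congr 1
  push_cast
  field_simp

theorem norm_inv_le {B : ℝ} (hB : 0 < B) (T : ℝ) :
    ‖((B : ℂ) + T * Complex.I)⁻¹‖ ≤ (min B 1)⁻¹ * (1 + T ^ 2) ^ (-(1 / 2) : ℝ) := by
  have hδ : 0 < min B 1 := lt_min hB one_pos
  have h1 : min B 1 * (1 + T ^ 2) ^ (1 / 2 : ℝ) ≤ ‖(B : ℂ) + T * Complex.I‖ := by
    rw [← Real.sqrt_eq_rpow, Complex.norm_add_mul_I]
    refine Real.le_sqrt_of_sq_le ?_
    rw [mul_pow, Real.sq_sqrt (by positivity)]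
    have h2 : min B 1 ^ 2 ≤ B ^ 2 := pow_le_pow_left₀ hδ.le (min_le_left _ _) 2
    have h3 : min B 1 ^ 2 ≤ 1 := pow_le_one₀ hδ.le (min_le_right _ _)
    nlinarith [sq_nonneg T]
  rw [norm_inv, Real.rpow_neg (by positivity), ← mul_inv]
  exact inv_anti₀ (by positivity) h1

theorem measurable_betaIntegrand (b : Idx (m + 1) → ℝ) :
    Measurable fun t : Idx (m + 1) → ℝ => betaIntegrand (m + 1) (linePoint b t) := by
  unfold betaIntegrand linePoint
  fun_prop

theorem integrable_prod_inv (hm : 1 ≤ m) {b : Idx (m + 1) → ℝ} (hb : ∀ l, 0 < b l) :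
    Integrable fun t : Idx (m + 1) → ℝ => ∏ c : Cell m, (cellVar (linePoint b t) c)⁻¹ := by
  have hmeas : Measurable fun t : Idx (m + 1) → ℝ =>
      ∏ c : Cell m, (cellVar (linePoint b t) c)⁻¹ := by
    have h : ∀ c : Cell m, Measurable fun t : Idx (m + 1) → ℝ => cellVar (linePoint b t) c := by
      rintro ⟨i, j⟩
      refine Fin.cases ?_ (fun i => ?_) i
      · simp only [cellVar, rowVar_zero, linePoint]
        fun_prop
      · simp only [cellVar, rowVar_succ, linePoint]
        fun_prop
    fun_prop
  refine ((integrable_prod_bracket hm).const_mul (∏ c, (min (cellVar b c) 1)⁻¹)).mono'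
    hmeas.aestronglyMeasurable (ae_of_all _ fun t => ?_)
  rw [norm_prod]
  refine (Finset.prod_le_prod (fun c _ => norm_nonneg _) fun c _ => ?_).trans
    (le_of_eq Finset.prod_mul_distrib)
  rw [cellVar_linePoint]
  exact norm_inv_le (cellVar_pos hb c) _

theorem exp_sum_linePoint (b t : Fin m ⊕ Fin (m + 1) → ℝ) :
    Complex.exp (∑ l : Fin m ⊕ Fin (m + 1), linePoint (k := m + 1) b t l) =
      Complex.exp ((∑ l, b l : ℝ) : ℂ) * Complex.exp ((∑ l, t l : ℝ) * Complex.I) := by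
  rw [← Complex.exp_add]
  congr 1
  simp only [linePoint]
  push_cast
  rw [Finset.sum_add_distrib, Finset.sum_mul]

theorem integrable_betaIntegrand (hm : 1 ≤ m) {b : Idx (m + 1) → ℝ} (hb : ∀ l, 0 < b l) :
    Integrable fun t : Idx (m + 1) → ℝ => betaIntegrand (m + 1) (linePoint b t) := by
  refine ((integrable_prod_inv hm hb).norm.const_mul
    (Real.exp (∑ l : Fin m ⊕ Fin (m + 1), b l))).mono'
    (measurable_betaIntegrand b).aestronglyMeasurable (ae_of_all _ fun t => le_of_eq ?_)
  rw [betaIntegrand_eq, norm_mul, exp_sum_linePoint, norm_mul, Complex.norm_exp_ofReal_mul_I,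
    mul_one, ← Complex.ofReal_exp, Complex.norm_real, Real.norm_of_nonneg (Real.exp_nonneg _)]

end SteinhausMoments

namespace SteinhausMoments

open scoped ENNReal Topology FourierTransform

/-! ### The integral defining `beta` as a volume -/

variable {m : ℕ}

/-- Pointwise Fourier inversion for the kernel without 2π in the exponent; rescaling the frequency
by 2π produces the power of 2π. -/
theorem integral_exp_mul_fourier {ι : Type*} [Fintype ι] {g R : (ι → ℝ) → ℂ} (hg : Integrable g)
    (hR : ∀ t, ∫ y, Complex.exp ((-∑ l, t l * y l : ℝ) * Complex.I) * g y = R t)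
    (hRi : Integrable R) {v : ι → ℝ} (hv : ContinuousAt g v) :
    ∫ t, Complex.exp ((∑ l, t l * v l : ℝ) * Complex.I) * R t =
      (2 * Real.pi : ℂ) ^ Fintype.card ι * g v := by
  have hπ : (0 : ℝ) < 2 * Real.pi := Real.two_pi_pos
  have e := PiLp.volume_preserving_toLp ι
  have he := (MeasurableEquiv.toLp 2 (ι → ℝ)).measurableEmbedding
  let f : EuclideanSpace ℝ ι → ℂ := fun y => g (WithLp.ofLp y)
  have hf : Integrable f := (e.integrable_comp_emb he).1 hg
  have hinner : ∀ x y : ι → ℝ, inner ℝ (WithLp.toLp 2 x : EuclideanSpace ℝ ι) (WithLp.toLp 2 y) =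
      ∑ l, x l * y l := fun x y => by
    simp [PiLp.inner_apply, mul_comm]
  have hF : ∀ t : ι → ℝ, 𝓕 f (WithLp.toLp 2 t) = R ((2 * Real.pi) • t) := fun t => by
    rw [Real.fourier_eq', ← e.integral_comp he, ← hR]
    refine integral_congr_ae (ae_of_all _ fun y => ?_)
    simp only [hinner, smul_eq_mul, f]
    congr 3
    simp only [Pi.smul_apply, smul_eq_mul, neg_mul, Finset.mul_sum]
    norm_num
    exact Finset.sum_congr rfl fun l _ => by ring
  have hFi : Integrable (𝓕 f) := by
    refine (e.integrable_comp_emb he).1 ?_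
    refine (hRi.comp_smul hπ.ne').congr (ae_of_all _ fun t => ?_)
    exact (hF t).symm
  have hc : ContinuousAt f (WithLp.toLp 2 v) :=
    ContinuousAt.comp (g := g) (f := fun y : EuclideanSpace ℝ ι => WithLp.ofLp y) hv
      (PiLp.continuous_ofLp 2 _).continuousAt
  have h := hf.fourierInv_fourier_eq hFi hc
  rw [Real.fourierInv_eq', ← e.integral_comp he] at h
  have h2 := Measure.integral_comp_smul_of_nonneg (volume : Measure (ι → ℝ))
    (fun t => Complex.exp ((∑ l, t l * v l : ℝ) * Complex.I) * R t) (2 * Real.pi) (hR := hπ.le)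
  have h3 : ∫ t : ι → ℝ, Complex.exp ((2 * Real.pi *
      inner ℝ (WithLp.toLp 2 t : EuclideanSpace ℝ ι) (WithLp.toLp 2 v) : ℝ) * Complex.I) •
      𝓕 f (WithLp.toLp 2 t) = ∫ t : ι → ℝ, Complex.exp
      ((∑ l, ((2 * Real.pi) • t) l * v l : ℝ) * Complex.I) * R ((2 * Real.pi) • t) := by
    refine integral_congr_ae (ae_of_all _ fun t => ?_)
    simp only [hinner, hF, smul_eq_mul, Pi.smul_apply, Finset.mul_sum, mul_assoc]
  rw [h3, h2, Module.finrank_fintype_fun_eq_card, Complex.real_smul] at h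
  change _ = g v at h
  rw [← h, ← mul_assoc]
  push_cast
  rw [mul_inv_cancel₀ (pow_ne_zero _ (by exact_mod_cast hπ.ne')), one_mul]

/-- The volume of the set of nonnegative matrices with the given margins. -/
noncomputable def fiberVol (y : Fin m ⊕ Fin (m + 1) → ℝ) : ℝ :=
  ∫ w : Fin m × Fin m → ℝ, ∏ c, (heaviside (completion m (w, y) c)).toReal

theorem prod_toReal_heaviside {ι : Type*} [Fintype ι] (u : ι → ℝ) :
    ∏ c, (heaviside (u c)).toReal = {u : ι → ℝ | ∀ c, 0 ≤ u c}.indicator 1 u := by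
  rw [← ENNReal.toReal_prod]
  by_cases h : ∀ c, 0 ≤ u c
  · rw [Set.indicator_of_mem (by exact h), prod_heaviside_eq_one fun c _ => h c]
    simp
  · rw [Set.indicator_of_notMem (by exact h), prod_heaviside_eq_zero (by simpa using h)]
    simp

theorem fiberVol_one : fiberVol (m := m) (fun _ => 1) = (volume (birkhoff m)).toReal := by
  have h : ∀ w : Fin m × Fin m → ℝ, ∏ c, (heaviside (completion m (w, fun _ => 1) c)).toReal =
      (birkhoff m).indicator 1 w := fun w => by
    rw [prod_toReal_heaviside]
    rfl
  simp only [fiberVol, h]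
  rw [integral_indicator_one measurableSet_birkhoff]
  rfl

/-- Dominated convergence: for almost every `w` no entry of the completed matrix with margins 1
vanishes, so each factor is continuous in the margins there. For margins below 2 the inner entries
stay in a fixed box. -/
theorem continuousAt_fiberVol : ContinuousAt (fiberVol (m := m)) fun _ => 1 := by
  refine continuousAt_of_dominated (bound := (Set.Icc 0 fun _ => 2).indicator 1)
    (Eventually.of_forall fun y => ?_) ?_ ?_ ?_
  · have h : ∀ c, Measurable fun w : Fin m × Fin m → ℝ => completion m (w, y) c := fun c =>
      (measurable_pi_apply c).comp (measurable_completion.comp (by fun_prop))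
    exact (Finset.measurable_prod _ fun c _ =>
      (measurable_heaviside.comp (h c)).ennreal_toReal).aestronglyMeasurable
  · have hnear : ∀ᶠ y : Fin m ⊕ Fin (m + 1) → ℝ in 𝓝 fun _ => 1, ∀ l, y l < 2 := by
      rw [eventually_all]
      exact fun l => (continuous_apply l).continuousAt.eventually_lt_const (by norm_num)
    filter_upwards [hnear] with y hy
    refine ae_of_all _ fun w => ?_
    rw [prod_toReal_heaviside]
    by_cases h : ∀ c, 0 ≤ completion m (w, y) c
    · have hw : ∀ i j, 0 ≤ w (i, j) := fun i j => h (i.succ, j.succ)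
      have hmem : w ∈ Set.Icc (0 : Fin m × Fin m → ℝ) fun _ => 2 := by
        refine ⟨fun p => hw p.1 p.2, fun p => ?_⟩
        have h1 := h (p.1.succ, 0)
        rw [completion_succ_zero] at h1
        have h2 := Finset.single_le_sum (f := fun j => w (p.1, j)) (fun j _ => hw p.1 j)
          (Finset.mem_univ p.2)
        have h3 := hy (Sum.inl p.1)
        simp only [Prod.mk.eta] at h1 h2
        change w p ≤ 2
        linarith
      rw [Set.indicator_of_mem (by exact h), Set.indicator_of_mem hmem]
      simp
    · rw [Set.indicator_of_notMem (by exact h), norm_zero]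
      exact Set.indicator_nonneg (by simp) _
  · rw [integrable_indicator_iff measurableSet_Icc]
    exact integrableOn_const isCompact_Icc.measure_lt_top.ne
  · filter_upwards [ae_all_iff.2 ae_completion_one_ne_zero] with w hw
    refine tendsto_finsetProd _ fun c _ => ?_
    refine (ENNReal.tendsto_toReal (heaviside_ne_top _)).comp ?_
    refine (continuousAt_heaviside (hw c)).tendsto.comp ?_
    have h : Continuous fun y => completion m (w, y) c :=
      (continuous_apply c).comp
        ((completion m).continuous_of_finiteDimensional.comp (by fun_prop))
    exact h.tendsto _

/-- Summing the row variables by rows and the column variables by columns produces the margins. The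
first row sum, which is not a coordinate, is met by the variable 0. -/
theorem sum_cellVar_mul_completion (s : Fin m ⊕ Fin (m + 1) → ℂ) (z : Margins m) :
    ∑ c, cellVar s c * (completion m z c : ℂ) = ∑ l, s l * (z.2 l : ℂ) := by
  have h1 : ∀ i : Fin m, ∑ j, (completion m z (i.succ, j) : ℂ) = (z.2 (Sum.inl i) : ℂ) :=
      fun i => by
      exact_mod_cast congrArg Complex.ofReal (sum_completion_row_succ z i)
  have h2 : ∀ j, ∑ i, (completion m z (i, j) : ℂ) = (z.2 (Sum.inr j) : ℂ) := fun j => by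
    exact_mod_cast congrArg Complex.ofReal (sum_completion_col z j)
  simp only [cellVar, add_mul, Finset.sum_add_distrib]
  rw [Fintype.sum_prod_type, Fintype.sum_prod_type_right, Fintype.sum_sum_type]
  congr 1
  · rw [Fin.sum_univ_succ]
    simp only [rowVar_zero, rowVar_succ, zero_mul, Finset.sum_const_zero, zero_add,
      ← Finset.mul_sum, h1]
  · simp only [← Finset.mul_sum, h2]

theorem integrable_heaviside_exp {S : ℂ} (hS : 0 < S.re) :
    Integrable fun u : ℝ => ((heaviside u).toReal : ℂ) * Complex.exp (-S * u) := by
  have h : ∀ u : ℝ, ((heaviside u).toReal : ℂ) * Complex.exp (-S * u) =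
      (Set.Ici 0).indicator (fun u : ℝ => Complex.exp (-S * u)) u := fun u => by
    by_cases hu : 0 ≤ u
    · simp [heaviside_of_nonneg hu, Set.mem_Ici.2 hu]
    · simp [heaviside_of_neg (not_le.1 hu), hu]
  simp only [h]
  rw [integrable_indicator_iff measurableSet_Ici, integrableOn_Ici_iff_integrableOn_Ioi]
  exact integrableOn_exp_mul_complex_Ioi (by simpa using hS) 0

theorem integral_heaviside_exp {S : ℂ} (hS : 0 < S.re) :
    ∫ u : ℝ, ((heaviside u).toReal : ℂ) * Complex.exp (-S * u) = S⁻¹ := by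
  have h : ∀ u : ℝ, ((heaviside u).toReal : ℂ) * Complex.exp (-S * u) =
      (Set.Ici 0).indicator (fun u : ℝ => Complex.exp (-S * u)) u := fun u => by
    by_cases hu : 0 ≤ u
    · simp [heaviside_of_nonneg hu, Set.mem_Ici.2 hu]
    · simp [heaviside_of_neg (not_le.1 hu), hu]
  simp only [h]
  rw [integral_indicator measurableSet_Ici, integral_Ici_eq_integral_Ioi,
    integral_exp_mul_complex_Ioi (by simpa using hS)]
  simp

/-- One integral over nonnegative matrices is computed twice: entry by entry it is a product of
one-dimensional Laplace integrals, and in the coordinates of `completion` the inner entries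
integrate to `fiberVol`. -/
theorem laplace_fiberVol {s : Fin m ⊕ Fin (m + 1) → ℂ} (hs : ∀ c : Cell m, 0 < (cellVar s c).re) :
    Integrable (fun y => (fiberVol y : ℂ) * Complex.exp (-∑ l, s l * (y l : ℂ))) ∧
      ∫ y, (fiberVol y : ℂ) * Complex.exp (-∑ l, s l * (y l : ℂ)) =
        ∏ c : Cell m, (cellVar s c)⁻¹ := by
  have hmp := measurePreserving_completion m
  let K : Cell m → ℝ → ℂ := fun c u => ((heaviside u).toReal : ℂ) * Complex.exp (-cellVar s c * u)
  have hK : Integrable fun u : Cell m → ℝ => ∏ c, K c (u c) :=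
    Integrable.fintype_prod fun c => integrable_heaviside_exp (hs c)
  have hKI : ∫ u : Cell m → ℝ, ∏ c, K c (u c) = ∏ c, (cellVar s c)⁻¹ := by
    rw [integral_fintype_prod_volume_eq_prod]
    exact Finset.prod_congr rfl fun c _ => integral_heaviside_exp (hs c)
  have hintegrable : Integrable (fun z => ∏ c, K c (completion m z c)) (volume.prod volume) :=
    hmp.integrable_comp_of_integrable hK
  have hval : ∫ z, ∏ c, K c (completion m z c) ∂(volume.prod volume) =
      ∏ c, (cellVar s c)⁻¹ := by
    have h := integral_map hmp.measurable.aemeasurable (f := fun u => ∏ c, K c (u c))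
      (by rw [hmp.map_eq]; exact hK.aestronglyMeasurable)
    rw [hmp.map_eq, hKI] at h
    exact h.symm
  have hfib : ∀ y, ∫ w, ∏ c, K c (completion m (w, y) c) =
      (fiberVol y : ℂ) * Complex.exp (-∑ l, s l * (y l : ℂ)) := by
    intro y
    rw [fiberVol, ← integral_complex_ofReal, ← integral_mul_const]
    refine integral_congr_ae (ae_of_all _ fun w => ?_)
    simp only [K]
    rw [Finset.prod_mul_distrib, ← Complex.exp_sum, ← sum_cellVar_mul_completion s (w, y)]
    push_cast
    simp only [neg_mul, Finset.sum_neg_distrib]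
  simp only [← hfib]
  exact ⟨hintegrable.integral_prod_right, by rw [← integral_prod_symm _ hintegrable, hval]⟩

/-- On the vertical lines the product of inverses is the Fourier transform of `fiberVol` damped by
exp (-∑ b_l y_l). Inversion at margins 1 returns the volume, and the factor exp (∑ b_l) of the
integrand cancels the damping, so the choice of `b` is immaterial. -/
theorem beta_eq (hm : 1 ≤ m) {b : Idx (m + 1) → ℝ} (hb : ∀ l, 0 < b l) :
    beta (m + 1) b = ((volume (birkhoff m)).toReal : ℂ) := by
  have hs : ∀ (t : Idx (m + 1) → ℝ) (c : Cell m), 0 < (cellVar (linePoint b t) c).re :=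
    fun t c => by
      rw [cellVar_linePoint]
      simpa using cellVar_pos hb c
  let g : (Fin m ⊕ Fin (m + 1) → ℝ) → ℂ := fun y =>
    (fiberVol y : ℂ) * Complex.exp (-∑ l : Fin m ⊕ Fin (m + 1), (b l : ℂ) * (y l : ℂ))
  let R : (Fin m ⊕ Fin (m + 1) → ℝ) → ℂ := fun t => ∏ c : Cell m, (cellVar (linePoint b t) c)⁻¹
  have hg : Integrable g := by
    refine (laplace_fiberVol (hs 0)).1.congr (ae_of_all _ fun y => ?_)
    simp [g, linePoint]
  have hR : ∀ t, ∫ y, Complex.exp ((-∑ l : Fin m ⊕ Fin (m + 1), t l * y l : ℝ) * Complex.I) *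
      g y = R t := fun t => by
    simp only [R]
    rw [← (laplace_fiberVol (hs t)).2]
    refine integral_congr_ae (ae_of_all _ fun y => ?_)
    simp only [g]
    rw [mul_left_comm, ← Complex.exp_add]
    congr 2
    simp only [linePoint, add_mul, Finset.sum_add_distrib]
    push_cast
    rw [neg_mul, Finset.sum_mul, neg_add, add_comm]
    congr 2
    exact Finset.sum_congr rfl fun l _ => by ring
  have hgc : ContinuousAt g fun _ => 1 := by
    refine ContinuousAt.mul (Complex.continuous_ofReal.continuousAt.comp continuousAt_fiberVol) ?_
    exact Continuous.continuousAt (by fun_prop)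
  have key := integral_exp_mul_fourier hg hR (integrable_prod_inv hm hb) hgc
  have hI : ∀ t : Fin m ⊕ Fin (m + 1) → ℝ, betaIntegrand (m + 1) (linePoint b t) =
      Complex.exp ((∑ l : Fin m ⊕ Fin (m + 1), b l : ℝ) : ℂ) *
        (Complex.exp ((∑ l : Fin m ⊕ Fin (m + 1), t l * 1 : ℝ) * Complex.I) * R t) := fun t => by
    rw [betaIntegrand_eq, exp_sum_linePoint, mul_assoc]
    simp only [mul_one, R]
  have hcard : Fintype.card (Fin m ⊕ Fin (m + 1)) = 2 * (m + 1) - 1 := by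
    simp only [Fintype.card_sum, Fintype.card_fin]
    omega
  have hval : ∫ t : Idx (m + 1) → ℝ, betaIntegrand (m + 1) (linePoint b t) =
      (2 * Real.pi : ℂ) ^ (2 * (m + 1) - 1) * (volume (birkhoff m)).toReal := by
    change ∫ t : Fin m ⊕ Fin (m + 1) → ℝ, betaIntegrand (m + 1) (linePoint b t) = _
    simp only [hI]
    rw [integral_const_mul, key, hcard, mul_left_comm]
    congr 1
    simp only [g, fiberVol_one]
    rw [mul_left_comm, ← Complex.exp_add]
    simp
  rw [beta, if_neg (by omega), integral_mul_const, hval, mul_pow]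
  have h1 : (2 * Real.pi : ℂ) ^ (2 * (m + 1) - 1) ≠ 0 :=
    pow_ne_zero _ (by exact_mod_cast Real.two_pi_pos.ne')
  have h2 : Complex.I ^ (2 * (m + 1) - 1) ≠ 0 := pow_ne_zero _ Complex.I_ne_zero
  field_simp

theorem volume_birkhoff_pos : 0 < (volume (birkhoff m)).toReal := by
  refine ENNReal.toReal_pos (ne_of_gt ?_) isBounded_birkhoff.measure_lt_top.ne
  have hc : Continuous fun w : Fin m × Fin m → ℝ => completion m (w, fun _ => 1) :=
    (completion m).continuous_of_finiteDimensional.comp (by fun_prop)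
  have ho : IsOpen {w : Fin m × Fin m → ℝ | ∀ c, 0 < completion m (w, fun _ => 1) c} := by
    simp only [Set.ofPred_forall]
    exact isOpen_iInter_of_finite fun c =>
      isOpen_lt continuous_const ((continuous_apply c).comp hc)
  -- The matrix with all entries 1 / (m + 1) is an interior point.
  refine (ho.measure_pos volume ⟨fun _ => ((m : ℝ) + 1)⁻¹, ?_⟩).trans_le
    (measure_mono fun w hw c => (hw c).le)
  have h0 : (0 : ℝ) < (m : ℝ) + 1 := by positivity
  have h1 : (m : ℝ) * ((m : ℝ) + 1)⁻¹ = 1 - ((m : ℝ) + 1)⁻¹ := by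
    field_simp
    ring
  have h2 : 0 < ((m : ℝ) + 1)⁻¹ := by positivity
  rintro ⟨i, j⟩
  refine Fin.cases (Fin.cases ?_ (fun j => ?_) j) (fun i => Fin.cases ?_ (fun j => ?_) j) i
  · rw [completion_zero_zero]
    simp only [Finset.sum_const, Finset.card_univ, Fintype.card_fin, nsmul_eq_mul, mul_one, h1]
    rw [mul_sub, mul_one, h1]
    linarith
  · rw [completion_zero_succ]
    simp only [Finset.sum_const, Finset.card_univ, Fintype.card_fin, nsmul_eq_mul, h1]
    linarith
  · rw [completion_succ_zero]
    simp only [Finset.sum_const, Finset.card_univ, Fintype.card_fin, nsmul_eq_mul, h1]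
    linarith
  · exact h2

/-- Without inner entries the volume is a point mass; this matches the convention β(1) = 1. -/
theorem volume_birkhoff_zero : volume (birkhoff 0) = 1 := by
  have h : birkhoff 0 = Set.univ := by
    refine Set.eq_univ_of_forall fun w c => ?_
    obtain rfl : c = (0, 0) := Prod.ext (Fin.eq_zero c.1) (Fin.eq_zero c.2)
    rw [completion_zero_zero]
    simp
  rw [h, Measure.volume_pi_eq_dirac (0 : Fin 0 × Fin 0 → ℝ)]
  simp

end SteinhausMoments

/-! ### The asymptotic formula -/

open SteinhausMoments in
theorem theorem1 {Ω : Type*} [MeasurableSpace Ω] (P : Measure Ω) [IsProbabilityMeasure P]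
    (X : ℕ → Ω → ℂ) (hX : IsMultiplicativeSteinhaus P X)
    (k : ℕ) (hk : 1 ≤ k) (σ : ℝ) (hσ₀ : 0 ≤ σ) (hσ₁ : σ < 1 / 2)
    (b : Idx k → ℝ) (hb : ∀ j, 0 < b j) :
    -- the product, the series and the integral that define `a(k)` and `β(k)` converge
    (∀ p : Nat.Primes, Summable (localTerm k p)) ∧
    Multipliable (fun p : Nat.Primes => eulerFactor k p) ∧
    (2 ≤ k → Integrable (fun t : Idx k → ℝ => betaIntegrand k (linePoint b t))) ∧
    (fun x : ℝ => (moment P X k σ x : ℂ)) ~[atTop]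
      (fun x : ℝ =>
        (arithFactor k : ℂ) * beta k b / ((1 - 2 * σ : ℝ) : ℂ) ^ (2 * k - 1) *
          ((Real.Gamma (2 * k - 1) / Real.Gamma k ^ 2 * x ^ ((k : ℝ) * (1 - 2 * σ)) *
            Real.log x ^ (k - 1) ^ 2 : ℝ) : ℂ)) := by
  obtain ⟨m, rfl⟩ : ∃ m, k = m + 1 := ⟨k - 1, by omega⟩
  refine ⟨fun p => summable_localTerm p.2, multipliable_eulerFactor,
    fun h => integrable_betaIntegrand (by omega) hb, ?_⟩
  have hτ : 0 < 1 - 2 * σ := by linarith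
  have hbeta : beta (m + 1) b = ((volume (birkhoff m)).toReal : ℂ) := by
    rcases Nat.eq_zero_or_pos m with rfl | hm
    · rw [volume_birkhoff_zero]
      simp [SteinhausMoments.beta]
    · exact beta_eq hm hb
  have hΓ₁ : Real.Gamma (2 * (m + 1 : ℕ) - 1) = (2 * m).factorial := by
    rw [← Real.Gamma_nat_eq_factorial]
    congr 1
    push_cast
    ring
  have hΓ₂ : Real.Gamma ((m + 1 : ℕ) : ℝ) = m.factorial := by
    rw [← Real.Gamma_nat_eq_factorial]
    norm_num
  set C : ℝ := arithFactor (m + 1) * (mainConst m σ).toReal with hC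
  have hCeq : C = arithFactor (m + 1) * ((volume (birkhoff m)).toReal *
      ((2 * m).factorial / (m.factorial : ℝ) ^ 2 / (1 - 2 * σ) ^ (2 * m + 1))) := by
    rw [hC, mainConst, ENNReal.toReal_mul, ENNReal.toReal_ofReal (by positivity)]
  have hC₀ : C ≠ 0 := by
    rw [hCeq]
    exact mul_ne_zero arithFactor_ne_zero (mul_ne_zero volume_birkhoff_pos.ne' (by positivity))
  have hreal : moment P X (m + 1) σ ~[atTop] fun x => C * mainSize m σ x := by
    refine (isEquivalent_iff_tendsto_one ?_).2 ?_
    · filter_upwards [eventually_gt_atTop 1] with x hx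
      exact mul_ne_zero hC₀ (mainSize_pos σ hx).ne'
    · have h := (hX.tendsto_moment (m := m) hσ₀ hσ₁).div_const C
      rw [div_self hC₀] at h
      refine h.congr fun x => ?_
      rw [Pi.div_apply, div_div, mul_comm C]
  -- Equivalence only involves norms of the difference and of the main term, so it passes from real
  -- to complex values.
  have hcast : (fun x : ℝ => (moment P X (m + 1) σ x : ℂ)) ~[atTop]
      fun x => ((C * mainSize m σ x : ℝ) : ℂ) := by
    refine IsLittleO.of_norm_norm ?_
    refine hreal.norm_norm.congr (fun x => ?_) fun x => ?_
    · simp only [Pi.sub_apply]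
      rw [← Complex.ofReal_sub, Complex.norm_real]
    · rw [Complex.norm_real]
  refine hcast.congr_right ?_
  filter_upwards [eventually_gt_atTop 0] with x hx
  rw [hbeta, hΓ₁, hΓ₂, mainSize_eq σ hx, hCeq, show 2 * (m + 1) - 1 = 2 * m + 1 by omega,
    Nat.add_sub_cancel]
  push_cast
  ring
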